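/- **Theorem 3.** Write $\bar a$ and $a$ for a pair of matching letters and let $L_D$ be the Dyck language generated by $S\to\bar a\,S\,a\,S\mid\varepsilon$. For $u,w\in L_D$ let $u\preceq w$ mean that $u$ results from $w$ by deleting zero or more matching pairs of letters. Let $h_0=\varepsilon$ and $h_{i+1}=\bar a\,h_i\,a\,\bar a\,h_i\,a$. A pushdown automaton (PDA) $P=(Q,\Sigma,\Gamma,\delta,q_0,\gamma_0)$ has finite sets $Q$, $\Sigma$, $\Gamma$ and a finite set $\delta\subseteq Q\times(\Sigma\cup\{\varepsilon\})\times\Gamma\times Q\times\Gamma^*$ of actions $(q,b,\gamma)\hookrightarrow(p,\xi)$; its moves are $(q,bw,\gamma\eta)\vdash(p,w,\xi\eta)$, the last component being the stack with its top on the left. Its size is $|P|=|Q|+|\Sigma|+|\Gamma|+|\delta|$. It is in *reduced form* if $|Q|=1$ and every action has $|\xi|\in\{0,2\}$. A *quasi-run* is a finite sequence of moves $I_0\vdash I_1\vdash\dots\vdash I_m$ that starts with a single stack symbol and ends with the empty stack; a *run* on $w\in\Sigma^*$ is a quasi-run from $(q_0,w,\gamma_0)$ that consumes all of $w$. The *footprint*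 of a quasi-run $r$ is $\alpha(r)=\bar a\,\alpha'(r)\in L_D$, where $\alpha'(r)=a$ if $m=1$, and $\alpha'(r)=a\,\bar a^{\,d}\,\alpha'(r_1)\cdots\alpha'(r_d)$ if $m>1$; here $d$ is the height of the stack of $I_1$, and $r_1,\dots,r_d$ are the consecutive quasi-runs into which $I_1,\dots,I_m$ splits, $r_i$ being the part that removes the $i$-th of these $d$ symbols. A run $r$ is *$k$-oscillating* if $k$ is the greatest $q$ with $h_q\preceq\alpha(r)$, and $L^{(k)}(P)$ is the set of words on which $P$ has a $k$-oscillating run. The *$k$-emptiness problem* asks, given $P$ and $k$, whether $L^{(k)}(P)\neq\emptyset$. Then the $k$-emptiness problem for PDAs in reduced form can be decided in $\mathrm{NSPACE}(k\log|P|)$, where for $k=0$ the bound is read as $\log|P|$. Precisely: there are a nondeterministic Turing machine $M$ with a two-way read-only input tape and finitely many work tapes, and a constant $c$, such that for every PDA $P$ in reduced form, every $k\ge 0$ and every encoding $x$ of $(P,k)$ (numbers, including $k$ and the names of states and symbols, written in binary): $M$ has an accepting computation on $x$ if and only if $L^{(k)}(P)\ne\emptyset$; every computation of $M$ on $x$ is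 finite; and every computation of $M$ on $x$ visits at most $c\cdot\max(k,1)\cdot\lfloor\log_2|P|\rfloor$ cells of each work tape. -/

import Mathlib

namespace Oscillation

/-! ### Dyck words, deletion of matching pairs, harmonics

`DyckStep.U` is the opening letter `ā`, `DyckStep.D` the closing letter `a`. -/

/-- The Dyck language, generated by the unambiguous grammar `S → ā S a S | ε`. -/
inductive IsDyck : List DyckStep → Prop
  | nil : IsDyck []
  | nest (u v : List DyckStep) : IsDyck u → IsDyck v →
      IsDyck (DyckStep.U :: u ++ DyckStep.D :: v)

/-- `DeletePair w w'`: the word `w'` results from `w` by deleting one matching pair. An occurrence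
of `ā` and a later occurrence of `a` in a Dyck word are a matching pair (children of the same node
of the parse tree) iff the factor strictly between them is a Dyck word. -/
def DeletePair (w w' : List DyckStep) : Prop :=
  ∃ x y z : List DyckStep, IsDyck y ∧
    w = x ++ DyckStep.U :: y ++ DyckStep.D :: z ∧ w' = x ++ y ++ z

/-- The ordering `u ⪯ w` : `u` results from `w` by deleting zero or more matching pairs. -/
def Embeds (u w : List DyckStep) : Prop :=
  Relation.ReflTransGen DeletePair w u

/-- Harmonics: `h₀ = ε`, `hᵢ₊₁ = ā hᵢ a ā hᵢ a`. -/
def dyckHarmonic : ℕ → List DyckStep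
  | 0 => []
  | i + 1 => (DyckStep.U :: dyckHarmonic i ++ [DyckStep.D]) ++
      (DyckStep.U :: dyckHarmonic i ++ [DyckStep.D])

/-- `k` is the rank of `w`: the greatest `q` with `h_q ⪯ w`. -/
def IsRank (w : List DyckStep) (k : ℕ) : Prop :=
  IsGreatest {q : ℕ | Embeds (dyckHarmonic q) w} k

/-! ### Pushdown automata and their runs -/

/-- A pushdown automaton with states `Q`, input alphabet `S` and stack alphabet `Γ`. An action
`(q, b, γ) ↪ (p, ξ)` is the tuple `(q, b, γ, p, ξ)`, with `b = none` for `ε`. -/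
structure PDA (Q S Γ : Type) where
  actions : Finset (Q × Option S × Γ × Q × List Γ)
  startState : Q
  startSymbol : Γ

/-- Instantaneous descriptors; the top of the stack is the head of the list. -/
structure ID (Q S Γ : Type) where
  state : Q
  tape : List S
  stack : List Γ

/-- `I / J = (state I, tape I, ξ)`, where `stack I = ξ ++ stack J`. -/
def ID.over {Q S Γ : Type} (I J : ID Q S Γ) : ID Q S Γ :=
  ⟨I.state, I.tape, I.stack.take (I.stack.length - J.stack.length)⟩

namespace PDA

variable {Q S Γ : Type}

/-- The size `|P| = |Q| + |Σ| + |Γ| + |δ|`. -/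
def size [Fintype Q] [Fintype S] [Fintype Γ] (P : PDA Q S Γ) : ℕ :=
  Fintype.card Q + Fintype.card S + Fintype.card Γ + P.actions.card

/-- Reduced form: a single state, and every action pops a symbol or replaces the topmost symbol
by two symbols. -/
def IsReduced (P : PDA Q S Γ) : Prop :=
  Subsingleton Q ∧ ∀ q b γ p ξ, (q, b, γ, p, ξ) ∈ P.actions → ξ.length = 0 ∨ ξ.length = 2

/-- Moves `(q, b w, γ ξ) ⊢ (p, w, ξ' ξ)` for actions `(q, b, γ) ↪ (p, ξ')`. -/
inductive Move (P : PDA Q S Γ) : ID Q S Γ → ID Q S Γ → Prop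
  | mk (q : Q) (b : Option S) (γ : Γ) (p : Q) (ξ' : List Γ) (w : List S) (ξ : List Γ) :
      (q, b, γ, p, ξ') ∈ P.actions →
      Move P ⟨q, b.toList ++ w, γ :: ξ⟩ ⟨p, w, ξ' ++ ξ⟩

/-- A quasi-run: a move sequence `I₀, …, I_m` whose first stack is a single symbol and whose last
stack is empty. -/
def IsQuasiRun (P : PDA Q S Γ) (r : List (ID Q S Γ)) : Prop :=
  r.IsChain P.Move ∧ (∃ I ∈ r.head?, I.stack.length = 1) ∧ (∃ J ∈ r.getLast?, J.stack = [])

/-- A run on input `w`. -/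
def IsRun (P : PDA Q S Γ) (w : List S) (r : List (ID Q S Γ)) : Prop :=
  P.IsQuasiRun r ∧ r.head? = some ⟨P.startState, w, [P.startSymbol]⟩ ∧
    (∃ J ∈ r.getLast?, J.tape = [])

end PDA

mutual

/-- `AlphaPrime r u` says `α'(r) = u` for a quasi-run `r = I₀, …, I_m`:
`α'(r) = a` if `m = 1`, and `α'(r) = a ā⋯ā α'(r₁)⋯α'(r_d)` with `d = |stack I₁|` letters `ā` if
`m > 1`, where `r₁, …, r_d` is the disassembly of `I₁, …, I_m`. -/
inductive AlphaPrime {Q S Γ : Type} : List (ID Q S Γ) → List DyckStep → Prop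
  | single (I₀ I₁ : ID Q S Γ) : AlphaPrime [I₀, I₁] [DyckStep.D]
  | more (I₀ I₁ I₂ : ID Q S Γ) (r : List (ID Q S Γ)) (u : List DyckStep) :
      Disassembly (I₁ :: I₂ :: r) u →
      AlphaPrime (I₀ :: I₁ :: I₂ :: r)
        (DyckStep.D :: List.replicate I₁.stack.length DyckStep.U ++ u)

/-- `Disassembly s u` : the move sequence `s` is cut into quasi-runs `r₁, …, r_d` and
`u = α'(r₁)⋯α'(r_d)`. If `s` starts with `I`, then `r₁` is the part of `s` up to the first later
position `J` whose stack is that of `I` without its topmost symbol, taken relative to `J`; the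
remaining quasi-runs disassemble the part of `s` from `J` on. -/
inductive Disassembly {Q S Γ : Type} : List (ID Q S Γ) → List DyckStep → Prop
  | nil (I : ID Q S Γ) : I.stack = [] → Disassembly [I] []
  | cons (I : ID Q S Γ) (t : List (ID Q S Γ)) (J : ID Q S Γ) (s : List (ID Q S Γ))
      (u v : List DyckStep) :
      I.stack ≠ [] → J.stack = I.stack.tail → (∀ K ∈ t, K.stack ≠ I.stack.tail) →
      AlphaPrime ((I :: t ++ [J]).map fun K => K.over J) u →
      Disassembly (J :: s) v →
      Disassembly (I :: t ++ J :: s) (u ++ v)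

end

/-- `u` is the footprint `α(r) = ā α'(r)` of the quasi-run `r`. -/
def IsFootprint {Q S Γ : Type} (r : List (ID Q S Γ)) (u : List DyckStep) : Prop :=
  ∃ v, AlphaPrime r v ∧ u = DyckStep.U :: v

/-- The quasi-run `r` has oscillation `k`: the rank of its footprint is `k`. -/
def IsOscillating {Q S Γ : Type} (r : List (ID Q S Γ)) (k : ℕ) : Prop :=
  ∃ u, IsFootprint r u ∧ IsRank u k

/-- The `k`-oscillating language `L^(k)(P)`. -/
def PDA.oscLanguage {Q S Γ : Type} (P : PDA Q S Γ) (k : ℕ) : Language S :=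
  {w | ∃ r, P.IsRun w r ∧ IsOscillating r k}

/-! ### Nondeterministic Turing machines with a read-only input tape -/

/-- Directions of a head move. -/
inductive Dir
  | left
  | stay
  | right

/-- What the input head sees: a letter of the input or one of the two end markers. -/
inductive InputCell (A : Type)
  | leftEnd
  | letter (a : A)
  | rightEnd

/-- A nondeterministic Turing machine with a two-way read-only input tape over the alphabet `A` and
finitely many read-write work tapes, each infinite to the right. A transition depends on the state
and the scanned cells, and chooses the new state, the move of the input head and, on each work
tape, the symbol written and the move of the head. -/
structure NTM (A : Type) where
  State : Type
  [finiteState : Finite State]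
  Symbol : Type
  [finiteSymbol : Finite Symbol]
  Tape : Type
  [finiteTape : Finite Tape]
  blank : Symbol
  start : State
  accept : State
  trans : State → InputCell A → (Tape → Symbol) → Set (State × Dir × (Tape → Symbol × Dir))

namespace NTM

variable {A : Type}

/-- Configurations: state, input head position, work tape contents and work head positions. Input
position `0` is the left end marker, and the right end marker follows the last letter. -/
structure Config (M : NTM A) where
  state : M.State
  inputHead : ℕ
  content : M.Tape → ℕ → M.Symbol
  head : M.Tape → ℕ

/-- The input tape `⊢ x ⊣`. -/
def inputCell (x : List A) : ℕ → InputCell A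
  | 0 => .leftEnd
  | n + 1 => match x[n]? with
    | some a => .letter a
    | none => .rightEnd

/-- Head moves on a tape with leftmost cell `0`; a left move on that cell has no effect. -/
def moveHead : Dir → ℕ → ℕ
  | .left, n => n - 1
  | .stay, n => n
  | .right, n => n + 1

/-- The initial configuration: all work tapes blank, all heads on the leftmost cell. -/
def init (M : NTM A) : M.Config :=
  ⟨M.start, 0, fun _ _ => M.blank, fun _ => 0⟩

/-- One step on input `x`. The input head never leaves `⊢ x ⊣`. -/
def Step (M : NTM A) (x : List A) (C C' : M.Config) : Prop :=
  ∃ q d f, (q, d, f) ∈ M.trans C.state (inputCell x C.inputHead)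
      (fun i => C.content i (C.head i)) ∧
    C'.state = q ∧
    C'.inputHead = min (moveHead d C.inputHead) (x.length + 1) ∧
    (∀ i, C'.content i = Function.update (C.content i) (C.head i) (f i).1) ∧
    (∀ i, C'.head i = moveHead (f i).2 (C.head i))

/-- Configurations reachable on input `x`. -/
def Reaches (M : NTM A) (x : List A) (C : M.Config) : Prop :=
  Relation.ReflTransGen (M.Step x) M.init C

/-- Some computation on `x` reaches the accepting state. -/
def Accepts (M : NTM A) (x : List A) : Prop :=
  ∃ C, M.Reaches x C ∧ C.state = M.accept

/-- Every computation on `x` is finite. -/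
def HaltsOn (M : NTM A) (x : List A) : Prop :=
  ¬ ∃ f : ℕ → M.Config, f 0 = M.init ∧ ∀ n, M.Step x (f n) (f (n + 1))

/-- Whatever the nondeterministic choices on input `x`, at most `s` cells (namely cells among
`0, …, s - 1`) of each work tape are visited. -/
def SpaceOn (M : NTM A) (x : List A) (s : ℕ) : Prop :=
  ∀ C, M.Reaches x C → ∀ i, C.head i < s

end NTM

/-! ### Instances of the `k`-emptiness problem as words -/

/-- The alphabet in which instances are written. -/
inductive Letter
  | bit (b : Bool)
  | comma
  | eps
  | action

/-- Binary notation (least significant bit first, no leading zeros), ended by a comma. -/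
def encodeNat (n : ℕ) : List Letter :=
  n.bits.map Letter.bit ++ [Letter.comma]

/-- An action, with states and symbols given by their numbers. -/
def encodeAction : ℕ × Option ℕ × ℕ × ℕ × List ℕ → List Letter
  | (q, b, γ, p, ξ) =>
    Letter.action :: encodeNat q ++
      (match b with
        | none => [Letter.eps, Letter.comma]
        | some a => encodeNat a) ++
      encodeNat γ ++ encodeNat p ++ ξ.flatMap encodeNat

/-- `x` is an encoding of the pair `(P, k)`: for some numbering of the states, input symbols and
stack symbols and some order of the actions, `x` lists `k`, the sizes of the three sets, the start
state, the start symbol and the actions. -/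
def IsEncoding {Q S Γ : Type} [Fintype Q] [Fintype S] [Fintype Γ]
    (P : PDA Q S Γ) (k : ℕ) (x : List Letter) : Prop :=
  ∃ (eQ : Q ≃ Fin (Fintype.card Q)) (eS : S ≃ Fin (Fintype.card S))
    (eΓ : Γ ≃ Fin (Fintype.card Γ)) (l : List (Q × Option S × Γ × Q × List Γ)),
    l.Nodup ∧ (∀ t, t ∈ l ↔ t ∈ P.actions) ∧
    x = encodeNat k ++ encodeNat (Fintype.card Q) ++ encodeNat (Fintype.card S) ++
      encodeNat (Fintype.card Γ) ++ encodeNat (eQ P.startState) ++ encodeNat (eΓ P.startSymbol) ++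
      l.flatMap fun t => encodeAction
        ((eQ t.1 : ℕ), t.2.1.map (fun a => (eS a : ℕ)), (eΓ t.2.2.1 : ℕ), (eQ t.2.2.2.1 : ℕ),
          t.2.2.2.2.map fun γ => (eΓ γ : ℕ))

end Oscillation

-- The rank of a Dyck word can be computed bottom-up once a second number is carried along: the
-- value of `w` is the pair `(r, t)` of its rank `r` and the least `t` such that `ā h_t a` does not
-- embed. A harmonic of positive index is a product of two equal factors. In a product it therefore
-- embeds into one factor, or its two halves go to different factors; this gives `joinVal`. In `ā w
-- a` the outer pair is of no use to a harmonic but serves one more nesting; this gives `nestVal`.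
-- That values compute ranks (`DyckVal.isRank_iff`) follows from two facts: values do not grow under
-- deletion (`DeletePair.eval_le`), and the bounds they give are attained (`DyckVal.embeds`).
--
-- A quasi-run of a reduced automaton is a binary derivation tree. A leaf has the value `(0, 1)`,
-- and a node whose subtrees have the values `a` and `b` has the value `joinVal (nestVal a) b`. So
-- the question is whether some tree over the start symbol has first component `k`
-- (`PDA.exists_mem_oscLanguage_iff`). At rank `q` only the values `(q, q + 1)` and `(q, q)` occur,
-- the shapes `single` and `double`.
--
-- Such a tree is guessed with a stack of goals, each a stack symbol with a shape at some level. A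
-- goal is replaced by goals for the two children of a guessed rule. With cost `2 * q + 1` for
-- `single` and `2 * q` for `double`, one child always costs strictly less than the goal and the
-- other at most as much. Meeting the cheaper child first keeps at most `2 * k + 1` goals on the
-- stack, each of logarithmic length. Levels are not stored with the goals: the current one is kept
-- in unary on a second stack, and `up` markers record the differences, `k` cells in all. Hence
-- there is no factor `log k`, even if `k` is large compared with `|P|`. Soundness and completeness
-- are `met_of_accIn` and `acc_of_hasVal`.
--
-- Halting and the space bound must hold on every computation. The Turing machine therefore first
-- marks `H = markedSpace ..` cells, of order `k log |P|`: it traverses a binary tree whose depth is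
-- the bit length of `k` and sweeps over the binary sizes of the automaton at each leaf. Pushes
-- beyond the mark fail, and a clock with `H` digits stops every computation. Its base is a constant
-- so large that it outlasts the number of configurations of height at most `H`, which is as long as
-- an accepting computation need be (`StackMachine.Acc.accIn`). These pieces meet in
-- `StackMachine.compile_spec`.

namespace Oscillation

/-! ### Ranks of Dyck words -/

/-- The value of a concatenation. The value of a Dyck word `w` is the pair of its rank and of the
least `t` such that `ā h_t a` does not embed into `w`. -/
def joinVal (v w : ℕ × ℕ) : ℕ × ℕ :=
  (max (max v.1 w.1) (min v.2 w.2), max v.2 w.2)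

/-- The value of `ā w a`, where `v` is the value of `w`. -/
def nestVal (v : ℕ × ℕ) : ℕ × ℕ := (v.1, v.1 + 1)

theorem joinVal_comm (v w : ℕ × ℕ) : joinVal v w = joinVal w v := by
  simp only [joinVal, Prod.mk.injEq]; omega

theorem joinVal_assoc (u v w : ℕ × ℕ) :
    joinVal (joinVal u v) w = joinVal u (joinVal v w) := by
  simp only [joinVal, max_assoc, min_max_distrib_left, min_max_distrib_right, Prod.mk.injEq,
    and_true]
  simp only [max_comm, max_left_comm, max_assoc]

theorem joinVal_left_comm (u v w : ℕ × ℕ) :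
    joinVal u (joinVal v w) = joinVal v (joinVal u w) := by
  rw [← joinVal_assoc, joinVal_comm u v, joinVal_assoc]

theorem zero_joinVal (v : ℕ × ℕ) : joinVal (0, 0) v = v := by
  simp [joinVal]

theorem joinVal_mono {u u' v v' : ℕ × ℕ} (h : u ≤ u') (h' : v ≤ v') :
    joinVal u v ≤ joinVal u' v' := by
  obtain ⟨h₁, h₂⟩ := h
  obtain ⟨h₃, h₄⟩ := h'
  constructor <;> simp only [joinVal] <;> omega

theorem nestVal_mono {u v : ℕ × ℕ} (h : u ≤ v) : nestVal u ≤ nestVal v := by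
  obtain ⟨h₁, h₂⟩ := h
  constructor <;> simp only [nestVal] <;> omega

/-- Dyck words with their values. -/
inductive DyckVal : List DyckStep → ℕ × ℕ → Prop
  | nil : DyckVal [] (0, 0)
  | nest {u v : List DyckStep} {a b : ℕ × ℕ} : DyckVal u a → DyckVal v b →
      DyckVal (DyckStep.U :: u ++ DyckStep.D :: v) (joinVal (nestVal a) b)

theorem IsDyck.exists_val {w : List DyckStep} (h : IsDyck w) : ∃ v, DyckVal w v := by
  induction h with
  | nil => exact ⟨_, .nil⟩
  | nest u v _ _ ihu ihv =>
    obtain ⟨a, ha⟩ := ihu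
    obtain ⟨b, hb⟩ := ihv
    exact ⟨_, .nest ha hb⟩

theorem DyckVal.isDyck {w : List DyckStep} {v : ℕ × ℕ} (h : DyckVal w v) : IsDyck w := by
  induction h with
  | nil => exact .nil
  | nest _ _ ihu ihv => exact .nest _ _ ihu ihv

/-- This is what makes `v ≤ nestVal v`: enclosing a word in a matching pair never lowers its value.
-/
theorem DyckVal.snd_le {w : List DyckStep} {v : ℕ × ℕ} (h : DyckVal w v) : v.2 ≤ v.1 + 1 := by
  induction h with
  | nil => simp
  | nest _ _ _ ihv => simp only [joinVal, nestVal]; omega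

/-- One letter of the evaluation of words that need not be balanced: the stack holds the values of
the factors that are still open. -/
def evalStep : List (ℕ × ℕ) → DyckStep → List (ℕ × ℕ)
  | st, .U => (0, 0) :: st
  | c :: s :: st, .D => joinVal s (nestVal c) :: st
  -- A closing letter without a partner is ignored. Any choice works that keeps the stack nonempty
  -- and the step monotone.
  | [c], .D => [c]
  | [], .D => []

theorem evalStep_ne_nil {st : List (ℕ × ℕ)} (h : st ≠ []) (a : DyckStep) :
    evalStep st a ≠ [] := by
  match st, a, h with
  | _, .U, _ => simp [evalStep]
  | [_], .D, _ => simp [evalStep]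
  | _ :: _ :: _, .D, _ => simp [evalStep]

theorem foldl_evalStep_ne_nil (w : List DyckStep) {st : List (ℕ × ℕ)} (h : st ≠ []) :
    w.foldl evalStep st ≠ [] := by
  induction w generalizing st with
  | nil => exact h
  | cons a w ih => exact ih (evalStep_ne_nil h a)

theorem evalStep_mono {st st' : List (ℕ × ℕ)} (h : List.Forall₂ (· ≤ ·) st st')
    (a : DyckStep) : List.Forall₂ (· ≤ ·) (evalStep st a) (evalStep st' a) := by
  cases a with
  | U => exact .cons le_rfl h
  | D =>
    match h with
    | .nil => exact .nil
    | .cons h .nil => exact .cons h .nil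
    | .cons h (.cons h' h'') => exact .cons (joinVal_mono h' (nestVal_mono h)) h''

theorem foldl_evalStep_mono (w : List DyckStep) {st st' : List (ℕ × ℕ)}
    (h : List.Forall₂ (· ≤ ·) st st') :
    List.Forall₂ (· ≤ ·) (w.foldl evalStep st) (w.foldl evalStep st') := by
  induction w generalizing st st' with
  | nil => exact h
  | cons a w ih => exact ih (evalStep_mono h a)

theorem DyckVal.foldl_evalStep {w : List DyckStep} {v : ℕ × ℕ} (h : DyckVal w v) (s : ℕ × ℕ)
    (st : List (ℕ × ℕ)) : w.foldl evalStep (s :: st) = joinVal s v :: st := by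
  induction h generalizing s st with
  | nil => simp [joinVal]
  | nest _ _ ihu ihv =>
    simp only [List.cons_append, List.foldl_cons, List.foldl_append, evalStep, ihu, ihv,
      zero_joinVal, joinVal_assoc]

/-- The context of the deleted pair need not be balanced, hence the evaluation with a stack. After
the prefix, the factor contributes `nestVal v` with the pair and `v` without it; the rest of the
word acts monotonically. -/
theorem DeletePair.eval_le {w w' : List DyckStep} (h : DeletePair w w') :
    List.Forall₂ (· ≤ ·) (w'.foldl evalStep [(0, 0)]) (w.foldl evalStep [(0, 0)]) := by
  obtain ⟨x, y, z, hy, rfl, rfl⟩ := h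
  obtain ⟨v, hv⟩ := hy.exists_val
  simp only [List.append_assoc, List.foldl_append, List.cons_append, List.foldl_cons]
  apply foldl_evalStep_mono
  obtain ⟨s, st, hs⟩ := List.exists_cons_of_ne_nil
    (foldl_evalStep_ne_nil x (List.cons_ne_nil ((0 : ℕ), (0 : ℕ)) []))
  rw [hs, hv.foldl_evalStep]
  simp only [evalStep]
  rw [hv.foldl_evalStep, zero_joinVal]
  refine .cons (joinVal_mono le_rfl ⟨le_rfl, hv.snd_le⟩) ?_
  exact List.forall₂_same.2 fun _ _ => le_rfl

theorem forall₂_le_trans {α : Type*} [Preorder α] {l₁ l₂ l₃ : List α}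
    (h : List.Forall₂ (· ≤ ·) l₁ l₂) (h' : List.Forall₂ (· ≤ ·) l₂ l₃) :
    List.Forall₂ (· ≤ ·) l₁ l₃ := by
  induction h generalizing l₃ with
  | nil => exact h'
  | cons h _ ih =>
    cases h' with
    | cons h₁ h₂ => exact .cons (h.trans h₁) (ih h₂)

theorem Embeds.eval_le {u w : List DyckStep} (h : Embeds u w) :
    List.Forall₂ (· ≤ ·) (u.foldl evalStep [(0, 0)]) (w.foldl evalStep [(0, 0)]) := by
  induction h with
  | refl => exact List.forall₂_same.2 fun _ _ => le_rfl
  | tail _ h ih => exact forall₂_le_trans h.eval_le ih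

theorem Embeds.val_le {u w : List DyckStep} {a b : ℕ × ℕ} (h : Embeds u w) (hu : DyckVal u a)
    (hw : DyckVal w b) : a ≤ b := by
  have := h.eval_le
  rw [hu.foldl_evalStep, hw.foldl_evalStep, zero_joinVal, zero_joinVal] at this
  cases this
  assumption

/-- The induction runs on the exact value `(q, q)`: two copies of `nestVal (q, q) = (q, q + 1)` join
to `(q + 1, q + 1)`. -/
theorem exists_dyckVal_harmonic (q : ℕ) : ∃ t, DyckVal (dyckHarmonic q) (q, t) := by
  suffices h : DyckVal (dyckHarmonic q) (q, q) from ⟨_, h⟩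
  induction q with
  | zero => exact .nil
  | succ q ih =>
    have := DyckVal.nest ih (DyckVal.nest ih .nil)
    simp only [joinVal, nestVal] at this
    simp only [dyckHarmonic]
    convert this using 1
    · simp
    · simp

theorem Embeds.trans {u v w : List DyckStep} (h : Embeds u v) (h' : Embeds v w) : Embeds u w :=
  Relation.ReflTransGen.trans h' h

theorem Embeds.context {u w : List DyckStep} (h : Embeds u w) (x z : List DyckStep) :
    Embeds (x ++ u ++ z) (x ++ w ++ z) := by
  refine Relation.ReflTransGen.lift (fun y => x ++ y ++ z) ?_ _ _ h
  rintro _ _ ⟨x', y, z', hy, rfl, rfl⟩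
  exact ⟨x ++ x', y, z' ++ z, hy, by simp, by simp⟩

theorem Embeds.append {u u' w w' : List DyckStep} (h : Embeds u w) (h' : Embeds u' w') :
    Embeds (u ++ u') (w ++ w') := by
  have h₁ := h.context [] w'
  have h₂ := h'.context u []
  simp only [List.nil_append, List.append_nil] at h₁ h₂
  exact h₂.trans h₁

theorem IsDyck.embeds_unnest {u v : List DyckStep} (hu : IsDyck u) :
    Embeds (u ++ v) (DyckStep.U :: u ++ DyckStep.D :: v) :=
  .single ⟨[], u, v, hu, by simp, by simp⟩

theorem IsDyck.nil_embeds {w : List DyckStep} (h : IsDyck w) : Embeds [] w := by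
  induction h with
  | nil => exact .refl
  | nest u v hu _ ihu ihv => exact (ihu.append ihv).trans hu.embeds_unnest

/-- Both components of the value are attained. Each maximum or minimum in `joinVal` names the part
of the word in which the embedding is to be found. -/
theorem DyckVal.embeds {w : List DyckStep} {v : ℕ × ℕ} (h : DyckVal w v) (q : ℕ) :
    (q ≤ v.1 → Embeds (dyckHarmonic q) w) ∧
      (q + 1 ≤ v.2 → Embeds (DyckStep.U :: dyckHarmonic q ++ [DyckStep.D]) w) := by
  induction h generalizing q with
  | nil =>
    refine ⟨fun h => ?_, fun h => by simp at h⟩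
    obtain rfl : q = 0 := by simpa using h
    exact .refl
  | @nest u v a b hu hv ihu ihv =>
    have keep : ∀ r, r ≤ a.1 → Embeds (DyckStep.U :: dyckHarmonic r ++ [DyckStep.D])
        (DyckStep.U :: u ++ [DyckStep.D]) := fun r hr => by
      simpa using ((ihu r).1 hr).context [DyckStep.U] [DyckStep.D]
    have left : Embeds (DyckStep.U :: u ++ [DyckStep.D]) (DyckStep.U :: u ++ DyckStep.D :: v) := by
      simpa using hv.isDyck.nil_embeds.context (DyckStep.U :: u ++ [DyckStep.D]) []
    have right : Embeds v (DyckStep.U :: u ++ DyckStep.D :: v) := by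
      refine Embeds.trans ?_ hu.isDyck.embeds_unnest
      simpa using hu.isDyck.nil_embeds.context [] v
    constructor
    · intro hq
      simp only [joinVal, nestVal, le_max_iff] at hq
      rcases hq with (hq | hq) | hq
      · refine Embeds.trans ((ihu q).1 hq) (Embeds.trans ?_ left)
        simpa using hu.isDyck.embeds_unnest (v := [])
      · exact ((ihv q).1 hq).trans right
      · cases q with
        | zero => exact (IsDyck.nest _ _ hu.isDyck hv.isDyck).nil_embeds
        | succ r =>
          -- The case of the minimum: one half of the harmonic goes into the first factor, the other
          -- half into the second.
          have := (keep r (by omega)).append ((ihv r).2 (by omega))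
          simpa [dyckHarmonic] using this
    · intro hq
      simp only [joinVal, nestVal, le_max_iff] at hq
      rcases hq with hq | hq
      · exact (keep q (by omega)).trans left
      · exact ((ihv q).2 hq).trans right

/-- The rank of a Dyck word is the first component of its value. -/
theorem DyckVal.isRank_iff {w : List DyckStep} {v : ℕ × ℕ} (h : DyckVal w v) (k : ℕ) :
    IsRank w k ↔ v.1 = k := by
  have hv : IsGreatest {q : ℕ | Embeds (dyckHarmonic q) w} v.1 := by
    refine ⟨(h.embeds v.1).1 le_rfl, fun q hq => ?_⟩
    obtain ⟨t, ht⟩ := exists_dyckVal_harmonic q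
    exact (Embeds.val_le hq ht h).1
  exact ⟨fun hk => hv.unique hk, fun hk => hk ▸ hv⟩

end Oscillation

namespace Oscillation

/-! ### Runs as derivation trees -/

variable {Q S Γ : Type}

/-- `γ → ξ` : some action replaces the topmost symbol `γ` by `ξ`. -/
def PDA.Rule (P : PDA Q S Γ) (γ : Γ) (ξ : List Γ) : Prop :=
  ∃ q b p, (q, b, γ, p, ξ) ∈ P.actions

/-- `P.Derives γ u`: some quasi-run from `γ` has the footprint `ā u`. -/
inductive PDA.Derives (P : PDA Q S Γ) : Γ → List DyckStep → Prop
  | leaf {γ : Γ} : P.Rule γ [] → Derives P γ [DyckStep.D]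
  | node {γ l r : Γ} {u v : List DyckStep} : P.Rule γ [l, r] → Derives P l u → Derives P r v →
      Derives P γ (DyckStep.D :: DyckStep.U :: DyckStep.U :: (u ++ v))

/-- `P.HasVal γ a`: some quasi-run from `γ` has a footprint of value `a`. -/
inductive PDA.HasVal (P : PDA Q S Γ) : Γ → ℕ × ℕ → Prop
  | leaf {γ : Γ} : P.Rule γ [] → HasVal P γ (0, 1)
  | node {γ l r : Γ} {a b : ℕ × ℕ} : P.Rule γ [l, r] → HasVal P l a → HasVal P r b →
      HasVal P γ (joinVal (nestVal a) b)

theorem dyckVal_cons_cons {w : List DyckStep} {b : ℕ × ℕ} (h : DyckVal w b) :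
    DyckVal (DyckStep.U :: DyckStep.D :: w) (joinVal (0, 1) b) :=
  DyckVal.nest .nil h

/-- A node has the footprint `ā a` followed by this word. Its first `ā` encloses the whole footprint
`ā a u` of the left subtree and is closed by the first letter of `α'` of the right one. -/
theorem dyckVal_node {u v : List DyckStep} {a b : ℕ × ℕ} (hu : DyckVal u a) (hv : DyckVal v b) :
    DyckVal (DyckStep.U :: DyckStep.U :: (DyckStep.D :: u ++ DyckStep.D :: v))
      (joinVal (nestVal (joinVal (0, 1) a)) b) := by
  simpa using DyckVal.nest (dyckVal_cons_cons hu) hv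

/-- The factor `ā a` at the front of the footprint, of value `(0, 1)`, may be moved past the left
subtree since `joinVal` is commutative. There it completes `v` to the footprint of the right
subtree, which yields the recursion of `HasVal`. -/
theorem PDA.Derives.exists_val {P : PDA Q S Γ} {γ : Γ} {u : List DyckStep} (h : P.Derives γ u) :
    ∃ w b, u = DyckStep.D :: w ∧ DyckVal w b ∧ P.HasVal γ (joinVal (0, 1) b) := by
  induction h with
  | leaf h => exact ⟨[], _, rfl, .nil, by simpa [joinVal] using .leaf h⟩
  | node h _ _ ihl ihr =>
    obtain ⟨u, a, rfl, hu, hl⟩ := ihl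
    obtain ⟨v, b, rfl, hv, hr⟩ := ihr
    refine ⟨_, _, rfl, dyckVal_node hu hv, ?_⟩
    rw [joinVal_left_comm]
    exact .node h hl hr

theorem PDA.HasVal.exists_derives {P : PDA Q S Γ} {γ : Γ} {a : ℕ × ℕ} (h : P.HasVal γ a) :
    ∃ w b, P.Derives γ (DyckStep.D :: w) ∧ DyckVal w b ∧ a = joinVal (0, 1) b := by
  induction h with
  | leaf h => exact ⟨[], _, .leaf h, .nil, by simp [joinVal]⟩
  | node h _ _ ihl ihr =>
    obtain ⟨u, a, hl, hu, rfl⟩ := ihl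
    obtain ⟨v, b, hr, hv, rfl⟩ := ihr
    refine ⟨_, _, .node h hl hr, dyckVal_node hu hv, ?_⟩
    rw [joinVal_left_comm]

/-- For each rank this leaves two possible values, so one bit beside the level describes a goal. -/
theorem PDA.HasVal.snd {P : PDA Q S Γ} {γ : Γ} {a : ℕ × ℕ} (h : P.HasVal γ a) :
    1 ≤ a.2 ∧ a.1 ≤ a.2 ∧ a.2 ≤ a.1 + 1 := by
  induction h with
  | leaf => simp
  | node _ _ _ ihl ihr => simp only [joinVal, nestVal]; omega

theorem exists_hasVal_iff_exists_derives (P : PDA Q S Γ) (γ : Γ) (k : ℕ) :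
    (∃ t, P.HasVal γ (k, t)) ↔ ∃ u, P.Derives γ u ∧ IsRank (DyckStep.U :: u) k := by
  constructor
  · rintro ⟨t, h⟩
    obtain ⟨w, b, hd, hw, hb⟩ := h.exists_derives
    refine ⟨_, hd, ((dyckVal_cons_cons hw).isRank_iff k).2 ?_⟩
    rw [← hb]
  · rintro ⟨u, hu, hk⟩
    obtain ⟨w, b, rfl, hw, hv⟩ := hu.exists_val
    have := ((dyckVal_cons_cons hw).isRank_iff k).1 hk
    exact ⟨(joinVal (0, 1) b).2, by rw [← this]; exact hv⟩

/-! #### From runs to derivations -/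

theorem getLast?_map_concat {α β : Type*} (f : α → β) (l : List α) (a : α) :
    ((l ++ [a]).map f).getLast? = some (f a) := by
  simp

/-- Along a chain of moves that does not come down to the stack `η`, everything happens
above `η`. -/
theorem PDA.isChain_map_over {P : PDA Q S Γ} {η : List Γ} (t : List (ID Q S Γ))
    (I J : ID Q S Γ) (hc : (I :: t ++ [J]).IsChain P.Move) (hI : ∃ ξ, ξ ≠ [] ∧ I.stack = ξ ++ η)
    (ht : ∀ K ∈ t, K.stack ≠ η) (hJ : J.stack = η) :
    ((I :: t ++ [J]).map fun K => K.over J).IsChain P.Move := by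
  have hover : ∀ K : ID Q S Γ, ∀ ξ, K.stack = ξ ++ η → K.over J = ⟨K.state, K.tape, ξ⟩ := by
    intro K ξ h
    simp [ID.over, h, hJ]
  have move : ∀ K K' : ID Q S Γ, P.Move K K' → (∃ ξ, ξ ≠ [] ∧ K.stack = ξ ++ η) →
      P.Move (K.over J) (K'.over J) ∧ ∃ ξ, K'.stack = ξ ++ η := by
    rintro K K' ⟨q, b, γ, p, ξ', w, ζ, hmem⟩ ⟨ξ, hξ, hs⟩
    obtain ⟨γ', ξ, rfl⟩ := List.exists_cons_of_ne_nil hξ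
    simp only [List.cons_append, List.cons.injEq] at hs
    obtain ⟨rfl, rfl⟩ := hs
    rw [hover _ (γ :: ξ) (by simp), hover _ (ξ' ++ ξ) (by simp)]
    exact ⟨.mk q b γ p ξ' w ξ hmem, ξ' ++ ξ, by simp⟩
  induction t generalizing I with
  | nil =>
    simp only [List.cons_append, List.nil_append, List.isChain_cons_cons] at hc
    simpa using (move _ _ hc.1 hI).1
  | cons K t ih =>
    simp only [List.cons_append, List.isChain_cons_cons] at hc
    obtain ⟨h₁, ξ, h₂⟩ := move _ _ hc.1 hI
    have hξ : ξ ≠ [] := by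
      rintro rfl
      exact ht K (by simp) h₂
    have := ih K hc.2 ⟨ξ, hξ, h₂⟩ fun L hL => ht L (by simp [hL])
    simp only [List.cons_append, List.map_cons, List.isChain_cons_cons] at this ⊢
    exact ⟨h₁, this⟩

/-- The quasi-runs of a disassembly correspond to the symbols of the stack that they remove;
relative to the stack below, each is itself a chain of moves to which induction applies. -/
theorem PDA.derives_of_alphaPrime {P : PDA Q S Γ} (hP : P.IsReduced) {r : List (ID Q S Γ)}
    {u : List DyckStep} (h : AlphaPrime r u) {γ : Γ} (hc : r.IsChain P.Move)
    (hhead : ∃ I ∈ r.head?, I.stack = [γ]) (hlast : ∃ J ∈ r.getLast?, J.stack = []) :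
    P.Derives γ u := by
  revert γ hc hhead hlast
  -- Simultaneous induction: a disassembly that starts with the stack `ξ` yields one derivation for
  -- each symbol of `ξ`.
  refine AlphaPrime.rec
    (motive_1 := fun r u _ => ∀ {γ : Γ}, r.IsChain P.Move → (∃ I ∈ r.head?, I.stack = [γ]) →
      (∃ J ∈ r.getLast?, J.stack = []) → P.Derives γ u)
    (motive_2 := fun s u _ => ∀ {ξ : List Γ}, s.IsChain P.Move →
      (∃ I ∈ s.head?, I.stack = ξ) → (∃ J ∈ s.getLast?, J.stack = []) →
      ∃ us : List (List DyckStep), List.Forall₂ P.Derives ξ us ∧ u = us.flatten)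
    ?_ ?_ ?_ ?_ h
  · rintro I₀ I₁ γ hc ⟨I, hI, hγ⟩ ⟨J, hJ, hJs⟩
    simp only [List.head?_cons, Option.mem_def, Option.some.injEq, List.getLast?_cons_cons,
      List.getLast?_singleton] at hI hJ
    subst hI hJ
    simp only [List.isChain_cons_cons] at hc
    obtain ⟨⟨q, b, γ', p, ξ', w, ξ, hmem⟩, -⟩ := hc
    simp only [List.cons.injEq, List.append_eq_nil_iff] at hγ hJs
    obtain ⟨rfl, rfl⟩ := hγ
    obtain ⟨rfl, -⟩ := hJs
    exact .leaf ⟨q, b, p, hmem⟩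
  · rintro I₀ I₁ I₂ r u _ ih γ hc ⟨I, hI, hγ⟩ hlast
    simp only [List.head?_cons, Option.mem_def, Option.some.injEq] at hI
    subst hI
    rw [List.isChain_cons_cons] at hc
    obtain ⟨us, hus, rfl⟩ := ih hc.2 ⟨I₁, by simp, rfl⟩ (by simpa using hlast)
    -- Another move follows, so the first action did not pop; in reduced form it pushed two symbols.
    have hne : I₁.stack ≠ [] := by
      intro h0
      have h12 := (List.isChain_cons_cons.1 hc.2).1
      cases h12
      simp at h0
    obtain ⟨⟨q, b, γ', p, ξ', w, ξ, hmem⟩, -⟩ := hc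
    simp only [List.cons.injEq] at hγ
    obtain ⟨rfl, rfl⟩ := hγ
    simp only [List.append_nil] at hus hne ⊢
    rcases hP.2 _ _ _ _ _ hmem with h0 | h2
    · exact absurd (List.length_eq_zero_iff.1 h0) hne
    · obtain ⟨l, r, rfl⟩ := List.length_eq_two.1 h2
      match us, hus with
      | [u, v], .cons hu (.cons hv .nil) =>
        simpa using PDA.Derives.node ⟨q, b, p, hmem⟩ hu hv
  · rintro I hI ξ - ⟨I', hI', rfl⟩ -
    simp only [List.head?_cons, Option.mem_def, Option.some.injEq] at hI'
    subst hI'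
    rw [hI]
    exact ⟨[], .nil, rfl⟩
  · rintro I t J s u v hI hJ ht _ _ ih ih' ξ hc ⟨I', hI', rfl⟩ hlast
    simp only [List.cons_append, List.head?_cons, Option.mem_def, Option.some.injEq] at hI'
    subst hI'
    obtain ⟨γ, η, hγ⟩ := List.exists_cons_of_ne_nil hI
    rw [hγ, List.tail_cons] at hJ ht
    have hsplit : I :: t ++ J :: s = (I :: t ++ [J]) ++ s := by simp
    have hc₁ : (I :: t ++ [J]).IsChain P.Move := by
      rw [hsplit] at hc
      exact hc.left_of_append
    have hc₂ : (J :: s).IsChain P.Move := hc.right_of_append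
    obtain ⟨us, hus, rfl⟩ := ih' hc₂ ⟨J, by simp, rfl⟩
      (by simpa [List.getLast?_append, List.getLast?_cons] using hlast)
    have hu : P.Derives γ u := by
      refine ih (PDA.isChain_map_over t I J hc₁ ⟨[γ], by simp, by simp [hγ]⟩ ht hJ)
        ⟨I.over J, by simp, ?_⟩ ⟨J.over J, getLast?_map_concat _ (_ :: _) _, ?_⟩
      · simp [ID.over, hγ, hJ]
      · simp [ID.over]
    rw [hγ]
    rw [hJ] at hus
    exact ⟨u :: us, .cons hu hus, by simp⟩

/-! #### From derivations to runs -/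

/-- The instantaneous descriptor with tape `c.1 ++ w` and stack `c.2 ++ η`. -/
def liftID (q : Q) (w : List S) (η : List Γ) (c : List S × List Γ) : ID Q S Γ :=
  ⟨q, c.1 ++ w, c.2 ++ η⟩

/-- The run is kept as a list of pairs (unread input, stack), valid over every remaining tape `w`
and every lower stack `η`. This uniformity allows the runs of two subtrees to be concatenated.
Nonempty inner stacks ensure that the disassembly cuts at the right places. -/
theorem PDA.Derives.exists_run {P : PDA Q S Γ} (hP : P.IsReduced) {γ : Γ} {u : List DyckStep}
    (h : P.Derives γ u) (q : Q) :
    ∃ (y : List S) (m : List (List S × List Γ)), (∀ c ∈ m, c.2 ≠ []) ∧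
      (∀ w η, (((y, [γ]) :: m ++ [([], [])]).map (liftID q w η)).IsChain P.Move) ∧
      ∀ w, AlphaPrime (((y, [γ]) :: m ++ [([], [])]).map (liftID q w [])) u := by
  have := hP.1
  induction h with
  | leaf h =>
    obtain ⟨q', b, p, hmem⟩ := h
    obtain rfl := Subsingleton.elim q q'
    obtain rfl := Subsingleton.elim q p
    refine ⟨b.toList, [], by simp, fun w η => ?_, fun w => .single _ _⟩
    simpa [liftID] using PDA.Move.mk q b _ q [] w η hmem
  | @node γ l r u v h _ _ ihl ihr =>
    obtain ⟨q', b, p, hmem⟩ := h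
    obtain rfl := Subsingleton.elim q q'
    obtain rfl := Subsingleton.elim q p
    obtain ⟨y₁, m₁, hm₁, hc₁, ha₁⟩ := ihl
    obtain ⟨y₂, m₂, hm₂, hc₂, ha₂⟩ := ihr
    -- The run of the left subtree takes place above `r`, with the input of the right subtree still
    -- unread.
    let up : List S × List Γ → List S × List Γ := fun c => (c.1 ++ y₂, c.2 ++ [r])
    refine ⟨b.toList ++ y₁ ++ y₂, (y₁ ++ y₂, [l, r]) :: m₁.map up ++ (y₂, [r]) :: m₂,
      ?_, fun w η => ?_, fun w => ?_⟩
    · intro c hc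
      simp only [List.cons_append, List.mem_cons, List.mem_append, List.mem_map] at hc
      rcases hc with rfl | ⟨c, -, rfl⟩ | rfl | hc
      · simp
      · simp [up]
      · simp
      · exact hm₂ c hc
    · have h₁ := hc₁ (y₂ ++ w) (r :: η)
      have h₂ := hc₂ w η
      have e : ((b.toList ++ y₁ ++ y₂, [γ]) ::
          ((y₁ ++ y₂, [l, r]) :: m₁.map up ++ (y₂, [r]) :: m₂) ++ [([], [])]).map (liftID q w η) =
          liftID q w η (b.toList ++ y₁ ++ y₂, [γ]) ::
            ((((y₁, [l]) :: m₁).map (liftID q (y₂ ++ w) (r :: η))) ++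
            (((y₂, [r]) :: m₂ ++ [([], [])]).map (liftID q w η))) := by
        simp [up, Function.comp_def, liftID]
      rw [e]
      -- The run of the left subtree ends where that of the right subtree begins.
      have e' : liftID q w η (y₂, [r]) = liftID q (y₂ ++ w) (r :: η) ([], []) := by
        simp [liftID]
      have hmove : P.Move (liftID q w η (b.toList ++ y₁ ++ y₂, [γ]))
          (liftID q (y₂ ++ w) (r :: η) (y₁, [l])) := by
        simpa [liftID] using PDA.Move.mk q b γ q [l, r] (y₁ ++ (y₂ ++ w)) η hmem
      rw [List.map_cons, List.cons_append, List.isChain_cons_cons]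
      refine ⟨hmove, ?_⟩
      rw [List.cons_append, List.map_cons, e'] at h₂ ⊢
      rw [List.map_append, List.map_cons, List.map_cons, List.map_nil] at h₁
      exact List.isChain_split.2 ⟨h₁, h₂⟩
    · have hdis₂ : Disassembly (((y₂, [r]) :: m₂ ++ [([], [])]).map (liftID q w [])) (v ++ []) := by
        rw [List.map_append, List.map_cons]
        refine .cons (liftID q w [] (y₂, [r])) (m₂.map (liftID q w [])) (liftID q w [] ([], [])) []
          _ _ (by simp [liftID]) (by simp [liftID]) ?_ ?_ (.nil _ (by simp [liftID]))
        · intro K hK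
          obtain ⟨c, hc, rfl⟩ := List.mem_map.1 hK
          simpa [liftID] using hm₂ c hc
        · convert ha₂ w using 1
          simp [liftID, Function.comp_def, ID.over]
      have hdis : Disassembly (((y₁, [l]) :: m₁).map (liftID q (y₂ ++ w) [r]) ++
          ((y₂, [r]) :: m₂ ++ [([], [])]).map (liftID q w [])) (u ++ (v ++ [])) := by
        refine .cons (liftID q (y₂ ++ w) [r] (y₁, [l])) (m₁.map (liftID q (y₂ ++ w) [r]))
          (liftID q w [] (y₂, [r])) _ _ _ (by simp [liftID]) (by simp [liftID]) ?_ ?_ hdis₂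
        · intro K hK
          obtain ⟨c, hc, rfl⟩ := List.mem_map.1 hK
          simpa [liftID] using hm₁ c hc
        · convert ha₁ (y₂ ++ w) using 1
          simp [liftID, Function.comp_def, ID.over]
      have key := fun I₂ t ht => AlphaPrime.more (liftID q w [] (b.toList ++ y₁ ++ y₂, [γ]))
        (liftID q (y₂ ++ w) [r] (y₁, [l])) I₂ t (u ++ (v ++ [])) ht
      have hne : m₁.map (liftID q (y₂ ++ w) [r]) ++
          ((y₂, [r]) :: m₂ ++ [([], [])]).map (liftID q w []) ≠ [] := by simp
      obtain ⟨I₂, t, hI₂⟩ := List.exists_cons_of_ne_nil hne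
      rw [List.map_cons, List.cons_append, hI₂] at hdis
      have := key I₂ t hdis
      rw [← hI₂] at this
      convert this using 1
      · simp [up, Function.comp_def, liftID]
      · simp [liftID, List.replicate]

/-- The `k`-oscillating language is nonempty iff some derivation from the start symbol has a value
with first component `k`. -/
theorem PDA.exists_mem_oscLanguage_iff {P : PDA Q S Γ} (hP : P.IsReduced) (k : ℕ) :
    (∃ w, w ∈ P.oscLanguage k) ↔ ∃ t, P.HasVal P.startSymbol (k, t) := by
  rw [exists_hasVal_iff_exists_derives]
  constructor
  · rintro ⟨w, r, ⟨⟨hc, -, hlast⟩, hhead, -⟩, u, ⟨v, hv, rfl⟩, hk⟩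
    exact ⟨v, PDA.derives_of_alphaPrime hP hv hc ⟨_, hhead, rfl⟩ hlast, hk⟩
  · rintro ⟨u, hu, hk⟩
    obtain ⟨y, m, -, hc, ha⟩ := hu.exists_run hP P.startState
    refine ⟨y, _, ⟨⟨hc [] [], ⟨_, rfl, ?_⟩,
      ⟨liftID P.startState [] [] ([], []), getLast?_map_concat _ (_ :: _) _, ?_⟩⟩, ?_, ?_⟩,
      _, ⟨_, ha [], rfl⟩, hk⟩
    · simp [liftID]
    · simp [liftID]
    · simp [liftID]
    · exact ⟨liftID P.startState [] [] ([], []), getLast?_map_concat _ (_ :: _) _, by simp [liftID]⟩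

end Oscillation

namespace Oscillation

open NTM (inputCell moveHead)

/-! ### Stack machines with a two-way input head -/

theorem inputCell_eq_letter_le {A : Type} {x : List A} {p : ℕ} {a : A}
    (h : inputCell x p = .letter a) : 1 ≤ p ∧ p ≤ x.length := by
  cases p with
  | zero => simp [inputCell] at h
  | succ p =>
    refine ⟨by omega, ?_⟩
    by_contra hp
    have : x[p]? = none := by
      rw [List.getElem?_eq_none_iff]
      omega
    simp [inputCell, this] at h

/-- Operations on a stack: `none` leaves it alone, `some none` pops, `some (some a)` pushes `a`. -/
abbrev StackOp (σ : Type) := Option (Option σ)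

/-- The effect of a stack operation. -/
def StackOp.apply {σ : Type} : StackOp σ → List σ → List σ
  | none, l => l
  | some none, l => l.tail
  | some (some a), l => a :: l

/-- A nondeterministic machine with a two-way read-only input tape and two stacks. -/
structure StackMachine (A : Type) where
  State : Type
  [finiteState : Finite State]
  Symbol : Type
  [finiteSymbol : Finite Symbol]
  start : State
  accept : State
  trans : State → InputCell A → Option Symbol → Option Symbol →
    Set (State × Dir × StackOp Symbol × StackOp Symbol)

namespace StackMachine

variable {A : Type}

attribute [instance] StackMachine.finiteState StackMachine.finiteSymbol

/-- Configurations of a stack machine. -/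
@[ext]
structure Config (M : StackMachine A) where
  state : M.State
  pos : ℕ
  fst : List M.Symbol
  snd : List M.Symbol

variable (M : StackMachine A)

/-- The configuration after the transition `o`. -/
def next (x : List A) (c : M.Config)
    (o : M.State × Dir × StackOp M.Symbol × StackOp M.Symbol) : M.Config :=
  ⟨o.1, min (moveHead o.2.1 c.pos) (x.length + 1), o.2.2.1.apply c.fst, o.2.2.2.apply c.snd⟩

/-- The transitions possible in a configuration. -/
def options (x : List A) (c : M.Config) :
    Set (M.State × Dir × StackOp M.Symbol × StackOp M.Symbol) :=
  M.trans c.state (inputCell x c.pos) c.fst.head? c.snd.head?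

/-- Both stacks have height at most `H`. -/
def Fits (H : ℕ) (c : M.Config) : Prop := c.fst.length ≤ H ∧ c.snd.length ≤ H

/-- Some computation of at most `n` steps leads from `c` to the accepting state, with stacks of
height at most `H` throughout. -/
inductive AccIn (x : List A) (H : ℕ) : ℕ → M.Config → Prop
  | halt (n : ℕ) (c : M.Config) : M.Fits H c → c.state = M.accept → AccIn x H n c
  | step (n : ℕ) (c : M.Config) (o) : M.Fits H c → o ∈ M.options x c →
      AccIn x H n (M.next x c o) → AccIn x H (n + 1) c

/-- Acceptance from `c` with stacks of height at most `H`. -/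
def Acc (x : List A) (H : ℕ) (c : M.Config) : Prop := ∃ n, M.AccIn x H n c

variable {M} {x : List A} {H : ℕ}

theorem AccIn.fits {n : ℕ} {c : M.Config} (h : M.AccIn x H n c) : M.Fits H c := by
  cases h <;> assumption

theorem AccIn.mono {m n : ℕ} (hmn : m ≤ n) {c : M.Config} (h : M.AccIn x H m c) :
    M.AccIn x H n c := by
  induction h generalizing n with
  | halt m c hf hc => exact .halt n c hf hc
  | step m c o hf ho _ ih =>
    obtain ⟨n, rfl⟩ := Nat.exists_eq_succ_of_ne_zero (show n ≠ 0 by omega)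
    exact .step n c o hf ho (ih (by omega))

theorem AccIn.exists_step {n : ℕ} {c : M.Config} (h : M.AccIn x H n c)
    (hc : c.state ≠ M.accept) :
    ∃ m < n, ∃ o ∈ M.options x c, M.AccIn x H m (M.next x c o) := by
  cases h with
  | halt _ _ _ h => exact absurd h hc
  | step m _ o _ ho h => exact ⟨m, by omega, o, ho, h⟩

theorem Acc.fits {c : M.Config} (h : M.Acc x H c) : M.Fits H c := by
  obtain ⟨n, h⟩ := h
  exact h.fits

theorem Acc.of_next {c : M.Config} {o} (hf : M.Fits H c) (ho : o ∈ M.options x c)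
    (h : M.Acc x H (M.next x c o)) : M.Acc x H c := by
  obtain ⟨n, h⟩ := h
  exact ⟨n + 1, .step n c o hf ho h⟩

/-! #### Accepting computations need not be long -/

/-- An increasing sequence of subsets of a finite set that stops growing at the first repetition
is constant from the index given by the size of the set on. -/
theorem stable_of_ncard_le {α : Type*} {U : Set α} (hU : U.Finite) {F : ℕ → Set α}
    (hF : ∀ n, F n ⊆ U) (hmono : Monotone F)
    (hstep : ∀ n, F n = F (n + 1) → F (n + 1) = F (n + 2)) (n : ℕ) : F n ⊆ F U.ncard := by
  have stay : ∀ m, F m = F (m + 1) → ∀ i, F (m + i) = F m := by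
    intro m hm
    have : ∀ i, F (m + i) = F (m + i + 1) := by
      intro i
      induction i with
      | zero => exact hm
      | succ i ih => exact hstep _ ih
    intro i
    induction i with
    | zero => rfl
    | succ i ih => rw [← ih, this i, add_assoc]
  by_cases h : ∃ m ≤ U.ncard, F m = F (m + 1)
  · obtain ⟨m, hm, hm'⟩ := h
    rcases le_total n m with hn | hn
    · exact hmono (hn.trans hm)
    · obtain ⟨i, rfl⟩ := Nat.exists_eq_add_of_le hn
      rw [stay m hm' i]
      exact hmono hm
  · push Not at h
    have grow : ∀ m ≤ U.ncard + 1, m ≤ (F m).ncard := by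
      intro m
      induction m with
      | zero => intro _; omega
      | succ m ih =>
        intro hm
        have h₁ := ih (by omega)
        have h₂ : F m ⊂ F (m + 1) :=
          (hmono (Nat.le_succ m)).ssubset_of_ne (h m (by omega))
        have := Set.ncard_lt_ncard h₂ (hU.subset (hF _))
        omega
    have h₁ := grow (U.ncard + 1) le_rfl
    have h₂ := Set.ncard_le_ncard (hF (U.ncard + 1)) hU
    omega

/-- A stack of height at most `H` as a function. -/
def stackCode {σ : Type} (H : ℕ) (l : List σ) : Fin H → Option σ := fun i => l[(i : ℕ)]?

theorem stackCode_inj {σ : Type} {H : ℕ} {l l' : List σ} (hl : l.length ≤ H)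
    (hl' : l'.length ≤ H) (h : stackCode H l = stackCode H l') : l = l' := by
  apply List.ext_getElem?
  intro i
  by_cases hi : i < H
  · exact congrFun h ⟨i, hi⟩
  · rw [List.getElem?_eq_none_iff.2 (by omega), List.getElem?_eq_none_iff.2 (by omega)]

/-- The configurations with stacks of height at most `H`. -/
def bounded (M : StackMachine A) (x : List A) (H : ℕ) : Set M.Config :=
  {c | M.Fits H c ∧ c.pos ≤ x.length + 1}

/-- An injective code of bounded configurations. -/
def code (M : StackMachine A) (x : List A) (H : ℕ) (c : M.bounded x H) :
    M.State × Fin (x.length + 2) × (Fin H → Option M.Symbol) × (Fin H → Option M.Symbol) :=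
  (c.1.state, ⟨c.1.pos, Nat.lt_succ_of_le c.2.2⟩, stackCode H c.1.fst, stackCode H c.1.snd)

theorem code_injective (M : StackMachine A) (x : List A) (H : ℕ) :
    Function.Injective (M.code x H) := by
  rintro ⟨c, hc⟩ ⟨c', hc'⟩ h
  simp only [code, Prod.mk.injEq, Fin.mk.injEq] at h
  obtain ⟨h₁, h₂, h₃, h₄⟩ := h
  exact Subtype.ext (Config.ext h₁ h₂ (stackCode_inj hc.1.1 hc'.1.1 h₃)
    (stackCode_inj hc.1.2 hc'.1.2 h₄))

theorem bounded_finite (M : StackMachine A) (x : List A) (H : ℕ) : (M.bounded x H).Finite :=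
  Set.finite_coe_iff.1 (Finite.of_injective _ (M.code_injective x H))

theorem ncard_bounded_le (M : StackMachine A) (x : List A) (H : ℕ) :
    (M.bounded x H).ncard ≤ Nat.card M.State * ((x.length + 2) *
      ((Nat.card M.Symbol + 1) ^ H * (Nat.card M.Symbol + 1) ^ H)) := by
  have h := Nat.card_le_card_of_injective _ (M.code_injective x H)
  rw [Nat.card_coe_set_eq] at h
  simpa [Nat.card_prod, Nat.card_fun, Finite.card_option] using h

/-- The bounded configurations that accept within `n` steps form an increasing sequence of sets, and
each set determines the next. It is constant after the first repetition, which comes no later than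
the number of bounded configurations. -/
theorem Acc.accIn {c : M.Config} (h : M.Acc x H c) (hc : c.pos ≤ x.length + 1) :
    M.AccIn x H (M.bounded x H).ncard c := by
  obtain ⟨n, h⟩ := h
  let F : ℕ → Set M.Config := fun n => {c | M.AccIn x H n c ∧ c.pos ≤ x.length + 1}
  have next_pos : ∀ (c : M.Config) o, (M.next x c o).pos ≤ x.length + 1 := fun c o =>
    min_le_right _ _
  have key := stable_of_ncard_le (M.bounded_finite x H) (F := F)
    (fun n c hc => ⟨hc.1.fits, hc.2⟩) (fun m n hmn c hc => ⟨hc.1.mono hmn, hc.2⟩) ?_ n ⟨h, hc⟩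
  · exact key.1
  · intro n hn
    refine Set.Subset.antisymm (fun c hc => ⟨hc.1.mono (Nat.le_succ _), hc.2⟩) ?_
    rintro c ⟨hc, hp⟩
    refine ⟨?_, hp⟩
    cases hc with
    | halt _ _ hf hs => exact .halt _ _ hf hs
    | step _ _ o hf ho h =>
      refine .step n c o hf ho ?_
      have : M.next x c o ∈ F (n + 1) := ⟨h, next_pos c o⟩
      rw [← hn] at this
      exact this.1

end StackMachine

end Oscillation

namespace Oscillation

open NTM (inputCell moveHead)

/-! ### Computations of Turing machines -/

namespace NTM

variable {A : Type}

/-- All computations from a configuration are finite, stay within space `s`, and accept only if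
`Φ` holds. -/
inductive Safe (M : NTM A) (x : List A) (s : ℕ) (Φ : Prop) : M.Config → Prop
  | intro (C : M.Config) : (∀ i, C.head i < s) → (C.state = M.accept → Φ) →
      (∀ C', M.Step x C C' → Safe M x s Φ C') → Safe M x s Φ C

variable {M : NTM A} {x : List A} {s : ℕ} {Φ : Prop}

theorem Safe.of_reach {C D : M.Config} (h : M.Safe x s Φ C)
    (hD : Relation.ReflTransGen (M.Step x) C D) : M.Safe x s Φ D := by
  induction hD with
  | refl => exact h
  | tail _ hstep ih =>
    cases ih with
    | intro _ _ _ h => exact h _ hstep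

theorem Safe.spaceOn (h : M.Safe x s Φ M.init) : M.SpaceOn x s := by
  intro C hC
  cases h.of_reach hC with
  | intro _ h _ _ => exact h

theorem Safe.of_accepts (h : M.Safe x s Φ M.init) (ha : M.Accepts x) : Φ := by
  obtain ⟨C, hC, hC'⟩ := ha
  cases h.of_reach hC with
  | intro _ _ h _ => exact h hC'

theorem Safe.haltsOn (h : M.Safe x s Φ M.init) : M.HaltsOn x := by
  rintro ⟨f, hf, hstep⟩
  suffices ∀ C, M.Safe x s Φ C → ∀ n, f n ≠ C from this _ (hf ▸ h) 0 hf
  intro C hC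
  induction hC with
  | intro C _ _ _ ih =>
    rintro n rfl
    exact ih _ (hstep n) (n + 1) rfl

theorem config_ext {C D : M.Config} (h₁ : C.state = D.state) (h₂ : C.inputHead = D.inputHead)
    (h₃ : C.content = D.content) (h₄ : C.head = D.head) : C = D := by
  cases C
  cases D
  simp_all

/-- Every computation from `C` passes through `D`, and one exists, as far as space `s` and
acceptance are concerned. -/
def Leads (M : NTM A) (x : List A) (s : ℕ) (C D : M.Config) : Prop :=
  Relation.ReflTransGen (M.Step x) C D ∧ ∀ Φ, M.Safe x s Φ D → M.Safe x s Φ C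

theorem Leads.refl (C : M.Config) : M.Leads x s C C := ⟨.refl, fun _ => id⟩

theorem Leads.trans {C D E : M.Config} (h : M.Leads x s C D) (h' : M.Leads x s D E) :
    M.Leads x s C E :=
  ⟨h.1.trans h'.1, fun Φ hE => h.2 Φ (h'.2 Φ hE)⟩

end NTM

/-! ### Simulation of stack machines by Turing machines -/

/-- The work tapes: a clock, a counter for the setup phase, and the two stacks. -/
inductive WorkTape
  | clock
  | count
  | fst
  | snd

instance : Finite WorkTape :=
  Finite.of_injective (β := Fin 4)
    (fun | .clock => 0 | .count => 1 | .fst => 2 | .snd => 3) (by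
      intro a b
      cases a <;> cases b <;> simp)

/-- A family indexed by the work tapes. -/
def quad {α : Type*} (a b c d : α) : WorkTape → α
  | .clock => a
  | .count => b
  | .fst => c
  | .snd => d

/-- Symbols on the work tapes. -/
inductive TapeSymbol (σ : Type) (B : ℕ)
  | blank
  | left
  | right
  | digit (i : Fin (B + 1))
  | count (i : Fin 3)
  | sym (a : σ)

instance {σ : Type} [Finite σ] {B : ℕ} : Finite (TapeSymbol σ B) :=
  Finite.of_injective (β := Fin 3 ⊕ Fin (B + 1) ⊕ Fin 3 ⊕ σ)
    (fun
      | .blank => .inl 0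
      | .left => .inl 1
      | .right => .inl 2
      | .digit i => .inr (.inl i)
      | .count i => .inr (.inr (.inl i))
      | .sym a => .inr (.inr (.inr a))) (by
      intro a b
      cases a <;> cases b <;> simp)

/-- States of the setup phase, which lays out the clock and marks the space available. -/
inductive SetupState
  | init
  | load
  | visit
  | sweep (i : Fin 3)
  | back (i : Fin 3)
  | seal
  | rewind

instance : Finite SetupState :=
  Finite.of_injective (β := Fin 5 ⊕ Fin 3 ⊕ Fin 3)
    (fun
      | .init => .inl 0
      | .load => .inl 1
      | .visit => .inl 2
      | .seal => .inl 3
      | .rewind => .inl 4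
      | .sweep i => .inr (.inl i)
      | .back i => .inr (.inr i)) (by
      intro a b
      cases a <;> cases b <;> simp)

namespace StackMachine

variable (M : StackMachine Letter) (B : ℕ)

/-- States of the simulating machine: setup, simulation of a transition, completion of pushes. -/
abbrev SimState := SetupState ⊕ M.State ⊕ (M.State × StackOp M.Symbol × StackOp M.Symbol)

/-- Symbols of the simulating machine. -/
abbrev SimSymbol := TapeSymbol M.Symbol B

/-- What the simulating machine does in one step. -/
abbrev SimAction := M.SimState × Dir × (WorkTape → M.SimSymbol B × Dir)

variable {M B}

/-- The setup phase. The counter tape receives one cell for each bit of the first number of the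
input and is then traversed like a binary tree, with a sweep over the next three numbers at each
leaf. Each cell seen in a sweep extends the space on the clock and on the stacks by one. -/
def setupNext : SetupState → InputCell Letter → (WorkTape → M.SimSymbol B) →
    Option (M.SimAction B)
  | .init, _, _ => some (.inl .load, .right, fun _ => (.left, .right))
  | .load, .letter (.bit _), r => some (.inl .load, .right,
      quad (r .clock, .stay) (.count 2, .right) (r .fst, .stay) (r .snd, .stay))
  | .load, .letter .comma, r => some (.inl .visit, .stay,
      quad (r .clock, .stay) (.right, .stay) (r .fst, .stay) (r .snd, .stay))
  | .visit, _, r => match r .count with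
    | .count 2 => some (.inl .visit, .stay,
        quad (r .clock, .stay) (.count 1, .right) (r .fst, .stay) (r .snd, .stay))
    | .count 1 => some (.inl .visit, .stay,
        quad (r .clock, .stay) (.count 0, .right) (r .fst, .stay) (r .snd, .stay))
    | .count 0 => some (.inl .visit, .stay,
        quad (r .clock, .stay) (.count 2, .left) (r .fst, .stay) (r .snd, .stay))
    | .right => some (.inl (.sweep 0), .right,
        quad (r .clock, .stay) (r .count, .stay) (r .fst, .stay) (r .snd, .stay))
    | .left => some (.inl .seal, .stay,
        quad (r .clock, .stay) (r .count, .stay) (r .fst, .stay) (r .snd, .stay))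
    | _ => none
  | .sweep i, .letter (.bit _), r => some (.inl (.sweep i), .right,
      quad (.digit (Fin.last B), .right) (r .count, .stay) (r .fst, .right) (r .snd, .right))
  | .sweep i, .letter .comma, r =>
      some (.inl (if i = 2 then .back 0 else .sweep (i + 1)), if i = 2 then .left else .right,
      quad (.digit (Fin.last B), .right) (r .count, .stay) (r .fst, .right) (r .snd, .right))
  | .back i, .letter (.bit _), r => some (.inl (.back i), .left,
      quad (r .clock, .stay) (r .count, .stay) (r .fst, .stay) (r .snd, .stay))
  | .back i, .letter .comma, r =>
      some (.inl (if i = 2 then .visit else .back (i + 1)), if i = 2 then .stay else .left,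
      quad (r .clock, .stay) (r .count, if i = 2 then .left else .stay) (r .fst, .stay)
        (r .snd, .stay))
  | .seal, _, r => some (.inl .rewind, .stay,
      quad (.right, .stay) (r .count, .stay) (.right, .left) (.right, .left))
  | .rewind, _, r => match r .fst with
    | .left => some (.inr (.inl M.start), .left,
        quad (r .clock, .stay) (r .count, .stay) (r .fst, .stay) (r .snd, .stay))
    | _ => some (.inl .rewind, .stay,
        quad (r .clock, .stay) (r .count, .stay) (r .fst, .left) (r .snd, .left))
  | _, _, _ => none

/-- The symbol that a stack shows. -/
def topSymbol {σ : Type} : TapeSymbol σ B → Option σ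
  | .sym a => some a
  | _ => none

/-- One step of the clock, a depth-first traversal of the tree of degree `B`; it fails when the
clock has run down. -/
def tick {σ : Type} : TapeSymbol σ B → Option (TapeSymbol σ B × Dir)
  | .digit i => if (i : ℕ) = 0 then some (.digit (Fin.last B), .left)
      else some (.digit ⟨i - 1, by omega⟩, .right)
  | .right => some (.right, .left)
  | _ => none

/-- The head movement for a stack operation. -/
def opDir {σ : Type} : StackOp σ → Dir
  | none => .stay
  | some none => .left
  | some (some _) => .right

/-- The symbol written to complete a stack operation; pushes fail beyond the right marker. -/
def opWrite {σ : Type} : StackOp σ → TapeSymbol σ B → Option (TapeSymbol σ B)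
  | some (some _), .right => none
  | some (some a), _ => some (.sym a)
  | _, c => some c

variable (M B)

/-- A Turing machine that simulates a stack machine within the space marked by the setup phase and
the time allowed by the clock. -/
def compile : NTM Letter where
  State := M.SimState
  Symbol := M.SimSymbol B
  Tape := WorkTape
  blank := .blank
  start := .inl .init
  accept := .inr (.inl M.accept)
  trans := fun s c r => match s with
    | .inl s => {o | setupNext s c r = some o}
    | .inr (.inl q) => {o | ∃ t ∈ M.trans q c (topSymbol (r .fst)) (topSymbol (r .snd)),
        ∃ a, tick (r .clock) = some a ∧
          o = (.inr (.inr (t.1, t.2.2.1, t.2.2.2)), t.2.1,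
            quad a (r .count, .stay) (r .fst, opDir t.2.2.1) (r .snd, opDir t.2.2.2))}
    | .inr (.inr (q, o₁, o₂)) => {o | ∃ a b, opWrite o₁ (r .fst) = some a ∧
        opWrite o₂ (r .snd) = some b ∧ o = (.inr (.inl q), .stay,
          quad (r .clock, .stay) (r .count, .stay) (a, .stay) (b, .stay))}

end StackMachine

/-- Content and head position of a tape. -/
@[ext]
structure TapeState (σ : Type) where
  content : ℕ → σ
  head : ℕ

namespace TapeState

variable {σ : Type}

/-- The scanned symbol. -/
def read (t : TapeState σ) : σ := t.content t.head

/-- Writing a symbol and moving the head. -/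
def act (t : TapeState σ) (a : σ × Dir) : TapeState σ :=
  ⟨Function.update t.content t.head a.1, moveHead a.2 t.head⟩

theorem act_read (t : TapeState σ) (d : Dir) : t.act (t.read, d) = ⟨t.content, moveHead d t.head⟩ := by
  simp [act, read]

theorem act_read_stay (t : TapeState σ) : t.act (t.read, .stay) = t := by
  simp [act_read, moveHead]

end TapeState

namespace StackMachine

variable {M : StackMachine Letter} {B : ℕ}

/-- A configuration of the simulating machine, given tape by tape. -/
def simCfg (s : M.SimState) (p : ℕ) (t₁ t₂ t₃ t₄ : TapeState (M.SimSymbol B)) :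
    (M.compile B).Config :=
  ⟨s, p, quad t₁.content t₂.content t₃.content t₄.content, quad t₁.head t₂.head t₃.head t₄.head⟩

variable {x : List Letter} {sp : ℕ}

theorem step_simCfg_iff {s : M.SimState} {p : ℕ} {t₁ t₂ t₃ t₄ : TapeState (M.SimSymbol B)}
    {C : (M.compile B).Config} :
    (M.compile B).Step x (simCfg s p t₁ t₂ t₃ t₄) C ↔
      ∃ o ∈ (M.compile B).trans s (inputCell x p) (quad t₁.read t₂.read t₃.read t₄.read),
        C = simCfg o.1 (min (moveHead o.2.1 p) (x.length + 1)) (t₁.act (o.2.2 .clock))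
          (t₂.act (o.2.2 .count)) (t₃.act (o.2.2 .fst)) (t₄.act (o.2.2 .snd)) := by
  have hread : (fun i => (simCfg (M := M) (B := B) s p t₁ t₂ t₃ t₄).content i
      ((simCfg (M := M) (B := B) s p t₁ t₂ t₃ t₄).head i)) =
      quad t₁.read t₂.read t₃.read t₄.read := by
    funext i
    cases i <;> rfl
  unfold NTM.Step
  rw [hread]
  constructor
  · rintro ⟨q, d, f, hmem, h₁, h₂, h₃, h₄⟩
    refine ⟨(q, d, f), hmem, ?_⟩
    refine NTM.config_ext h₁ h₂ ?_ ?_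
    · funext i
      exact (h₃ i).trans (by cases i <;> rfl)
    · funext i
      exact (h₄ i).trans (by cases i <;> rfl)
  · rintro ⟨⟨q, d, f⟩, hmem, rfl⟩
    refine ⟨q, d, f, hmem, rfl, rfl, ?_, ?_⟩ <;> intro i <;> cases i <;> rfl

/-- The setup phase is deterministic and none of its states accepts, so safety passes from the
successor back to the configuration. -/
theorem leads_of_setupNext {s : SetupState} {p : ℕ} {t₁ t₂ t₃ t₄ : TapeState (M.SimSymbol B)}
    {s' : M.SimState} {d : Dir} {a₁ a₂ a₃ a₄ : M.SimSymbol B × Dir}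
    (h : setupNext s (inputCell x p) (quad t₁.read t₂.read t₃.read t₄.read) =
      some (s', d, quad a₁ a₂ a₃ a₄))
    (h₁ : t₁.head < sp) (h₂ : t₂.head < sp) (h₃ : t₃.head < sp) (h₄ : t₄.head < sp) :
    (M.compile B).Leads x sp (simCfg (.inl s) p t₁ t₂ t₃ t₄)
      (simCfg s' (min (moveHead d p) (x.length + 1)) (t₁.act a₁) (t₂.act a₂) (t₃.act a₃)
        (t₄.act a₄)) := by
  constructor
  · exact .single (step_simCfg_iff.2 ⟨_, h, rfl⟩)
  · intro Φ hΦ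
    refine .intro _ ?_ (fun h => by simp [simCfg, compile] at h) ?_
    · intro i
      cases i <;> assumption
    · intro C hC
      obtain ⟨o, ho, rfl⟩ := step_simCfg_iff.1 hC
      obtain rfl : (s', d, quad a₁ a₂ a₃ a₄) = o := Option.some_injective _ (h.symm.trans ho)
      exact hΦ

end StackMachine

end Oscillation

-- Number fields on the input and the layout of the work tapes

namespace Oscillation

open NTM (inputCell moveHead)

/-- Cell `p + 1` on: `a` bits, then a comma. -/
structure BitField (x : List Letter) (p a : ℕ) : Prop where
  bit : ∀ t < a, ∃ b, inputCell x (p + 1 + t) = .letter (.bit b)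
  comma : inputCell x (p + a + 1) = .letter .comma

theorem min_moveHead_right {A : Type} {x : List A} {p : ℕ} {a : A}
    (h : inputCell x p = .letter a) : min (moveHead .right p) (x.length + 1) = p + 1 := by
  have := inputCell_eq_letter_le h
  simp only [moveHead]
  omega

theorem min_moveHead_left {A : Type} {x : List A} {p : ℕ} (h : p ≤ x.length + 1) :
    min (moveHead .left p) (x.length + 1) = p - 1 := by
  simp only [moveHead]
  omega

theorem min_moveHead_stay {A : Type} {x : List A} {p : ℕ} (h : p ≤ x.length + 1) :
    min (moveHead .stay p) (x.length + 1) = p := by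
  simp only [moveHead]
  omega

namespace StackMachine

variable {M : StackMachine Letter} {B : ℕ} {x : List Letter} {sp : ℕ}

/-! #### The setup phase -/

/-- The clock tape with `n` cells laid out. -/
def clockTape (σ : Type) (B n : ℕ) : TapeState (TapeSymbol σ B) :=
  ⟨fun i => if i = 0 then .left else if i ≤ n then .digit (Fin.last B) else .blank, n + 1⟩

/-- An empty stack tape with the head on cell `n + 1`. -/
def emptyTape (σ : Type) (B n : ℕ) : TapeState (TapeSymbol σ B) :=
  ⟨fun i => if i = 0 then .left else .blank, n + 1⟩

/-- The content of the counter tape with `n` cells. -/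
def countContent (σ : Type) (B n : ℕ) : ℕ → TapeSymbol σ B :=
  fun i => if i = 0 then .left else if i ≤ n then .count 2 else .blank

/-- Configurations of the setup phase. -/
def setupCfg (M : StackMachine Letter) (B : ℕ) (s : SetupState) (p n : ℕ)
    (t : TapeState (M.SimSymbol B)) : (M.compile B).Config :=
  simCfg (.inl s) p (clockTape _ B n) t (emptyTape _ B n) (emptyTape _ B n)

theorem clockTape_act (σ : Type) (B n : ℕ) :
    (clockTape σ B n).act (.digit (Fin.last B), .right) = clockTape σ B (n + 1) := by
  ext i
  · simp only [clockTape, TapeState.act, Function.update_apply]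
    split_ifs <;> first | rfl | omega
  · rfl

theorem emptyTape_act (σ : Type) (B n : ℕ) :
    (emptyTape σ B n).act ((emptyTape σ B n).read, .right) = emptyTape σ B (n + 1) := by
  rw [TapeState.act_read]
  rfl

theorem leads_init (hsp : 0 < sp) :
    (M.compile B).Leads x sp (M.compile B).init
      (setupCfg M B .load 1 0 ⟨countContent _ B 0, 1⟩) := by
  let t : TapeState (M.SimSymbol B) := ⟨fun _ => .blank, 0⟩
  have e : (M.compile B).init = simCfg (.inl .init) 0 t t t t := by
    refine NTM.config_ext rfl rfl ?_ ?_ <;> funext i <;> cases i <;> rfl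
  rw [e]
  have hquad : (fun _ => (TapeSymbol.left, Dir.right) : WorkTape → M.SimSymbol B × Dir) =
      quad (.left, .right) (.left, .right) (.left, .right) (.left, .right) := by
    funext i
    cases i <;> rfl
  have h := leads_of_setupNext (M := M) (B := B) (x := x) (sp := sp) (s := .init) (p := 0)
    (t₁ := t) (t₂ := t) (t₃ := t) (t₄ := t) (by rw [setupNext, hquad]) hsp hsp hsp hsp
  convert h using 1
  have hp : min (moveHead .right 0) (x.length + 1) = 1 := by simp [moveHead]
  have ht : ∀ t' : TapeState (M.SimSymbol B), t'.head = 1 → t'.content 0 = .left →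
      (∀ i ≠ 0, t'.content i = .blank) → t' = t.act (.left, .right) := by
    intro t' h₁ h₂ h₃
    ext i
    · by_cases hi : i = 0
      · subst hi
        simp [h₂, TapeState.act, t]
      · simp [h₃ i hi, TapeState.act, t, hi]
    · simpa [TapeState.act, moveHead, t] using h₁
  rw [hp, setupCfg, ht (clockTape _ B 0), ht (emptyTape _ B 0), ht ⟨countContent _ B 0, 1⟩]
  all_goals simp +contextual [countContent, emptyTape, clockTape]

/-- What the heads scan in the setup phase. -/
def setupRead (M : StackMachine Letter) (B n : ℕ) (t : TapeState (M.SimSymbol B)) :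
    WorkTape → M.SimSymbol B :=
  quad (clockTape _ B n).read t.read (emptyTape _ B n).read (emptyTape _ B n).read

theorem leads_keep {s s' : SetupState} {p p' n : ℕ} {t t' : TapeState (M.SimSymbol B)} {d : Dir}
    {a : M.SimSymbol B × Dir}
    (h : setupNext s (inputCell x p) (setupRead M B n t) =
      some (.inl s', d, quad ((clockTape _ B n).read, .stay) a ((emptyTape _ B n).read, .stay)
        ((emptyTape _ B n).read, .stay)))
    (ht : t.head < sp) (hn : n + 2 ≤ sp) (hp : min (moveHead d p) (x.length + 1) = p')
    (ha : t.act a = t') :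
    (M.compile B).Leads x sp (setupCfg M B s p n t) (setupCfg M B s' p' n t') := by
  have hsp : n + 1 < sp := by omega
  have := leads_of_setupNext h hsp ht hsp hsp
  rwa [hp, ha, TapeState.act_read_stay, TapeState.act_read_stay] at this

/-- The clock and both stacks are extended in lockstep, so one number `n` describes all three and
their right ends will be marked at the same cell. -/
theorem leads_advance {s s' : SetupState} {p p' n : ℕ} {t : TapeState (M.SimSymbol B)} {d : Dir}
    (h : setupNext s (inputCell x p) (setupRead M B n t) =
      some (.inl s', d, quad (.digit (Fin.last B), .right) (t.read, .stay)
        ((emptyTape _ B n).read, .right) ((emptyTape _ B n).read, .right)))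
    (ht : t.head < sp) (hn : n + 2 ≤ sp) (hp : min (moveHead d p) (x.length + 1) = p') :
    (M.compile B).Leads x sp (setupCfg M B s p n t) (setupCfg M B s' p' (n + 1) t) := by
  have hsp : n + 1 < sp := by omega
  have := leads_of_setupNext h hsp ht hsp hsp
  rwa [hp, TapeState.act_read_stay, clockTape_act, emptyTape_act] at this

theorem leads_load {p a : ℕ} (h : BitField x p a) (hsp : 2 ≤ sp) (i : ℕ) (hi : i ≤ a)
    (ha : a + 2 ≤ sp) :
    (M.compile B).Leads x sp (setupCfg M B .load (p + 1) 0 ⟨countContent _ B 0, 1⟩)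
      (setupCfg M B .load (p + 1 + i) 0 ⟨countContent _ B i, i + 1⟩) := by
  induction i with
  | zero => exact .refl _
  | succ i ih =>
    refine (ih (by omega)).trans ?_
    obtain ⟨b, hb⟩ := h.bit i (by omega)
    refine leads_keep (a := (.count 2, .right)) (by rw [hb]; rfl) (by simp only; omega) hsp
      (min_moveHead_right hb) ?_
    ext j
    · simp only [countContent, TapeState.act, Function.update_apply]
      split_ifs <;> first | rfl | omega
    · rfl

/-- The counter tape when the traversal starts. -/
def countTape (σ : Type) (B a : ℕ) : ℕ → TapeSymbol σ B :=
  Function.update (countContent σ B a) (a + 1) .right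

theorem leads_load_comma {p a : ℕ} (h : BitField x p a) (hsp : 2 ≤ sp) (ha : a + 2 ≤ sp) :
    (M.compile B).Leads x sp (setupCfg M B .load (p + 1) 0 ⟨countContent _ B 0, 1⟩)
      (setupCfg M B .visit (p + a + 1) 0 ⟨countTape _ B a, a + 1⟩) := by
  refine (leads_load h hsp a le_rfl ha).trans ?_
  have hc := h.comma
  rw [show p + a + 1 = p + 1 + a by omega] at hc ⊢
  exact leads_keep (a := (.right, .stay)) (by rw [hc]; rfl) (by simp only; omega) hsp
    (min_moveHead_stay (by have := inputCell_eq_letter_le hc; omega)) rfl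

theorem leads_sweep_bits {p a : ℕ} (h : BitField x p a) {n : ℕ} {t : TapeState (M.SimSymbol B)}
    (ht : t.head < sp) (c : Fin 3) (i : ℕ) (hi : i ≤ a) (hn : n + a + 2 ≤ sp) :
    (M.compile B).Leads x sp (setupCfg M B (.sweep c) (p + 1) n t)
      (setupCfg M B (.sweep c) (p + 1 + i) (n + i) t) := by
  induction i with
  | zero => exact .refl _
  | succ i ih =>
    refine (ih (by omega)).trans ?_
    obtain ⟨b, hb⟩ := h.bit i (by omega)
    exact leads_advance (by rw [hb]; rfl) ht (by omega) (min_moveHead_right hb)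

theorem leads_sweep {p a : ℕ} (h : BitField x p a) {n : ℕ} {t : TapeState (M.SimSymbol B)}
    (ht : t.head < sp) (c : Fin 3) (hn : n + a + 2 ≤ sp) :
    (M.compile B).Leads x sp (setupCfg M B (.sweep c) (p + 1) n t)
      (setupCfg M B (if c = 2 then .back 0 else .sweep (c + 1))
        (if c = 2 then p + a else p + a + 1 + 1) (n + (a + 1)) t) := by
  refine (leads_sweep_bits h ht c a le_rfl hn).trans ?_
  have hc := h.comma
  rw [show p + a + 1 = p + 1 + a by omega] at hc ⊢
  refine leads_advance (n := n + a) (d := if c = 2 then .left else .right) (by rw [hc]; rfl) ht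
    (by omega) ?_
  have := inputCell_eq_letter_le hc
  split_ifs <;> simp only [moveHead] <;> omega

theorem leads_back_bits {p a : ℕ} (h : BitField x p a) {n : ℕ} {t : TapeState (M.SimSymbol B)}
    (ht : t.head < sp) (c : Fin 3) (i : ℕ) (hi : i ≤ a) (hn : n + 2 ≤ sp) :
    (M.compile B).Leads x sp (setupCfg M B (.back c) (p + i) n t)
      (setupCfg M B (.back c) p n t) := by
  induction i with
  | zero => exact .refl _
  | succ i ih =>
    refine .trans ?_ (ih (by omega))
    obtain ⟨b, hb⟩ := h.bit i (by omega)
    rw [show p + 1 + i = p + (i + 1) by omega] at hb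
    exact leads_keep (a := (t.read, .stay)) (by rw [hb]; rfl) ht hn
      (min_moveHead_left (by have := inputCell_eq_letter_le hb; omega)) (t.act_read_stay)

theorem leads_back_comma {p : ℕ} (h : inputCell x p = .letter .comma) {n : ℕ}
    {t : TapeState (M.SimSymbol B)} (ht : t.head < sp) (c : Fin 3) (hn : n + 2 ≤ sp) :
    (M.compile B).Leads x sp (setupCfg M B (.back c) p n t)
      (setupCfg M B (if c = 2 then .visit else .back (c + 1)) (if c = 2 then p else p - 1) n
        ⟨t.content, if c = 2 then t.head - 1 else t.head⟩) := by
  refine leads_keep (d := if c = 2 then .stay else .left)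
    (a := (t.read, if c = 2 then .left else .stay)) (by rw [h]; rfl) ht hn ?_ ?_
  · have := inputCell_eq_letter_le h
    split_ifs <;> simp only [moveHead] <;> omega
  · rw [TapeState.act_read]
    split_ifs <;> rfl

/-- At a leaf of the traversal: the sweep over three numbers. -/
theorem leads_leaf {p a b c : ℕ} (hp : inputCell x p = .letter .comma) (ha : BitField x p a)
    (hb : BitField x (p + a + 1) b) (hc : BitField x (p + a + 1 + b + 1) c)
    {n : ℕ} {t : TapeState (M.SimSymbol B)} (ht : t.head < sp) (htr : t.read = .right)
    (hn : n + (a + b + c + 3) + 2 ≤ sp) :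
    (M.compile B).Leads x sp (setupCfg M B .visit p n t)
      (setupCfg M B .visit p (n + (a + b + c + 3)) ⟨t.content, t.head - 1⟩) := by
  have h₀ : (M.compile B).Leads x sp (setupCfg M B .visit p n t)
      (setupCfg M B (.sweep 0) (p + 1) n t) :=
    leads_keep (a := (t.read, .stay)) (by simp only [setupNext, setupRead, quad, htr]) ht
      (by omega) (min_moveHead_right hp) t.act_read_stay
  have h₁ := leads_sweep (n := n) ha ht 0 (by omega)
  have h₂ := leads_sweep (n := n + (a + 1)) hb ht 1 (by omega)
  have h₃ := leads_sweep (n := n + (a + 1) + (b + 1)) hc ht 2 (by omega)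
  rw [show n + (a + 1) + (b + 1) + (c + 1) = n + (a + b + c + 3) by omega] at h₃
  have hn' : n + (a + b + c + 3) + 2 ≤ sp := hn
  -- The head returns over the same fields in reverse order to the comma at `p`, ready for the next
  -- leaf.
  have h₄ := leads_back_bits hc ht 0 c le_rfl hn'
  have h₅ := leads_back_comma hb.comma ht 0 hn'
  have h₆ := leads_back_bits hb ht 1 b le_rfl hn'
  have h₇ := leads_back_comma ha.comma ht 1 hn'
  have h₈ := leads_back_bits ha ht 2 a le_rfl hn'
  have h₉ := leads_back_comma hp ht 2 hn'
  exact h₀.trans (h₁.trans (h₂.trans (h₃.trans (h₄.trans (h₅.trans (h₆.trans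
    (h₇.trans (h₈.trans h₉))))))))

/-- A digit counts the subtrees still to be entered. In `Fin 3` adding `2` subtracts `1`, so `2`
becomes `1`, `1` becomes `0`, and `0` is reset to `2` as the head leaves to the left. -/
theorem leads_visit_count {p : ℕ} (hp : p ≤ x.length + 1) {n : ℕ}
    {t : TapeState (M.SimSymbol B)} (ht : t.head < sp) (hn : n + 2 ≤ sp) (i : Fin 3)
    (htr : t.read = .count i) :
    (M.compile B).Leads x sp (setupCfg M B .visit p n t)
      (setupCfg M B .visit p n (t.act (.count (i + 2), if i = 0 then .left else .right))) := by
  refine leads_keep (d := .stay) ?_ ht hn (min_moveHead_stay hp) rfl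
  simp only [setupNext, setupRead, quad, htr]
  fin_cases i <;> rfl

end StackMachine

end Oscillation

-- Traversal of the counter tree and end of the setup

namespace Oscillation

open NTM (inputCell moveHead)

namespace StackMachine

variable {M : StackMachine Letter} {B : ℕ} {x : List Letter} {sp : ℕ}

theorem countTape_of_le {σ : Type} {a q : ℕ} (h : 1 ≤ q) (hq : q ≤ a) :
    countTape σ B a q = .count 2 := by
  rw [countTape, Function.update_of_ne (by omega)]
  simp only [countContent]
  rw [if_neg (by omega), if_pos hq]

/-- The traversal of the subtree below cell `q` of the counter tape, with `2 ^ i` leaves. -/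
theorem leads_subtree {p a b c : ℕ} (hp : inputCell x p = .letter .comma) (ha : BitField x p a)
    (hb : BitField x (p + a + 1) b) (hc : BitField x (p + a + 1 + b + 1) c) {m : ℕ}
    (hm : m + 2 ≤ sp) (i : ℕ) {n q : ℕ} {f : ℕ → M.SimSymbol B} (hq : 1 ≤ q)
    (hqi : q + i = m + 1) (hf : ∀ j, q ≤ j → f j = countTape _ B m j)
    (hn : n + 2 ^ i * (a + b + c + 3) + 2 ≤ sp) :
    (M.compile B).Leads x sp (setupCfg M B .visit p n ⟨f, q⟩)
      (setupCfg M B .visit p (n + 2 ^ i * (a + b + c + 3)) ⟨f, q - 1⟩) := by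
  have hp' : p ≤ x.length + 1 := by
    have := inputCell_eq_letter_le hp
    omega
  induction i generalizing n q f with
  | zero =>
    simp only [pow_zero, one_mul] at hn ⊢
    refine leads_leaf hp ha hb hc (t := ⟨f, q⟩) (by simp only; omega) ?_ hn
    simp only [TapeState.read, hf q le_rfl]
    rw [show q = m + 1 by omega, countTape, Function.update_self]
  | succ i ih =>
    have hδ : 2 ^ (i + 1) * (a + b + c + 3) =
      2 ^ i * (a + b + c + 3) + 2 ^ i * (a + b + c + 3) := by ring
    have hfq : f q = .count 2 := by rw [hf q le_rfl, countTape_of_le hq (by omega)]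
    have hup : ∀ (v : M.SimSymbol B) (g : ℕ → M.SimSymbol B),
        (∀ j, q + 1 ≤ j → g j = countTape _ B m j) →
        ∀ j, q + 1 ≤ j → Function.update g q v j = countTape _ B m j := by
      intro v g hg j hj
      rw [Function.update_of_ne (by omega), hg j hj]
    have hf₀ : ∀ j, q + 1 ≤ j → f j = countTape _ B m j := fun j hj => hf j (by omega)
    -- The first subtree is entered with digit `1` and the second with digit `0`; then digit `2` is
    -- restored and the head leaves. The cells left of `q` are arbitrary throughout.
    have h₁ : (M.compile B).Leads x sp (setupCfg M B .visit p n ⟨f, q⟩)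
        (setupCfg M B .visit p n ⟨Function.update f q (.count 1), q + 1⟩) :=
      leads_visit_count hp' (t := ⟨f, q⟩) (by simp only; omega) (by omega) 2 hfq
    have h₂ := ih (n := n) (q := q + 1) (f := Function.update f q (.count 1)) (by omega) (by omega)
      (hup _ _ hf₀) (by omega)
    have h₃ : (M.compile B).Leads x sp (setupCfg M B .visit p (n + 2 ^ i * (a + b + c + 3))
        ⟨Function.update f q (.count 1), q⟩)
        (setupCfg M B .visit p (n + 2 ^ i * (a + b + c + 3))
          ⟨Function.update f q (.count 0), q + 1⟩) := by
      have := leads_visit_count (M := M) (B := B) (sp := sp) hp'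
        (n := n + 2 ^ i * (a + b + c + 3)) (t := ⟨Function.update f q (.count 1), q⟩)
        (by simp only; omega) (by omega) 1 (by simp [TapeState.read])
      simpa [TapeState.act, moveHead] using this
    have h₄ := ih (n := n + 2 ^ i * (a + b + c + 3)) (q := q + 1)
      (f := Function.update f q (.count 0)) (by omega) (by omega) (hup _ _ hf₀) (by omega)
    have h₅ : (M.compile B).Leads x sp (setupCfg M B .visit p (n + 2 ^ (i + 1) * (a + b + c + 3))
        ⟨Function.update f q (.count 0), q⟩)
        (setupCfg M B .visit p (n + 2 ^ (i + 1) * (a + b + c + 3)) ⟨f, q - 1⟩) := by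
      have := leads_visit_count (M := M) (B := B) (sp := sp) hp'
        (n := n + 2 ^ (i + 1) * (a + b + c + 3)) (t := ⟨Function.update f q (.count 0), q⟩)
        (by simp only; omega) (by omega) 0 (by simp [TapeState.read])
      have e : Function.update f q (.count 2) = f := by rw [← hfq, Function.update_eq_self]
      simpa [TapeState.act, moveHead, e] using this
    rw [hδ, ← add_assoc] at h₅ ⊢
    exact h₁.trans (h₂.trans (h₃.trans (h₄.trans h₅)))

/-- The traversal starts at a leaf with all digits fresh. Each cell on the way back to the left
marker is therefore treated as newly entered and adds a full subtree, so the leaves number `1 + 2 +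
4 + ⋯ = 2 ^ i - 1`. -/
theorem leads_visit_all {p a b c : ℕ} (hp : inputCell x p = .letter .comma) (ha : BitField x p a)
    (hb : BitField x (p + a + 1) b) (hc : BitField x (p + a + 1 + b + 1) c) {m : ℕ}
    (hm : m + 2 ≤ sp) (i : ℕ) (hi : i ≤ m + 1)
    (hn : (2 ^ i - 1) * (a + b + c + 3) + 2 ≤ sp) :
    (M.compile B).Leads x sp (setupCfg M B .visit p 0 ⟨countTape _ B m, m + 1⟩)
      (setupCfg M B .visit p ((2 ^ i - 1) * (a + b + c + 3)) ⟨countTape _ B m, m + 1 - i⟩) := by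
  induction i with
  | zero => simpa using NTM.Leads.refl _
  | succ i ih =>
    have hδ : (2 ^ (i + 1) - 1) * (a + b + c + 3) =
        (2 ^ i - 1) * (a + b + c + 3) + 2 ^ i * (a + b + c + 3) := by
      rw [← add_mul]
      congr 1
      have := Nat.one_le_two_pow (n := i)
      omega
    rw [hδ] at hn ⊢
    refine (ih (by omega) (by omega)).trans ?_
    have := leads_subtree (M := M) (B := B) hp ha hb hc hm i
      (n := (2 ^ i - 1) * (a + b + c + 3)) (q := m + 1 - i) (f := countTape _ B m)
      (by omega) (by omega) (fun _ _ => rfl) hn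
    rwa [show m + 1 - i - 1 = m + 1 - (i + 1) by omega] at this

/-- The clock when the simulation starts. -/
def sealedClock (σ : Type) (B H : ℕ) : TapeState (TapeSymbol σ B) :=
  ⟨Function.update (clockTape σ B H).content (H + 1) .right, H + 1⟩

/-- An empty stack tape with its right end marked. -/
def sealedStack (σ : Type) (B H i : ℕ) : TapeState (TapeSymbol σ B) :=
  ⟨Function.update (emptyTape σ B H).content (H + 1) .right, i⟩

theorem leads_seal {p : ℕ} (hp : p ≤ x.length + 1) {m H : ℕ} (hH : H + 2 ≤ sp) :
    (M.compile B).Leads x sp (setupCfg M B .visit p H ⟨countTape _ B m, 0⟩)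
      (simCfg (.inl .rewind) p (sealedClock _ B H) ⟨countTape _ B m, 0⟩ (sealedStack _ B H H)
        (sealedStack _ B H H)) := by
  have hl : (⟨countTape _ B m, 0⟩ : TapeState (M.SimSymbol B)).read = .left := by
    simp [TapeState.read, countTape, countContent]
  have h₁ : (M.compile B).Leads x sp (setupCfg M B .visit p H ⟨countTape _ B m, 0⟩)
      (setupCfg M B .seal p H ⟨countTape _ B m, 0⟩) :=
    leads_keep (a := (.left, .stay)) (d := .stay) (by simp only [setupNext, setupRead, quad, hl])
      (by simp only; omega) hH (min_moveHead_stay hp)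
      (by rw [← hl, TapeState.act_read_stay])
  refine h₁.trans ?_
  have hsp : H + 1 < sp := by omega
  have := leads_of_setupNext (M := M) (B := B) (x := x) (sp := sp) (s := .seal) (p := p)
    (t₁ := clockTape _ B H) (t₂ := ⟨countTape _ B m, 0⟩) (t₃ := emptyTape _ B H)
    (t₄ := emptyTape _ B H) (d := .stay) (a₁ := (.right, .stay))
    (a₂ := (TapeState.read ⟨countTape _ B m, 0⟩, .stay)) (a₃ := (.right, .left))
    (a₄ := (.right, .left)) rfl hsp (by simp only; omega) hsp hsp
  rwa [min_moveHead_stay hp, TapeState.act_read_stay] at this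

/-- The simulation begins one cell to the left of `p`. When `p` is the comma after `k`, this is the
most significant bit of `k`, or the left end marker if `k = 0`. -/
theorem leads_rewind {p : ℕ} (hp : p ≤ x.length + 1) {m H : ℕ} (hH : H + 2 ≤ sp) (i : ℕ)
    (hi : i ≤ H) :
    (M.compile B).Leads x sp
      (simCfg (.inl .rewind) p (sealedClock _ B H) ⟨countTape _ B m, 0⟩ (sealedStack _ B H i)
        (sealedStack _ B H i))
      (simCfg (.inr (.inl M.start)) (p - 1) (sealedClock _ B H) ⟨countTape _ B m, 0⟩
        (sealedStack _ B H 0) (sealedStack _ B H 0)) := by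
  have hread : (sealedStack M.Symbol B H i).read = if i = 0 then .left else .blank := by
    simp only [sealedStack, TapeState.read]
    rw [Function.update_of_ne (by omega)]
    rfl
  have hsp : H + 1 < sp := by omega
  induction i with
  | zero =>
    have := leads_of_setupNext (M := M) (B := B) (x := x) (sp := sp) (s := .rewind) (p := p)
      (t₁ := sealedClock _ B H) (t₂ := ⟨countTape _ B m, 0⟩) (t₃ := sealedStack _ B H 0)
      (t₄ := sealedStack _ B H 0) (s' := .inr (.inl M.start)) (d := .left)
      (a₁ := ((sealedClock _ B H).read, .stay))
      (a₂ := (TapeState.read ⟨countTape _ B m, 0⟩, .stay))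
      (a₃ := ((sealedStack _ B H 0).read, .stay)) (a₄ := ((sealedStack _ B H 0).read, .stay))
      (by simp only [setupNext, quad, hread, if_true]) hsp
      (by simp only; omega) (by simp only [sealedStack]; omega) (by simp only [sealedStack]; omega)
    simpa only [min_moveHead_left hp, TapeState.act_read_stay] using this
  | succ i ih =>
    refine .trans ?_ (ih (by omega) (by
      simp only [sealedStack, TapeState.read]
      rw [Function.update_of_ne (by omega)]
      rfl))
    have := leads_of_setupNext (M := M) (B := B) (x := x) (sp := sp) (s := .rewind) (p := p)
      (t₁ := sealedClock _ B H) (t₂ := ⟨countTape _ B m, 0⟩) (t₃ := sealedStack _ B H (i + 1))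
      (t₄ := sealedStack _ B H (i + 1)) (s' := .inl .rewind) (d := .stay)
      (a₁ := ((sealedClock _ B H).read, .stay))
      (a₂ := (TapeState.read ⟨countTape _ B m, 0⟩, .stay))
      (a₃ := ((sealedStack _ B H (i + 1)).read, .left))
      (a₄ := ((sealedStack _ B H (i + 1)).read, .left))
      (by
        simp only [setupNext, quad, hread]
        rfl) hsp
      (by simp only; omega) (by simp only [sealedStack]; omega) (by simp only [sealedStack]; omega)
    rw [min_moveHead_stay hp, TapeState.act_read_stay, TapeState.act_read_stay,
      TapeState.act_read] at this
    exact this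

/-- The space marked for an input that starts with numbers of `m`, `a`, `b` and `c` bits. -/
def markedSpace (m a b c : ℕ) : ℕ := (2 ^ (m + 1) - 1) * (a + b + c + 3)

/-- The setup phase. -/
theorem leads_setup {m a b c : ℕ} (hm : BitField x 0 m) (ha : BitField x (m + 1) a)
    (hb : BitField x (m + 1 + a + 1) b) (hc : BitField x (m + 1 + a + 1 + b + 1) c)
    (hsp : m + 2 ≤ sp) (hH : markedSpace m a b c + 2 ≤ sp) :
    (M.compile B).Leads x sp (M.compile B).init
      (simCfg (.inr (.inl M.start)) m (sealedClock _ B (markedSpace m a b c))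
        ⟨countTape _ B m, 0⟩ (sealedStack _ B (markedSpace m a b c) 0)
        (sealedStack _ B (markedSpace m a b c) 0)) := by
  have hcomma : inputCell x (m + 1) = .letter .comma := by simpa using hm.comma
  have hp : m + 1 ≤ x.length + 1 := by
    have := inputCell_eq_letter_le hcomma
    omega
  have h₁ := leads_load_comma (M := M) (B := B) hm (sp := sp) (by omega) hsp
  have h₂ := leads_visit_all (M := M) (B := B) hcomma ha hb hc hsp (m + 1) le_rfl hH
  simp only [zero_add] at h₁
  rw [Nat.sub_self] at h₂
  exact (leads_init (by omega)).trans (h₁.trans (h₂.trans ((leads_seal hp hH).trans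
    (leads_rewind hp hH _ le_rfl))))

end StackMachine

end Oscillation

namespace Oscillation

open NTM (inputCell moveHead)

namespace StackMachine

variable {M : StackMachine Letter} {B : ℕ} {x : List Letter} {sp : ℕ}

/-! #### The simulation phase -/

/-- The list `l`, with its head on the right, stands on cells `1, …, l.length`, after a left
marker. -/
def Holds {σ τ : Type} {B : ℕ} (e : τ → TapeSymbol σ B) (f : ℕ → TapeSymbol σ B) :
    List τ → Prop
  | [] => f 0 = .left
  | a :: l => f (l.length + 1) = e a ∧ Holds e f l

theorem Holds.update {σ τ : Type} {e : τ → TapeSymbol σ B} {f : ℕ → TapeSymbol σ B} {l : List τ}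
    (h : Holds e f l) {i : ℕ} (hi : l.length < i) (v : TapeSymbol σ B) :
    Holds e (Function.update f i v) l := by
  induction l with
  | nil => simpa [Holds, Function.update_of_ne (show 0 ≠ i by simp at hi; omega)] using h
  | cons a l ih =>
    simp only [List.length_cons] at hi
    exact ⟨by rw [Function.update_of_ne (by omega)]; exact h.1, ih h.2 (by omega)⟩

/-- A tape that holds the stack `l`, with the head on its topmost symbol. -/
structure StackRep {σ : Type} {B : ℕ} (H : ℕ) (t : TapeState (TapeSymbol σ B)) (l : List σ) :
    Prop where
  head : t.head = l.length
  length_le : l.length ≤ H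
  holds : Holds .sym t.content l
  right : t.content (H + 1) = .right
  ne_right : ∀ i ≤ H, t.content i ≠ .right

variable {σ : Type} {H : ℕ}

theorem StackRep.topSymbol {t : TapeState (TapeSymbol σ B)} {l : List σ} (h : StackRep H t l) :
    topSymbol t.read = l.head? := by
  rw [TapeState.read, h.head]
  cases l with
  | nil => rw [show t.content (List.length ([] : List σ)) = .left from h.holds]; rfl
  | cons a l => rw [List.length_cons, h.holds.1]; rfl

/-- The tape of a stack after the first half of an operation. -/
def opMove (t : TapeState (TapeSymbol σ B)) (o : StackOp σ) :
    TapeState (TapeSymbol σ B) :=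
  t.act (t.read, opDir o)

theorem StackRep.head_move_le {t : TapeState (TapeSymbol σ B)} {l : List σ} (h : StackRep H t l)
    (o : StackOp σ) : (opMove t o).head ≤ H + 1 := by
  have h₁ := h.head
  have h₂ := h.length_le
  rw [opMove, TapeState.act_read]
  match o with
  | none => simp only [opDir, moveHead]; omega
  | some none => simp only [opDir, moveHead]; omega
  | some (some a) => simp only [opDir, moveHead]; omega

theorem StackRep.exists_opWrite {t : TapeState (TapeSymbol σ B)} {l : List σ}
    (h : StackRep H t l) {o : StackOp σ} (ho : (o.apply l).length ≤ H) :
    ∃ a, opWrite o (opMove t o).read = some a := by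
  match o with
  | none => exact ⟨_, rfl⟩
  | some none => exact ⟨_, rfl⟩
  | some (some a) =>
    refine ⟨.sym a, ?_⟩
    have hne : (opMove t (some (some a))).read ≠ .right := by
      rw [opMove, TapeState.act_read]
      simp only [TapeState.read, opDir, moveHead]
      refine h.ne_right _ ?_
      have := h.head
      simp only [StackOp.apply, List.length_cons] at ho
      omega
    revert hne
    cases (opMove t (some (some a))).read <;> simp [opWrite]

/-- A push writes above the old top, so the head has to move before it writes; this is why a
transition takes two machine steps. Symbols left above the head by a pop do no harm, since `Holds`
concerns only the cells up to the head. -/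
theorem StackRep.act_opWrite {t : TapeState (TapeSymbol σ B)} {l : List σ} (h : StackRep H t l)
    {o : StackOp σ} {a : TapeSymbol σ B} (ha : opWrite o (opMove t o).read = some a) :
    StackRep H ((opMove t o).act (a, .stay)) (o.apply l) := by
  match o with
  | none =>
    obtain rfl : (opMove t none).read = a := Option.some_injective _ ha
    rw [TapeState.act_read_stay, opMove, TapeState.act_read]
    exact ⟨h.head, h.length_le, h.holds, h.right, h.ne_right⟩
  | some none =>
    obtain rfl : (opMove t (some none)).read = a := Option.some_injective _ ha
    rw [TapeState.act_read_stay, opMove, TapeState.act_read]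
    have h₁ := h.head
    have h₂ := h.length_le
    refine ⟨?_, ?_, ?_, h.right, h.ne_right⟩
    · simp [StackOp.apply, opDir, moveHead, h₁]
    · simp [StackOp.apply]; omega
    · have := h.holds
      cases l with
      | nil => exact this
      | cons b l => exact this.2
  | some (some b) =>
    have h₁ := h.head
    have h₂ := h.length_le
    rw [opMove, TapeState.act_read] at ha ⊢
    simp only [TapeState.read, opDir, moveHead, h₁] at ha
    -- At height `H` the cell above is the right marker, and the push would have failed.
    have hlt : l.length < H := by
      by_contra hlt
      rw [show l.length = H by omega, h.right] at ha
      simp [opWrite] at ha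
    obtain rfl : a = .sym b := by
      have := h.ne_right (l.length + 1) (by omega)
      revert ha this
      cases t.content (l.length + 1) <;> simp [opWrite, eq_comm]
    refine ⟨?_, ?_, ?_, ?_, ?_⟩
    · simp [StackOp.apply, TapeState.act, opDir, moveHead, h₁]
    · simp [StackOp.apply]; omega
    · refine ⟨?_, ?_⟩
      · simp [TapeState.act, opDir, moveHead, h₁]
      · simp only [TapeState.act, opDir, moveHead, h₁]
        exact h.holds.update (by omega) _
    · simp only [TapeState.act, opDir, moveHead, h₁]
      rw [Function.update_of_ne (by omega), h.right]
    · intro i hi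
      simp only [TapeState.act, opDir, moveHead, h₁, Function.update_apply]
      split_ifs
      · simp
      · exact h.ne_right i hi

theorem stackRep_sealedStack (σ : Type) (B H : ℕ) : StackRep H (sealedStack σ B H 0) [] where
  head := rfl
  length_le := by simp
  holds := by
    simp [Holds, sealedStack, emptyTape]
  right := by simp [sealedStack]
  ne_right := by
    intro i hi
    simp only [sealedStack, emptyTape]
    rw [Function.update_of_ne (by omega)]
    split_ifs <;> simp

-- The clock

/-- The number of steps of the clock on a subtree of height `j`. -/
def clockLife (B : ℕ) : ℕ → ℕ
  | 0 => 1
  | j + 1 => B * (1 + clockLife B j) + 1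

/-- The number of steps left to the clock, from the digits up to the head. -/
def clockRest (B : ℕ) : ℕ → List (Fin (B + 1)) → ℕ
  | _, [] => 0
  | j, d :: ds => d * (1 + clockLife B j) + 1 + clockRest B (j + 1) ds

theorem pow_le_clockLife (B j : ℕ) : B ^ j ≤ clockLife B j := by
  induction j with
  | zero => simp [clockLife]
  | succ j ih =>
    rw [clockLife, pow_succ, mul_comm]
    have := Nat.mul_le_mul_left B ih
    rw [mul_add]
    omega

/-- The first summand on the right, for a digit `B` above subtrees of height `j`, is exactly
`clockLife B (j + 1)`. -/
theorem clockLife_le_clockRest (B j m : ℕ) :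
    clockLife B (j + m) ≤ clockRest B j (List.replicate m (Fin.last B)) + clockLife B j := by
  induction m generalizing j with
  | zero => simp
  | succ m ih =>
    have := ih (j + 1)
    simp only [List.replicate_succ, clockRest, Fin.val_last] at this ⊢
    rw [clockLife] at this
    rw [show j + (m + 1) = j + 1 + m by omega]
    omega

/-- The clock tape with `n` steps left. -/
inductive ClockRep {σ : Type} {B : ℕ} (H : ℕ) (t : TapeState (TapeSymbol σ B)) : ℕ → Prop
  | inner (ds : List (Fin (B + 1))) : t.head = ds.length → ds.length ≤ H →
      Holds .digit t.content ds →
      (∀ i, ds.length < i → i ≤ H → t.content i = .digit (Fin.last B)) →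
      t.content (H + 1) = .right → ClockRep H t (clockRest B (H - ds.length) ds)
  | outer (ds : List (Fin (B + 1))) : t.head = H + 1 → ds.length = H →
      Holds .digit t.content ds → t.content (H + 1) = .right →
      ClockRep H t (clockRest B 0 ds + 1)

theorem ClockRep.head_le {t : TapeState (TapeSymbol σ B)} {n : ℕ} (h : ClockRep H t n) :
    t.head ≤ H + 1 := by
  cases h <;> omega

/-- The clock is at a node of a tree of degree `B`, with the numbers of unvisited children on the
path above it as digits. Each tick follows one edge, so the time left drops by exactly one; it is
zero only at the left marker. -/
theorem ClockRep.tick {t : TapeState (TapeSymbol σ B)} {n : ℕ} (h : ClockRep H t n) :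
    (tick t.read = none ∧ n = 0) ∨
      ∃ a m, tick t.read = some a ∧ n = m + 1 ∧ ClockRep H (t.act a) m := by
  cases h with
  | outer ds hh hlen hd hr =>
    right
    have hread : t.read = .right := by rw [TapeState.read, hh, hr]
    refine ⟨(.right, .left), _, by rw [hread]; rfl, rfl, ?_⟩
    rw [← hread, TapeState.act_read]
    have : clockRest B 0 ds = clockRest B (H - ds.length) ds := by rw [hlen, Nat.sub_self]
    rw [this]
    exact .inner ds (by simp [hh, moveHead, hlen]) hlen.le hd (fun i _ _ => by omega) hr
  | inner ds hh hlen hd hfresh hr =>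
    cases ds with
    | nil =>
      left
      refine ⟨?_, rfl⟩
      rw [TapeState.read, hh, show t.content (List.length []) = .left from hd]
      rfl
    | cons d ds =>
      right
      simp only [List.length_cons] at hh hlen hfresh
      have hread : t.read = .digit d := by rw [TapeState.read, hh, hd.1]
      have hsub : H - (ds.length + 1) + 1 = H - ds.length := by omega
      by_cases h0 : (d : ℕ) = 0
      -- No child is left: the digit is made fresh for the next visit and the head goes up.
      · refine ⟨(.digit (Fin.last B), .left), clockRest B (H - ds.length) ds,
          by rw [hread]; simp [StackMachine.tick, h0], ?_, ?_⟩
        · simp only [List.length_cons, clockRest, h0, hsub]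
          omega
        · refine .inner ds (by simp [TapeState.act, hh, moveHead]) (by omega) ?_ ?_ ?_
          · exact hd.2.update (by omega) _
          · intro i hi hiH
            simp only [TapeState.act, Function.update_apply]
            split_ifs with hi'
            · rfl
            · exact hfresh i (by omega) hiH
          · simp only [TapeState.act]
            rw [Function.update_of_ne (by omega), hr]
      · set d' : Fin (B + 1) := ⟨d - 1, by omega⟩ with hd'
        have hd0 : (d : ℕ) = d' + 1 := by simp only [hd']; omega
        refine ⟨(.digit d', .right), d' * (1 + clockLife B (H - (ds.length + 1))) +
          clockLife B (H - (ds.length + 1)) + 1 + clockRest B (H - ds.length) ds,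
          by rw [hread]; simp [StackMachine.tick, h0, hd'], ?_, ?_⟩
        · simp only [List.length_cons, clockRest, hd0, hsub]
          ring
        · have hcontent : (t.act (.digit d', .right)).content =
              Function.update t.content (ds.length + 1) (.digit d') := by
            rw [← hh]
            rfl
          have hhold : Holds .digit (t.act (.digit d', .right)).content (d' :: ds) := by
            rw [hcontent]
            exact ⟨by simp, hd.2.update (by omega) _⟩
          have hright : (t.act (.digit d', .right)).content (H + 1) = .right := by
            rw [hcontent, Function.update_of_ne (by omega), hr]
          by_cases hend : ds.length + 1 = H
          -- The child is a leaf, represented by the right marker, and accounts for `clockLife B 0 =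
          -- 1` step.
          · have := ClockRep.outer (H := H) (d' :: ds)
              (show (t.act (.digit d', .right)).head = H + 1 by
                simp [TapeState.act, moveHead, hh, hend]) (by simpa using hend) hhold hright
            convert this using 1
            rw [show H - (ds.length + 1) = 0 by omega, show H - ds.length = 1 by omega]
            simp only [clockRest, clockLife, zero_add]
            omega
          -- The child is an inner node whose digit is still fresh, so its whole subtree lies ahead.
          · have := ClockRep.inner (H := H) (Fin.last B :: d' :: ds)
              (show (t.act (.digit d', .right)).head = _ by
                simp [TapeState.act, moveHead, hh]) (by simp only [List.length_cons]; omega)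
              ⟨by
                rw [hcontent, Function.update_of_ne (by simp)]
                exact hfresh _ (by simp) (by simp only [List.length_cons]; omega), hhold⟩
              (fun i hi hiH => by
                simp only [List.length_cons] at hi
                rw [hcontent, Function.update_of_ne (by omega), hfresh i (by omega) hiH]) hright
            convert this using 1
            obtain ⟨j, hj⟩ : ∃ j, H = ds.length + 1 + 1 + j := ⟨H - (ds.length + 2), by omega⟩
            have e₁ : H - (ds.length + 1) = j + 1 := by omega
            have e₂ : H - ds.length = j + 1 + 1 := by omega
            have e₃ : H - (Fin.last B :: d' :: ds).length = j := by
              simp only [List.length_cons]; omega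
            rw [e₁, e₂, e₃]
            simp only [clockRest, clockLife, Fin.val_last]
            ring

theorem holds_replicate {τ : Type} {e : τ → TapeSymbol σ B} {f : ℕ → TapeSymbol σ B} {a : τ}
    (h0 : f 0 = .left) (m : ℕ) (h : ∀ i, 1 ≤ i → i ≤ m → f i = e a) :
    Holds e f (List.replicate m a) := by
  induction m with
  | zero => exact h0
  | succ m ih =>
    refine ⟨?_, ih fun i h₁ h₂ => h i h₁ (by omega)⟩
    simpa using h (m + 1) (by omega) le_rfl

/-- The clock starts at a leaf below a path of fresh digits. What remains is still at least one full
traversal of height `H`, hence at least its `B ^ H` leaves. -/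
theorem clockRep_sealedClock (σ : Type) (B H : ℕ) :
    ∃ n, B ^ H ≤ n ∧ ClockRep H (sealedClock σ B H) n := by
  refine ⟨_, ?_, .outer (List.replicate H (Fin.last B)) rfl (by simp) ?_ (by simp [sealedClock])⟩
  · refine (pow_le_clockLife B H).trans ?_
    simpa [clockLife] using clockLife_le_clockRest B 0 H
  · refine holds_replicate (by simp [sealedClock, clockTape]) H fun i h₁ h₂ => ?_
    simp only [sealedClock, clockTape]
    rw [Function.update_of_ne (by omega), if_neg (by omega), if_pos h₂]

theorem step_inr_inl_iff {q : M.State} {p : ℕ} {t₁ t₂ t₃ t₄ : TapeState (M.SimSymbol B)}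
    {C : (M.compile B).Config} :
    (M.compile B).Step x (simCfg (.inr (.inl q)) p t₁ t₂ t₃ t₄) C ↔
      ∃ o ∈ M.trans q (inputCell x p) (topSymbol t₃.read) (topSymbol t₄.read),
        ∃ a, StackMachine.tick t₁.read = some a ∧
        C = simCfg (.inr (.inr (o.1, o.2.2.1, o.2.2.2))) (min (moveHead o.2.1 p) (x.length + 1))
          (t₁.act a) t₂ (opMove t₃ o.2.2.1) (opMove t₄ o.2.2.2) := by
  rw [step_simCfg_iff]
  constructor
  · rintro ⟨_, ⟨o, ho, a, ha, rfl⟩, rfl⟩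
    refine ⟨o, ho, a, ha, ?_⟩
    simp only [quad, opMove, TapeState.act_read_stay]
  · rintro ⟨o, ho, a, ha, rfl⟩
    refine ⟨_, ⟨o, ho, a, ha, rfl⟩, ?_⟩
    simp only [quad, opMove, TapeState.act_read_stay]

theorem step_inr_inr_iff {q : M.State} {o₁ o₂ : StackOp M.Symbol} {p : ℕ}
    (hp : p ≤ x.length + 1) {t₁ t₂ t₃ t₄ : TapeState (M.SimSymbol B)}
    {C : (M.compile B).Config} :
    (M.compile B).Step x (simCfg (.inr (.inr (q, o₁, o₂))) p t₁ t₂ t₃ t₄) C ↔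
      ∃ a b, opWrite o₁ t₃.read = some a ∧ opWrite o₂ t₄.read = some b ∧
        C = simCfg (.inr (.inl q)) p t₁ t₂ (t₃.act (a, .stay)) (t₄.act (b, .stay)) := by
  rw [step_simCfg_iff]
  constructor
  · rintro ⟨_, ⟨a, b, ha, hb, rfl⟩, rfl⟩
    refine ⟨a, b, ha, hb, ?_⟩
    simp only [quad, TapeState.act_read_stay, min_moveHead_stay hp]
  · rintro ⟨a, b, ha, hb, rfl⟩
    refine ⟨_, ⟨a, b, ha, hb, rfl⟩, ?_⟩
    simp only [quad, TapeState.act_read_stay, min_moveHead_stay hp]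

/-- Each simulated transition costs a tick, so induction on the time left gives termination. The
markers confine the heads to the cells up to `H + 1`. -/
theorem safe_of_rep {Φ : Prop} (hH : H + 2 ≤ sp) {t₂ : TapeState (M.SimSymbol B)}
    (ht₂ : t₂.head < sp) {n : ℕ} {c : M.Config} {t₁ t₃ t₄ : TapeState (M.SimSymbol B)}
    (h₁ : ClockRep H t₁ n) (h₃ : StackRep H t₃ c.fst) (h₄ : StackRep H t₄ c.snd)
    (hΦ : M.Acc x H c → Φ) :
    (M.compile B).Safe x sp Φ (simCfg (.inr (.inl c.state)) c.pos t₁ t₂ t₃ t₄) := by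
  induction n using Nat.strong_induction_on generalizing c t₁ t₃ t₄ with
  | _ n ih =>
    refine .intro _ ?_ ?_ ?_
    · have := h₁.head_le
      have := h₃.head
      have := h₃.length_le
      have := h₄.head
      have := h₄.length_le
      rintro (_ | _ | _ | _) <;> simp only [simCfg, quad] <;> omega
    · intro h
      simp only [simCfg, compile, Sum.inr.injEq, Sum.inl.injEq] at h
      exact hΦ ⟨0, .halt _ _ ⟨h₃.length_le, h₄.length_le⟩ h⟩
    · intro C hC
      obtain ⟨o, ho, a, ha, rfl⟩ := step_inr_inl_iff.1 hC
      rw [h₃.topSymbol, h₄.topSymbol] at ho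
      rcases h₁.tick with ⟨hn, -⟩ | ⟨a', m, ha', rfl, h₁'⟩
      · simp [hn] at ha
      obtain rfl : a' = a := Option.some_injective _ (ha'.symm.trans ha)
      refine .intro _ ?_ (fun h => by simp [simCfg, compile] at h) ?_
      · have := h₁'.head_le
        have := h₃.head_move_le o.2.2.1
        have := h₄.head_move_le o.2.2.2
        rintro (_ | _ | _ | _) <;> simp only [simCfg, quad] <;> omega
      · intro C' hC'
        obtain ⟨a, b, ha, hb, rfl⟩ := (step_inr_inr_iff (min_le_right _ _)).1 hC'
        refine ih m (by omega) (c := M.next x c o) h₁' (h₃.act_opWrite ha) (h₄.act_opWrite hb)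
          fun hacc => hΦ ?_
        exact hacc.of_next ⟨h₃.length_le, h₄.length_le⟩ ho

/-- A computation of bounded height never meets the right marker with a push, and only the first of
the two machine steps per transition uses the clock. So `k` ticks suffice for `k` transitions. -/
theorem reach_of_accIn {t₂ : TapeState (M.SimSymbol B)} {k : ℕ} {c : M.Config}
    (hc : M.AccIn x H k c) {n : ℕ} (hn : k ≤ n) {t₁ t₃ t₄ : TapeState (M.SimSymbol B)}
    (h₁ : ClockRep H t₁ n) (h₃ : StackRep H t₃ c.fst) (h₄ : StackRep H t₄ c.snd) :
    ∃ C, Relation.ReflTransGen ((M.compile B).Step x)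
      (simCfg (.inr (.inl c.state)) c.pos t₁ t₂ t₃ t₄) C ∧ C.state = (M.compile B).accept := by
  induction hc generalizing n t₁ t₃ t₄ with
  | halt k c _ h => exact ⟨_, .refl, by simp [simCfg, h, compile]⟩
  | step k c o _ ho hacc ih =>
    rcases h₁.tick with ⟨-, hn'⟩ | ⟨a, m, ha, hm, h₁'⟩
    · omega
    obtain ⟨b₁, hb₁⟩ := h₃.exists_opWrite (o := o.2.2.1) hacc.fits.1
    obtain ⟨b₂, hb₂⟩ := h₄.exists_opWrite (o := o.2.2.2) hacc.fits.2
    obtain ⟨C, hC, hC'⟩ := ih (n := m) (by omega) h₁' (h₃.act_opWrite hb₁) (h₄.act_opWrite hb₂)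
    refine ⟨C, .head (b := simCfg (.inr (.inr (o.1, o.2.2.1, o.2.2.2)))
      (min (moveHead o.2.1 c.pos) (x.length + 1)) (t₁.act a) t₂ (opMove t₃ o.2.2.1)
      (opMove t₄ o.2.2.2)) ?_ (.head ?_ hC), hC'⟩
    · refine step_inr_inl_iff.2 ⟨o, ?_, a, ha, rfl⟩
      rw [h₃.topSymbol, h₄.topSymbol]
      exact ho
    · exact (step_inr_inr_iff (min_le_right _ _)).2 ⟨b₁, b₂, hb₁, hb₂, rfl⟩

/-- The simulating machine decides acceptance of the stack machine within the marked space. -/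
theorem compile_spec {m a b c : ℕ} (hm : BitField x 0 m) (ha : BitField x (m + 1) a)
    (hb : BitField x (m + 1 + a + 1) b) (hc : BitField x (m + 1 + a + 1 + b + 1) c)
    (hsp : m + 2 ≤ sp) (hH : markedSpace m a b c + 2 ≤ sp)
    (hB : (M.bounded x (markedSpace m a b c)).ncard ≤ B ^ markedSpace m a b c) :
    ((M.compile B).Accepts x ↔ M.Acc x (markedSpace m a b c) ⟨M.start, m, [], []⟩) ∧
      (M.compile B).HaltsOn x ∧ (M.compile B).SpaceOn x sp := by
  have hlead := leads_setup (M := M) (B := B) hm ha hb hc hsp hH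
  obtain ⟨n, hn, hclock⟩ := clockRep_sealedClock M.Symbol B (markedSpace m a b c)
  have hstack := stackRep_sealedStack M.Symbol B (markedSpace m a b c)
  have hsafe := hlead.2 _ (safe_of_rep (Φ := M.Acc x (markedSpace m a b c) ⟨M.start, m, [], []⟩)
    (c := ⟨M.start, m, [], []⟩) hH (show 0 < sp by omega) hclock hstack hstack id)
  refine ⟨⟨hsafe.of_accepts, fun hacc => ?_⟩, hsafe.haltsOn, hsafe.spaceOn⟩
  have hpos : m ≤ x.length + 1 := by
    have := inputCell_eq_letter_le hm.comma
    omega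
  -- Some accepting computation has at most as many steps as there are bounded configurations, and
  -- the clock runs at least that long.
  obtain ⟨C, hC, hC'⟩ := reach_of_accIn (B := B) (t₂ := ⟨countTape _ B m, 0⟩)
    (hacc.accIn hpos) (hB.trans hn) hclock hstack hstack
  exact ⟨C, hlead.1.trans hC, hC'⟩

end StackMachine

end Oscillation

namespace Oscillation

open NTM (inputCell moveHead)

/-! ### A stack machine for the emptiness problem

The first stack holds goals `(s, γ)`, to be met one after the other: some derivation from `γ` has
the value `s.val q`, where the level `q` is the height of the second stack. The level rises by one
between two goals for each marker `up` between them. -/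

/-- The two forms of values with first component `q`. -/
inductive Shape
  | single
  | double

/-- The value of shape `s` at level `q`. -/
def Shape.val : Shape → ℕ → ℕ × ℕ
  | .single, q => (q, q + 1)
  | .double, q => (q, q)

/-- Stack symbols. -/
inductive GoalSymbol
  | bit (b : Bool)
  | goal (s : Shape)
  | up
  | unit

/-- What to do after the second symbol on the right hand side of a rule has been copied. -/
inductive AfterCopy
  | descend
  | copy
  | run

/-- States of the machine. -/
inductive GoalState
  | level
  | twice (b : Bool)
  | twice' (b : Bool)
  | refill (b : Bool)
  | header
  | start
  | run
  | seek (s : Shape)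
  | source (s : Shape)
  | label (s : Shape)
  | compare (s : Shape)
  | target (s : Shape)
  | pop
  | skipFst (s : Shape) (a : AfterCopy)
  | skipSnd (s : Shape) (a : AfterCopy)
  | copySnd (s : Shape) (a : AfterCopy)
  | descend
  | descend'
  | copyFst
  | skipTail
  | copyTail
  | lower
  | lower'
  | done

/-- The state in which a copy of the second symbol is followed up. -/
def AfterCopy.state : AfterCopy → GoalState
  | .descend => .descend
  | .copy => .copyFst
  | .run => .run

instance : Finite Shape :=
  Finite.of_injective (β := Fin 2) (fun | .single => 0 | .double => 1) (by
    intro a b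
    cases a <;> cases b <;> simp)

instance : Finite AfterCopy :=
  Finite.of_injective (β := Fin 3) (fun | .descend => 0 | .copy => 1 | .run => 2) (by
    intro a b
    cases a <;> cases b <;> simp)

instance : Finite GoalSymbol :=
  Finite.of_injective (β := Bool ⊕ Shape ⊕ Fin 2)
    (fun
      | .bit b => .inl b
      | .goal s => .inr (.inl s)
      | .up => .inr (.inr 0)
      | .unit => .inr (.inr 1)) (by
      intro a b
      cases a <;> cases b <;> simp)

instance : Finite GoalState :=
  Finite.of_injective (β := Fin 13 ⊕ (Fin 3 × Bool) ⊕ (Fin 5 × Shape) ⊕ (Fin 3 × Shape × AfterCopy))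
    (fun
      | .level => .inl 0
      | .header => .inl 1
      | .start => .inl 2
      | .run => .inl 3
      | .pop => .inl 4
      | .descend => .inl 5
      | .descend' => .inl 6
      | .copyFst => .inl 7
      | .skipTail => .inl 8
      | .copyTail => .inl 9
      | .lower => .inl 10
      | .lower' => .inl 11
      | .twice b => .inr (.inl (0, b))
      | .twice' b => .inr (.inl (1, b))
      | .refill b => .inr (.inl (2, b))
      | .seek s => .inr (.inr (.inl (0, s)))
      | .source s => .inr (.inr (.inl (1, s)))
      | .label s => .inr (.inr (.inl (2, s)))
      | .compare s => .inr (.inr (.inl (3, s)))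
      | .target s => .inr (.inr (.inl (4, s)))
      | .skipFst s a => .inr (.inr (.inr (0, s, a)))
      | .skipSnd s a => .inr (.inr (.inr (1, s, a)))
      | .copySnd s a => .inr (.inr (.inr (2, s, a)))
      | .done => .inl 12) (by
      intro a b
      cases a <;> cases b <;> simp)

/-- The transitions: `GoalTr q c t u o` means that in state `q`, on the input cell `c` and with `t`
and `u` on top of the two stacks, `o` may be done. -/
inductive GoalTr : GoalState → InputCell Letter → Option GoalSymbol → Option GoalSymbol →
    GoalState × Dir × StackOp GoalSymbol × StackOp GoalSymbol → Prop
  -- The number `k` is converted to unary by Horner's rule: the level is doubled by way of the first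
  -- stack, then the next bit is added.
  | level_bit (b t u) : GoalTr .level (.letter (.bit b)) t u (.twice b, .stay, none, none)
  | level_end (t u) : GoalTr .level .leftEnd t u (.header, .right, none, none)
  | twice_pop (b c t) :
      GoalTr (.twice b) c t (some .unit) (.twice' b, .stay, some (some .unit), some none)
  | twice_push (b c t u) : GoalTr (.twice' b) c t u (.twice b, .stay, some (some .unit), none)
  | twice_end (b c t) : GoalTr (.twice b) c t none (.refill b, .stay, none, none)
  | refill_pop (b c u) :
      GoalTr (.refill b) c (some .unit) u (.refill b, .stay, some none, some (some .unit))
  | refill_end (b c u) : GoalTr (.refill b) c none u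
      (.level, .left, none, if b then some (some .unit) else none)
  | header_bit (b t u) : GoalTr .header (.letter (.bit b)) t u (.header, .right, none, none)
  | header_comma (t u) : GoalTr .header (.letter .comma) t u (.header, .right, none, none)
  | header_action (t u) : GoalTr .header (.letter .action) t u (.start, .left, none, none)
  | header_end (t u) : GoalTr .header .rightEnd t u (.start, .left, none, none)
  | start (t u) : GoalTr .start (.letter .comma) t u (.copyFst, .left, none, none)
  | run_up (c u) : GoalTr .run c (some .up) u (.run, .stay, some none, some (some .unit))
  | run_end (c u) : GoalTr .run c none u (.done, .stay, none, none)
  | run_goal (s c u) : GoalTr .run c (some (.goal s)) u (.seek s, .stay, some none, none)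
  -- The head may wander at will; endless searches are cut off by the clock of the simulating
  -- machine.
  | seek_left (s c t u) : GoalTr (.seek s) c t u (.seek s, .left, none, none)
  | seek_right (s c t u) : GoalTr (.seek s) c t u (.seek s, .right, none, none)
  | seek_action (s t u) :
      GoalTr (.seek s) (.letter .action) t u (.source s, .right, none, none)
  -- The only state has number `0`, whose binary notation is empty, so the field of a state is a
  -- mere comma.
  | source (s t u) : GoalTr (.source s) (.letter .comma) t u (.label s, .right, none, none)
  | label_bit (s b t u) : GoalTr (.label s) (.letter (.bit b)) t u (.label s, .right, none, none)
  | label_eps (s t u) : GoalTr (.label s) (.letter .eps) t u (.label s, .right, none, none)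
  | label_comma (s t u) : GoalTr (.label s) (.letter .comma) t u (.compare s, .right, none, none)
  | compare_bit (s b u) : GoalTr (.compare s) (.letter (.bit b)) (some (.bit b)) u
      (.compare s, .right, some none, none)
  | compare_comma (s t u) : (∀ b, t ≠ some (.bit b)) →
      GoalTr (.compare s) (.letter .comma) t u (.target s, .right, none, none)
  -- The value of a leaf is `(0, 1)`, of shape `single` at level `0`. State `pop` checks that the
  -- right hand side is empty and the level is `0`.
  | target_pop (t u) : GoalTr (.target .single) (.letter .comma) t u (.pop, .right, none, none)
  -- The right child inherits shape and level; the left child has lower rank and is met first.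
  | target_keep (s t u) : GoalTr (.target s) (.letter .comma) t u
      (.skipFst s .descend, .right, none, none)
  -- Two children of rank one less whose footprints form a new harmonic: the right one has to be
  -- `single`, the shape of the left one is free.
  | target_split (t) : GoalTr (.target .double) (.letter .comma) t (some .unit)
      (.skipFst .single .copy, .right, some (some .up), some none)
  -- The left child has the full rank; the right child must not raise it and is met first.
  | target_tail (t u) : GoalTr (.target .single) (.letter .comma) t u
      (.skipTail, .right, none, none)
  | pop_action (t) : GoalTr .pop (.letter .action) t none (.run, .stay, none, none)
  | pop_end (t) : GoalTr .pop .rightEnd t none (.run, .stay, none, none)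
  | skipFst_bit (s a b t u) : GoalTr (.skipFst s a) (.letter (.bit b)) t u
      (.skipFst s a, .right, none, none)
  | skipFst_comma (s a t u) : GoalTr (.skipFst s a) (.letter .comma) t u
      (.skipSnd s a, .right, none, none)
  | skipSnd_bit (s a b t u) : GoalTr (.skipSnd s a) (.letter (.bit b)) t u
      (.skipSnd s a, .right, none, none)
  | skipSnd_comma (s a t u) : GoalTr (.skipSnd s a) (.letter .comma) t u
      (.copySnd s a, .left, none, none)
  | copySnd_bit (s a b t u) : GoalTr (.copySnd s a) (.letter (.bit b)) t u
      (.copySnd s a, .left, some (some (.bit b)), none)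
  | copySnd_comma (s a t u) : GoalTr (.copySnd s a) (.letter .comma) t u
      (a.state, .left, some (some (.goal s)), none)
  | descend (c t) : GoalTr .descend c t (some .unit)
      (.descend', .stay, some (some .up), some none)
  | descend_more (c t) : GoalTr .descend' c t (some .unit)
      (.descend', .stay, some (some .up), some none)
  | descend_end (c t u) : GoalTr .descend' c t u (.copyFst, .stay, none, none)
  | copyFst_bit (b t u) : GoalTr .copyFst (.letter (.bit b)) t u
      (.copyFst, .left, some (some (.bit b)), none)
  | copyFst_comma (s t u) : GoalTr .copyFst (.letter .comma) t u
      (.run, .stay, some (some (.goal s)), none)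
  | skipTail_bit (b t u) : GoalTr .skipTail (.letter (.bit b)) t u (.skipTail, .right, none, none)
  | skipTail_comma (t u) : GoalTr .skipTail (.letter .comma) t u (.copyTail, .left, none, none)
  | copyTail_bit (b t u) : GoalTr .copyTail (.letter (.bit b)) t u
      (.copyTail, .left, some (some (.bit b)), none)
  | copyTail_comma (s t u) : GoalTr .copyTail (.letter .comma) t u
      (.lower, .right, some (some (.goal s)), none)
  | lower (c t) : GoalTr .lower c t (some .unit) (.lower', .stay, some (some .up), some none)
  -- At an unchanged level the right child has to be `double`: a right child `(q, q + 1)` would give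
  -- the node rank `q + 1`.
  | lower_end (c t u) : GoalTr .lower c t u (.skipFst .double .run, .stay, none, none)
  | lower_more (c t) : GoalTr .lower' c t (some .unit)
      (.lower', .stay, some (some .up), some none)
  | lower_more_end (s c t u) : GoalTr .lower' c t u (.skipFst s .run, .stay, none, none)

/-- The stack machine for the emptiness problem. -/
def goalMachine : StackMachine Letter where
  State := GoalState
  Symbol := GoalSymbol
  start := .level
  accept := .done
  trans := fun q c t u => {o | GoalTr q c t u o}

/-- A configuration of the machine. -/
abbrev goalCfg (q : GoalState) (p : ℕ) (S V : List GoalSymbol) : goalMachine.Config := ⟨q, p, S, V⟩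

/-- Bounded acceptance in at most `n` steps. -/
abbrev GoalAccIn (x : List Letter) (H n : ℕ) (q : GoalState) (p : ℕ) (S V : List GoalSymbol) :
    Prop := goalMachine.AccIn x H n (goalCfg q p S V)

/-- Bounded acceptance. -/
abbrev GoalAcc (x : List Letter) (H : ℕ) (q : GoalState) (p : ℕ) (S V : List GoalSymbol) :
    Prop := goalMachine.Acc x H (goalCfg q p S V)

/-- Acceptance from the two configurations is equivalent, and the second is not farther from it. -/
def GoalLeads (x : List Letter) (H : ℕ) (c d : goalMachine.Config) : Prop :=
  (∀ n, goalMachine.AccIn x H n c → goalMachine.AccIn x H n d) ∧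
    (goalMachine.Acc x H d → goalMachine.Acc x H c)

theorem GoalLeads.refl {x : List Letter} {H : ℕ} (c : goalMachine.Config) : GoalLeads x H c c :=
  ⟨fun _ => id, id⟩

theorem GoalLeads.trans {x : List Letter} {H : ℕ} {c d e : goalMachine.Config}
    (h : GoalLeads x H c d) (h' : GoalLeads x H d e) : GoalLeads x H c e :=
  ⟨fun n hn => h'.1 n (h.1 n hn), fun he => h.2 (h'.2 he)⟩

section

variable {x : List Letter} {H : ℕ} {q : GoalState} {p : ℕ} {S V : List GoalSymbol}

theorem GoalAccIn.exists_step {n : ℕ} (h : GoalAccIn x H n q p S V) (hq : q ≠ .done) :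
    ∃ m < n, ∃ q' d o₁ o₂, GoalTr q (inputCell x p) S.head? V.head? (q', d, o₁, o₂) ∧
      GoalAccIn x H m q' (min (moveHead d p) (x.length + 1)) (StackOp.apply o₁ S)
        (StackOp.apply o₂ V) := by
  obtain ⟨m, hm, o, ho, h⟩ := StackMachine.AccIn.exists_step h hq
  exact ⟨m, hm, o.1, o.2.1, o.2.2.1, o.2.2.2, ho, h⟩

theorem GoalAcc.of_tr {q' : GoalState} {d : Dir} {o₁ o₂ : StackOp GoalSymbol}
    (h : GoalTr q (inputCell x p) S.head? V.head? (q', d, o₁, o₂)) {p' : ℕ}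
    {S' V' : List GoalSymbol} (hacc : GoalAcc x H q' p' S' V')
    (hp : min (moveHead d p) (x.length + 1) = p') (hS : StackOp.apply o₁ S = S')
    (hV : StackOp.apply o₂ V = V') (hS' : S.length ≤ H) (hV' : V.length ≤ H) :
    GoalAcc x H q p S V := by
  subst hp hS hV
  exact StackMachine.Acc.of_next (M := goalMachine) (o := (q', d, o₁, o₂)) ⟨hS', hV'⟩ h hacc

/-- Acceptance from the later configuration bounds only its own stacks. The two implications between
heights recover the bound for the earlier one; they hold trivially for pushes, while pops need a
bound from elsewhere. -/
theorem goalLeads_of_tr {q' : GoalState} {d : Dir} {o₁ o₂ : StackOp GoalSymbol}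
    (h : ∀ o, GoalTr q (inputCell x p) S.head? V.head? o ↔ o = (q', d, o₁, o₂))
    (hq : q ≠ .done) {p' : ℕ} {S' V' : List GoalSymbol}
    (hp : min (moveHead d p) (x.length + 1) = p') (hS : StackOp.apply o₁ S = S')
    (hV : StackOp.apply o₂ V = V') (hS' : S'.length ≤ H → S.length ≤ H)
    (hV' : V'.length ≤ H → V.length ≤ H) :
    GoalLeads x H (goalCfg q p S V) (goalCfg q' p' S' V') := by
  constructor
  · intro n hn
    obtain ⟨m, hm, q₁, d₁, o₃, o₄, htr, hacc⟩ := GoalAccIn.exists_step hn hq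
    have := (h _).1 htr
    simp only [Prod.mk.injEq] at this
    obtain ⟨rfl, rfl, rfl, rfl⟩ := this
    subst hp hS hV
    exact StackMachine.AccIn.mono hm.le hacc
  · intro hacc
    exact GoalAcc.of_tr ((h _).2 rfl) hacc hp hS hV (hS' hacc.fits.1) (hV' hacc.fits.2)

theorem goalLeads_keep {q' : GoalState} {d : Dir}
    (h : ∀ o, GoalTr q (inputCell x p) S.head? V.head? o ↔ o = (q', d, none, none))
    (hq : q ≠ .done) {p' : ℕ} (hp : min (moveHead d p) (x.length + 1) = p') :
    GoalLeads x H (goalCfg q p S V) (goalCfg q' p' S V) :=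
  goalLeads_of_tr h hq hp rfl rfl id id

end

end Oscillation

-- Scanning and copying names

namespace Oscillation

open NTM (inputCell moveHead)

/-- From cell `t` on, the input reads `bs`, then a comma. -/
def FieldAt (x : List Letter) : ℕ → List Bool → Prop
  | t, [] => inputCell x t = .letter .comma
  | t, b :: bs => inputCell x t = .letter (.bit b) ∧ FieldAt x (t + 1) bs

theorem FieldAt.comma {x : List Letter} {t : ℕ} {bs : List Bool} (h : FieldAt x t bs) :
    inputCell x (t + bs.length) = .letter .comma := by
  induction bs generalizing t with
  | nil => exact h
  | cons b bs ih =>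
    have := ih h.2
    rwa [List.length_cons, show t + (bs.length + 1) = t + 1 + bs.length by omega]

theorem FieldAt.cell {x : List Letter} {t : ℕ} {bs : List Bool} (h : FieldAt x t bs) :
    inputCell x t = .letter .comma ∨ ∃ b, inputCell x t = .letter (.bit b) := by
  cases bs with
  | nil => exact .inl h
  | cons b bs => exact .inr ⟨b, h.1⟩

/-- States that move right over bits. -/
def IsSkip (q : GoalState) : Prop :=
  q ≠ .done ∧ ∀ b t u o, GoalTr q (.letter (.bit b)) t u o ↔ o = (q, .right, none, none)

/-- States that move left over bits and copy them to the first stack. -/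
def IsCopy (q : GoalState) : Prop :=
  q ≠ .done ∧ ∀ b t u o, GoalTr q (.letter (.bit b)) t u o ↔
    o = (q, .left, some (some (.bit b)), none)

theorem isSkip_skipFst (s : Shape) (a : AfterCopy) : IsSkip (.skipFst s a) :=
  ⟨by simp, fun _ _ _ _ => ⟨fun h => by cases h; rfl, fun h => h ▸ .skipFst_bit ..⟩⟩

theorem isSkip_skipSnd (s : Shape) (a : AfterCopy) : IsSkip (.skipSnd s a) :=
  ⟨by simp, fun _ _ _ _ => ⟨fun h => by cases h; rfl, fun h => h ▸ .skipSnd_bit ..⟩⟩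

theorem isSkip_skipTail : IsSkip .skipTail :=
  ⟨by simp, fun _ _ _ _ => ⟨fun h => by cases h; rfl, fun h => h ▸ .skipTail_bit ..⟩⟩

theorem isCopy_copyFst : IsCopy .copyFst :=
  ⟨by simp, fun _ _ _ _ => ⟨fun h => by cases h; rfl, fun h => h ▸ .copyFst_bit ..⟩⟩

theorem isCopy_copySnd (s : Shape) (a : AfterCopy) : IsCopy (.copySnd s a) :=
  ⟨by simp, fun _ _ _ _ => ⟨fun h => by cases h; rfl, fun h => h ▸ .copySnd_bit ..⟩⟩

theorem isCopy_copyTail : IsCopy .copyTail :=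
  ⟨by simp, fun _ _ _ _ => ⟨fun h => by cases h; rfl, fun h => h ▸ .copyTail_bit ..⟩⟩

/-- A name as a word of stack symbols. -/
def goalBits (bs : List Bool) : List GoalSymbol := bs.map .bit

@[simp] theorem length_goalBits (bs : List Bool) : (goalBits bs).length = bs.length := by
  simp [goalBits]

section

variable {x : List Letter} {H : ℕ} {q : GoalState} {p t : ℕ} {S V : List GoalSymbol}
  {bs : List Bool}

theorem IsSkip.leads (hq : IsSkip q) (h : FieldAt x t bs) :
    GoalLeads x H (goalCfg q t S V) (goalCfg q (t + bs.length) S V) := by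
  induction bs generalizing t with
  | nil => exact .refl _
  | cons b bs ih =>
    have := ih h.2
    rw [List.length_cons, show t + (bs.length + 1) = t + 1 + bs.length by omega]
    refine .trans ?_ this
    refine goalLeads_keep (fun o => ?_) hq.1 (min_moveHead_right h.1)
    rw [h.1]
    exact hq.2 _ _ _ _

/-- Names are copied from right to left. They then lie on the stack with their first bit on top, in
the order in which `compare` meets the bits on the input. -/
theorem IsCopy.leads (hq : IsCopy q) (h : FieldAt x t bs) :
    GoalLeads x H (goalCfg q (t + bs.length - 1) S V)
      (goalCfg q (t - 1) (goalBits bs ++ S) V) := by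
  induction bs generalizing t with
  | nil => exact .refl _
  | cons b bs ih =>
    have := ih h.2
    rw [List.length_cons, show t + (bs.length + 1) - 1 = t + 1 + bs.length - 1 by omega]
    refine this.trans ?_
    rw [Nat.add_sub_cancel]
    refine goalLeads_of_tr (o₁ := some (some (.bit b))) (o₂ := none) (fun o => ?_) hq.1
      (min_moveHead_left (by have := inputCell_eq_letter_le h.1; omega)) rfl rfl ?_ id
    · rw [h.1]
      exact hq.2 _ _ _ _
    · intro h
      simp [goalBits] at h ⊢
      omega

theorem goalLeads_skipFst (s : Shape) (a : AfterCopy) (h : FieldAt x t bs) :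
    GoalLeads x H (goalCfg (.skipFst s a) t S V)
      (goalCfg (.skipSnd s a) (t + bs.length + 1) S V) := by
  refine ((isSkip_skipFst s a).leads h).trans ?_
  refine goalLeads_keep (fun o => ?_) (by simp) (min_moveHead_right h.comma)
  rw [h.comma]
  exact ⟨fun h => by cases h; rfl, fun h => h ▸ .skipFst_comma ..⟩

theorem goalLeads_copySnd (s : Shape) (a : AfterCopy) (h : FieldAt x t bs)
    (ht : inputCell x (t - 1) = .letter .comma) :
    GoalLeads x H (goalCfg (.skipSnd s a) t S V)
      (goalCfg a.state (t - 1 - 1) (.goal s :: goalBits bs ++ S) V) := by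
  refine ((isSkip_skipSnd s a).leads h).trans ?_
  have hle := inputCell_eq_letter_le h.comma
  have h₁ : GoalLeads x H (goalCfg (.skipSnd s a) (t + bs.length) S V)
      (goalCfg (.copySnd s a) (t + bs.length - 1) S V) := by
    refine goalLeads_keep (fun o => ?_) (by simp) (min_moveHead_left (by omega))
    rw [h.comma]
    exact ⟨fun h => by cases h; rfl, fun h => h ▸ .skipSnd_comma ..⟩
  refine h₁.trans (((isCopy_copySnd s a).leads h).trans ?_)
  refine goalLeads_of_tr (o₁ := some (some (.goal s))) (o₂ := none) (fun o => ?_) (by simp)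
    (min_moveHead_left (by omega)) rfl rfl ?_ id
  · rw [ht]
    exact ⟨fun h => by cases h; rfl, fun h => h ▸ .copySnd_comma ..⟩
  · intro h
    simp only [List.cons_append, List.length_cons] at h
    omega

/-- The second symbol of a right hand side is copied, with the input head ending up at the end of
the first. -/
theorem goalLeads_skipFst_copySnd (s : Shape) (a : AfterCopy) {cs : List Bool}
    (h : FieldAt x t bs) (h' : FieldAt x (t + bs.length + 1) cs) :
    GoalLeads x H (goalCfg (.skipFst s a) t S V)
      (goalCfg a.state (t + bs.length - 1) (.goal s :: goalBits cs ++ S) V) := by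
  refine (goalLeads_skipFst s a h).trans ?_
  have := goalLeads_copySnd (x := x) (H := H) (S := S) (V := V) s a h' h.comma
  rwa [Nat.add_sub_cancel] at this

theorem goalLeads_skipTail (h : FieldAt x t bs) :
    GoalLeads x H (goalCfg .skipTail t S V) (goalCfg .copyTail (t - 1) (goalBits bs ++ S) V) := by
  refine (isSkip_skipTail.leads h).trans ?_
  have hle := inputCell_eq_letter_le h.comma
  refine .trans ?_ (isCopy_copyTail.leads h)
  refine goalLeads_keep (fun o => ?_) (by simp) (min_moveHead_left (by omega))
  rw [h.comma]
  exact ⟨fun h => by cases h; rfl, fun h => h ▸ .skipTail_comma ..⟩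

/-- The stack that represents the level `q`. -/
def units (q : ℕ) : List GoalSymbol := List.replicate q .unit

@[simp] theorem length_units (q : ℕ) : (units q).length = q := by simp [units]

theorem head?_units_eq_none {q : ℕ} (h : (units q).head? = none) : q = 0 := by
  cases q with
  | zero => rfl
  | succ q => simp [units, List.replicate_succ] at h

theorem exists_of_head?_units {q : ℕ} {a : GoalSymbol} (h : (units q).head? = some a) :
    ∃ r, q = r + 1 := by
  cases q with
  | zero => simp [units] at h
  | succ q => exact ⟨q, rfl⟩

/-- A block of `up` markers. -/
def ups (j : ℕ) : List GoalSymbol := List.replicate j .up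

@[simp] theorem length_ups (q : ℕ) : (ups q).length = q := by simp [ups]

/-! #### The level -/

theorem goalLeads_twice (b : Bool) (hp : p ≤ x.length + 1) (v j : ℕ) (hv : v ≤ H) :
    GoalLeads x H (goalCfg (.twice b) p (units j) (units v))
      (goalCfg (.refill b) p (units (j + 2 * v)) []) := by
  induction v generalizing j with
  | zero =>
    refine goalLeads_keep (fun o => ?_) (by simp) (min_moveHead_stay hp)
    exact ⟨fun h => by cases h; rfl, fun h => h ▸ .twice_end ..⟩
  | succ v ih =>
    have h₁ : GoalLeads x H (goalCfg (.twice b) p (units j) (units (v + 1)))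
        (goalCfg (.twice' b) p (units (j + 1)) (units v)) := by
      refine goalLeads_of_tr (o₁ := some (some .unit)) (o₂ := some none) (fun o => ?_) (by simp)
        (min_moveHead_stay hp) rfl rfl ?_ (fun _ => by simpa using hv)
      · exact ⟨fun h => by cases h; rfl, fun h => h ▸ .twice_pop ..⟩
      · simp only [length_units]; omega
    have h₂ : GoalLeads x H (goalCfg (.twice' b) p (units (j + 1)) (units v))
        (goalCfg (.twice b) p (units (j + 1 + 1)) (units v)) := by
      refine goalLeads_of_tr (o₁ := some (some .unit)) (o₂ := none) (fun o => ?_) (by simp)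
        (min_moveHead_stay hp) rfl rfl ?_ id
      · exact ⟨fun h => by cases h; rfl, fun h => h ▸ .twice_push ..⟩
      · simp only [length_units]; omega
    have := ih (j + 1 + 1) (by omega)
    rw [show j + 1 + 1 + 2 * v = j + 2 * (v + 1) by omega] at this
    exact h₁.trans (h₂.trans this)

theorem goalLeads_refill (b : Bool) (hp : p ≤ x.length + 1) (j v : ℕ) (hj : v + j ≤ H) :
    GoalLeads x H (goalCfg (.refill b) p (units j) (units v))
      (goalCfg .level (p - 1) [] (units (v + j + b.toNat))) := by
  induction j generalizing v with
  | zero =>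
    refine goalLeads_of_tr (o₁ := none) (o₂ := if b then some (some .unit) else none) (fun o => ?_) (by simp)
      (min_moveHead_left hp) rfl (by cases b <;> rfl) (fun h => h) ?_
    · exact ⟨fun h => by cases h; rfl, fun h => h ▸ .refill_end ..⟩
    · simp only [length_units]; omega
  | succ j ih =>
    have := ih (v + 1) (by omega)
    rw [show v + 1 + j = v + (j + 1) by omega] at this
    refine .trans ?_ this
    refine goalLeads_of_tr (o₁ := some none) (o₂ := some (some .unit)) (fun o => ?_) (by simp)
      (min_moveHead_stay hp) rfl rfl (fun _ => by simp only [length_units]; omega)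
      (fun _ => by simp only [length_units]; omega)
    exact ⟨fun h => by cases h; rfl, fun h => h ▸ .refill_pop ..⟩

theorem div_two_pow_eq (k i : ℕ) :
    2 * (k / 2 ^ (i + 1)) + (k.testBit i).toNat = k / 2 ^ i := by
  rw [Nat.toNat_testBit, pow_succ, ← Nat.div_div_eq_div_mul]
  omega

/-- Bits are listed from the least significant one on, so a head moving left reads the leading bits
first; `k / 2 ^ i` is the number read so far. -/
theorem goalLeads_level {k : ℕ} (hk : k ≤ H) (i : ℕ)
    (hbit : ∀ j < i, inputCell x (j + 1) = .letter (.bit (k.testBit j))) :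
    GoalLeads x H (goalCfg .level i [] (units (k / 2 ^ i))) (goalCfg .header 1 [] (units k)) := by
  induction i with
  | zero =>
    rw [pow_zero, Nat.div_one]
    refine goalLeads_keep (d := .right) (fun o => ?_) (by simp) (by simp [moveHead])
    exact ⟨fun h => by cases h; rfl, fun h => h ▸ .level_end ..⟩
  | succ i ih =>
    refine .trans ?_ (ih fun j hj => hbit j (by omega))
    have hc := hbit i (by omega)
    have hp : i + 1 ≤ x.length + 1 := by
      have := inputCell_eq_letter_le hc
      omega
    have h₁ : GoalLeads x H (goalCfg .level (i + 1) [] (units (k / 2 ^ (i + 1))))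
        (goalCfg (.twice (k.testBit i)) (i + 1) (units 0) (units (k / 2 ^ (i + 1)))) := by
      refine goalLeads_keep (fun o => ?_) (by simp) (min_moveHead_stay hp)
      rw [hc]
      exact ⟨fun h => by cases h; rfl, fun h => h ▸ .level_bit ..⟩
    have hle : k / 2 ^ i ≤ k := Nat.div_le_self _ _
    have hdiv := div_two_pow_eq k i
    have h₂ := goalLeads_twice (H := H) (k.testBit i) hp (k / 2 ^ (i + 1)) 0 (by omega)
    have h₃ := goalLeads_refill (H := H) (k.testBit i) hp (0 + 2 * (k / 2 ^ (i + 1))) 0 (by omega)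
    rw [show 0 + (0 + 2 * (k / 2 ^ (i + 1))) + (k.testBit i).toNat = k / 2 ^ i by omega] at h₃
    exact h₁.trans (h₂.trans h₃)

/-! #### The start symbol -/

theorem goalLeads_header (i : ℕ)
    (hcell : ∀ j < i, inputCell x (t + j) = .letter .comma ∨
      ∃ b, inputCell x (t + j) = .letter (.bit b)) :
    GoalLeads x H (goalCfg .header t S V) (goalCfg .header (t + i) S V) := by
  induction i with
  | zero => exact .refl _
  | succ i ih =>
    refine (ih fun j hj => hcell j (by omega)).trans ?_
    rcases hcell i (by omega) with hc | ⟨b, hc⟩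
    · refine goalLeads_keep (fun o => ?_) (by simp) (min_moveHead_right hc)
      rw [hc]
      exact ⟨fun h => by cases h; rfl, fun h => h ▸ .header_comma ..⟩
    · refine goalLeads_keep (fun o => ?_) (by simp) (min_moveHead_right hc)
      rw [hc]
      exact ⟨fun h => by cases h; rfl, fun h => h ▸ .header_bit ..⟩

theorem goalLeads_start (h : FieldAt x t bs)
    (hend : inputCell x (t + bs.length + 1) = .letter .action ∨
      inputCell x (t + bs.length + 1) = .rightEnd) :
    GoalLeads x H (goalCfg .header (t + bs.length + 1) S V)
      (goalCfg .copyFst (t - 1) (goalBits bs ++ S) V) := by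
  have hle := inputCell_eq_letter_le h.comma
  have h₁ : GoalLeads x H (goalCfg .header (t + bs.length + 1) S V)
      (goalCfg .start (t + bs.length) S V) := by
    rcases hend with hc | hc
    · refine goalLeads_keep (fun o => ?_) (by simp) (min_moveHead_left (by omega))
      rw [hc]
      exact ⟨fun h => by cases h; rfl, fun h => h ▸ .header_action ..⟩
    · refine goalLeads_keep (fun o => ?_) (by simp) (min_moveHead_left (by omega))
      rw [hc]
      exact ⟨fun h => by cases h; rfl, fun h => h ▸ .header_end ..⟩
  refine h₁.trans (.trans ?_ (isCopy_copyFst.leads h))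
  refine goalLeads_keep (fun o => ?_) (by simp) (min_moveHead_left (by omega))
  rw [h.comma]
  exact ⟨fun h => by cases h; rfl, fun h => h ▸ .start ..⟩

/-! #### Search for an action -/

theorem GoalAccIn.exists_source {s : Shape} {n : ℕ} (h : GoalAccIn x H n (.seek s) p S V) :
    ∃ p', inputCell x p' = .letter .action ∧ GoalAccIn x H n (.source s) (p' + 1) S V := by
  induction n using Nat.strong_induction_on generalizing p with
  | _ n ih =>
    obtain ⟨m, hm, q', d, o₁, o₂, htr, hacc⟩ := GoalAccIn.exists_step h (by simp)
    generalize hc : inputCell x p = c at htr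
    cases htr with
    | seek_left =>
      obtain ⟨p', h₁, h₂⟩ := ih m hm hacc
      exact ⟨p', h₁, StackMachine.AccIn.mono hm.le h₂⟩
    | seek_right =>
      obtain ⟨p', h₁, h₂⟩ := ih m hm hacc
      exact ⟨p', h₁, StackMachine.AccIn.mono hm.le h₂⟩
    | seek_action =>
      rw [min_moveHead_right hc] at hacc
      exact ⟨p, hc, StackMachine.AccIn.mono hm.le hacc⟩

theorem GoalAcc.seek_of_le {s : Shape} {i : ℕ} (hi : p + i ≤ x.length + 1) :
    (GoalAcc x H (.seek s) (p + i) S V → GoalAcc x H (.seek s) p S V) ∧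
      (GoalAcc x H (.seek s) p S V → GoalAcc x H (.seek s) (p + i) S V) := by
  induction i with
  | zero => exact ⟨id, id⟩
  | succ i ih =>
    obtain ⟨ih₁, ih₂⟩ := ih (by omega)
    constructor
    · intro h
      refine ih₁ (GoalAcc.of_tr (.seek_right ..) h ?_ rfl rfl h.fits.1 h.fits.2)
      simp only [moveHead]; omega
    · intro h
      refine GoalAcc.of_tr (.seek_left ..) (ih₂ h) ?_ rfl rfl h.fits.1 h.fits.2
      simp only [moveHead]; omega

theorem GoalAcc.seek_of_source {s : Shape} (hp : p ≤ x.length + 1)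
    (ht : inputCell x t = .letter .action) (h : GoalAcc x H (.source s) (t + 1) S V) :
    GoalAcc x H (.seek s) p S V := by
  have hle := inputCell_eq_letter_le ht
  have h₁ : GoalAcc x H (.seek s) t S V :=
    GoalAcc.of_tr (by rw [ht]; exact .seek_action ..) h (min_moveHead_right ht) rfl rfl
      h.fits.1 h.fits.2
  rcases le_total p t with hpt | hpt
  · obtain ⟨i, rfl⟩ := Nat.exists_eq_add_of_le hpt
    exact (GoalAcc.seek_of_le (by omega)).1 h₁
  · obtain ⟨i, rfl⟩ := Nat.exists_eq_add_of_le hpt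
    exact (GoalAcc.seek_of_le (by omega)).2 h₁

/-! #### Comparison of names -/

/-- Names have no end mark on the stack; what delimits them is that the symbol below is not a bit.
-/
theorem GoalAccIn.compare_eq {s : Shape} {n : ℕ} {cs : List Bool} (h : FieldAt x t bs)
    (hS : ∀ b, S.head? ≠ some (.bit b))
    (hacc : GoalAccIn x H n (.compare s) t (goalBits cs ++ S) V) :
    cs = bs ∧ GoalAccIn x H n (.target s) (t + bs.length + 1) S V := by
  induction bs generalizing t n cs with
  | nil =>
    obtain ⟨m, hm, q', d, o₁, o₂, htr, hacc⟩ := GoalAccIn.exists_step hacc (by simp)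
    have hc : inputCell x t = .letter .comma := h
    rw [hc] at htr
    cases cs with
    | nil =>
      cases htr
      rw [min_moveHead_right hc] at hacc
      exact ⟨rfl, StackMachine.AccIn.mono hm.le hacc⟩
    | cons c cs =>
      cases htr with
      | compare_comma _ _ _ hne => exact absurd rfl (hne c)
  | cons b bs ih =>
    obtain ⟨m, hm, q', d, o₁, o₂, htr, hacc⟩ := GoalAccIn.exists_step hacc (by simp)
    rw [h.1] at htr
    cases cs with
    | nil =>
      simp only [goalBits, List.map_nil, List.nil_append] at htr
      generalize hh : S.head? = a at htr
      cases htr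
      exact absurd hh (hS b)
    | cons c cs =>
      simp only [goalBits, List.map_cons, List.cons_append, List.head?_cons] at htr
      cases htr
      rw [min_moveHead_right h.1] at hacc
      obtain ⟨rfl, h'⟩ := ih h.2 hacc
      refine ⟨rfl, ?_⟩
      rw [List.length_cons, show t + (cs.length + 1) + 1 = t + 1 + cs.length + 1 by omega]
      exact StackMachine.AccIn.mono hm.le h'

theorem GoalAcc.compare {s : Shape} (h : FieldAt x t bs)
    (hS : ∀ b, S.head? ≠ some (.bit b)) (hH : (goalBits bs ++ S).length ≤ H)
    (hacc : GoalAcc x H (.target s) (t + bs.length + 1) S V) :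
    GoalAcc x H (.compare s) t (goalBits bs ++ S) V := by
  induction bs generalizing t with
  | nil =>
    have hc : inputCell x t = .letter .comma := h
    refine GoalAcc.of_tr (o₁ := none) (o₂ := none) ?_ hacc (min_moveHead_right hc) rfl rfl hH
      hacc.fits.2
    rw [hc]
    exact .compare_comma _ _ _ hS
  | cons b bs ih =>
    rw [List.length_cons, show t + (bs.length + 1) + 1 = t + 1 + bs.length + 1 by omega] at hacc
    refine GoalAcc.of_tr ?_ (ih h.2 (by simp at hH ⊢; omega) hacc) (min_moveHead_right h.1)
      (o₁ := some none) (o₂ := none) rfl rfl hH hacc.fits.2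
    rw [h.1]
    exact .compare_bit ..

/-! #### Changes of level -/

/-- The separate state `descend'` enforces at least one step down, since the left child must have
strictly lower rank here. Level plus markers stays constant. -/
theorem GoalAccIn.descend {n r : ℕ} (hp : p ≤ x.length + 1)
    (h : GoalAccIn x H n .descend p S (units r)) :
    ∃ j i, r = i + (j + 1) ∧ GoalAccIn x H n .copyFst p (ups (j + 1) ++ S) (units i) := by
  have more : ∀ n j i, GoalAccIn x H n .descend' p (ups (j + 1) ++ S) (units i) →
      ∃ j' i', i + (j + 1) = i' + (j' + 1) ∧
        GoalAccIn x H n .copyFst p (ups (j' + 1) ++ S) (units i') := by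
    intro n
    induction n using Nat.strong_induction_on with
    | _ n ih =>
      intro j i h
      obtain ⟨m, hm, q', d, o₁, o₂, htr, hacc⟩ := GoalAccIn.exists_step h (by simp)
      generalize hu : (units i).head? = u at htr
      cases htr with
      | descend_more =>
        obtain ⟨i, rfl⟩ := exists_of_head?_units hu
        rw [min_moveHead_stay hp] at hacc
        obtain ⟨j', i', hi', h'⟩ := ih m hm (j + 1) i hacc
        exact ⟨j', i', by omega, StackMachine.AccIn.mono hm.le h'⟩
      | descend_end =>
        rw [min_moveHead_stay hp] at hacc
        exact ⟨j, i, rfl, StackMachine.AccIn.mono hm.le hacc⟩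
  obtain ⟨m, hm, q', d, o₁, o₂, htr, hacc⟩ := GoalAccIn.exists_step h (by simp)
  generalize hu : (units r).head? = u at htr
  cases htr
  obtain ⟨r, rfl⟩ := exists_of_head?_units hu
  rw [min_moveHead_stay hp] at hacc
  obtain ⟨j', i', hi', h'⟩ := more m 0 r hacc
  exact ⟨j', i', by omega, StackMachine.AccIn.mono hm.le h'⟩

/-- Here the level may stay the same, but then shape `single` is excluded, as the rank of the node
would exceed that of the left child. -/
theorem GoalAccIn.lower {n r : ℕ} (hp : p ≤ x.length + 1)
    (h : GoalAccIn x H n .lower p S (units r)) :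
    ∃ j i s, r = i + j ∧ (s = Shape.single → 1 ≤ j) ∧
      GoalAccIn x H n (.skipFst s .run) p (ups j ++ S) (units i) := by
  have more : ∀ n j i, GoalAccIn x H n .lower' p (ups (j + 1) ++ S) (units i) →
      ∃ j' i' s, i + (j + 1) = i' + (j' + 1) ∧
        GoalAccIn x H n (.skipFst s .run) p (ups (j' + 1) ++ S) (units i') := by
    intro n
    induction n using Nat.strong_induction_on with
    | _ n ih =>
      intro j i h
      obtain ⟨m, hm, q', d, o₁, o₂, htr, hacc⟩ := GoalAccIn.exists_step h (by simp)
      generalize hu : (units i).head? = u at htr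
      cases htr with
      | lower_more =>
        obtain ⟨i, rfl⟩ := exists_of_head?_units hu
        rw [min_moveHead_stay hp] at hacc
        obtain ⟨j', i', s, hi', h'⟩ := ih m hm (j + 1) i hacc
        exact ⟨j', i', s, by omega, StackMachine.AccIn.mono hm.le h'⟩
      | lower_more_end s =>
        rw [min_moveHead_stay hp] at hacc
        exact ⟨j, i, s, rfl, StackMachine.AccIn.mono hm.le hacc⟩
  obtain ⟨m, hm, q', d, o₁, o₂, htr, hacc⟩ := GoalAccIn.exists_step h (by simp)
  generalize hu : (units r).head? = u at htr
  cases htr with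
  | lower =>
    obtain ⟨r, rfl⟩ := exists_of_head?_units hu
    rw [min_moveHead_stay hp] at hacc
    obtain ⟨j', i', s, hi', h'⟩ := more m 0 r hacc
    exact ⟨j' + 1, i', s, by omega, fun _ => by omega, StackMachine.AccIn.mono hm.le h'⟩
  | lower_end =>
    rw [min_moveHead_stay hp] at hacc
    exact ⟨0, r, .double, rfl, by simp, StackMachine.AccIn.mono hm.le hacc⟩

theorem GoalAcc.descend {i j : ℕ} (hp : p ≤ x.length + 1) (hH : i + (j + 1) ≤ H)
    (h : GoalAcc x H .copyFst p (ups (j + 1) ++ S) (units i)) :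
    GoalAcc x H .descend p S (units (i + (j + 1))) := by
  have hS : (ups (j + 1) ++ S).length ≤ H := h.fits.1
  simp only [List.length_append, length_ups] at hS
  have more : ∀ l ≤ j, GoalAcc x H .descend' p (ups (j + 1 - l) ++ S) (units (i + l)) := by
    intro l hl
    induction l with
    | zero =>
      exact GoalAcc.of_tr (.descend_end ..) h (min_moveHead_stay hp) rfl rfl h.fits.1 h.fits.2
    | succ l ih =>
      refine GoalAcc.of_tr (.descend_more ..) (ih (by omega)) (min_moveHead_stay hp) ?_ rfl ?_ ?_
      · rw [show j + 1 - l = j + 1 - (l + 1) + 1 by omega]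
        rfl
      · simp only [List.length_append, length_ups]; omega
      · simp only [length_units]; omega
  have := more j le_rfl
  rw [show j + 1 - j = 0 + 1 by omega] at this
  exact GoalAcc.of_tr (.descend ..) this (min_moveHead_stay hp) rfl rfl (by omega)
    (by simpa using hH)

theorem GoalAcc.lower {i j : ℕ} {s : Shape} (hp : p ≤ x.length + 1) (hH : i + j ≤ H)
    (hs : s = Shape.single → 1 ≤ j)
    (h : GoalAcc x H (.skipFst s .run) p (ups j ++ S) (units i)) :
    GoalAcc x H .lower p S (units (i + j)) := by
  have hS : (ups j ++ S).length ≤ H := h.fits.1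
  simp only [List.length_append, length_ups] at hS
  cases j with
  | zero =>
    cases s with
    | single => exact absurd (hs rfl) (by omega)
    | double =>
      exact GoalAcc.of_tr (.lower_end ..) h (min_moveHead_stay hp) rfl rfl h.fits.1 h.fits.2
  | succ j =>
    have more : ∀ l ≤ j, GoalAcc x H .lower' p (ups (j + 1 - l) ++ S) (units (i + l)) := by
      intro l hl
      induction l with
      | zero =>
        exact GoalAcc.of_tr (.lower_more_end ..) h (min_moveHead_stay hp) rfl rfl h.fits.1 h.fits.2
      | succ l ih =>
        refine GoalAcc.of_tr (.lower_more ..) (ih (by omega)) (min_moveHead_stay hp) ?_ rfl ?_ ?_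
        · rw [show j + 1 - l = j + 1 - (l + 1) + 1 by omega]
          rfl
        · simp only [List.length_append, length_ups]; omega
        · simp only [length_units]; omega
    have := more j le_rfl
    rw [show j + 1 - j = 0 + 1 by omega] at this
    exact GoalAcc.of_tr (.lower ..) this (min_moveHead_stay hp) rfl rfl (by omega)
      (by simpa using hH)

end

end Oscillation

-- Rules listed on the input, and lists of goals

namespace Oscillation

open NTM (inputCell moveHead)

variable {Q S Γ : Type}

/-- From cell `t` on, the input reads the right hand side `ξ` of a rule. -/
def TargetAt (x : List Letter) (name : Γ → List Bool) (t : ℕ) : List Γ → Prop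
  | [] => inputCell x t = .letter .action ∨ inputCell x t = .rightEnd
  | [l, r] => FieldAt x t (name l) ∧ FieldAt x (t + (name l).length + 1) (name r)
  | _ => False

/-- The input has an action for the rule `γ → ξ` at cell `p`, with a label of length `m`. -/
structure ActionAt (x : List Letter) (name : Γ → List Bool) (p m : ℕ) (γ : Γ) (ξ : List Γ) :
    Prop where
  action : inputCell x p = .letter .action
  source : inputCell x (p + 1) = .letter .comma
  label : ∀ i < m, inputCell x (p + 2 + i) = .letter .eps ∨
    ∃ b, inputCell x (p + 2 + i) = .letter (.bit b)
  comma : inputCell x (p + 2 + m) = .letter .comma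
  symbol : FieldAt x (p + 2 + m + 1) (name γ)
  state : inputCell x (p + 2 + m + 1 + (name γ).length + 1) = .letter .comma
  target : TargetAt x name (p + 2 + m + 1 + (name γ).length + 1 + 1) ξ

/-- The actions on the input are those of `P`, for the given names of stack symbols. -/
structure ListsActions (x : List Letter) (P : PDA Q S Γ) (name : Γ → List Bool) : Prop where
  name_injective : Function.Injective name
  exists_rule : ∀ p, inputCell x p = .letter .action →
    ∃ m γ ξ, P.Rule γ ξ ∧ ActionAt x name p m γ ξ
  exists_action : ∀ γ ξ, P.Rule γ ξ → ∃ p m, ActionAt x name p m γ ξ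

/-- Entries of the first stack. -/
inductive Goal (Γ : Type)
  | up
  | goal (s : Shape) (γ : Γ)

/-- The first stack for a list of goals. -/
def goalStack (name : Γ → List Bool) : List (Goal Γ) → List GoalSymbol
  | [] => []
  | .up :: l => .up :: goalStack name l
  | .goal s γ :: l => .goal s :: goalBits (name γ) ++ goalStack name l

/-- All goals can be met, starting at level `q`. -/
def Met (P : PDA Q S Γ) : List (Goal Γ) → ℕ → Prop
  | [], _ => True
  | .up :: l, q => Met P l (q + 1)
  | .goal s γ :: l, q => P.HasVal γ (s.val q) ∧ Met P l q

theorem head?_goalStack_ne_bit (name : Γ → List Bool) (l : List (Goal Γ)) (b : Bool) :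
    (goalStack name l).head? ≠ some (.bit b) := by
  match l with
  | [] => simp [goalStack]
  | .up :: l => simp [goalStack]
  | .goal s γ :: l => simp [goalStack]

theorem goalStack_replicate_up (name : Γ → List Bool) (j : ℕ) (l : List (Goal Γ)) :
    goalStack name (List.replicate j .up ++ l) = ups j ++ goalStack name l := by
  induction j with
  | zero => rfl
  | succ j ih =>
    rw [List.replicate_succ, List.cons_append, goalStack, ih]
    rfl

theorem met_replicate_up (P : PDA Q S Γ) (j : ℕ) (l : List (Goal Γ)) (q : ℕ) :
    Met P (List.replicate j .up ++ l) q ↔ Met P l (q + j) := by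
  induction j generalizing q with
  | zero => rfl
  | succ j ih =>
    rw [List.replicate_succ, List.cons_append, Met, ih, show q + 1 + j = q + (j + 1) by omega]

section

variable {x : List Letter} {H : ℕ} {name : Γ → List Bool} {P : PDA Q S Γ}

theorem ActionAt.leads_compare {p m : ℕ} {γ : Γ} {ξ : List Γ} (h : ActionAt x name p m γ ξ)
    (s : Shape) (T V : List GoalSymbol) :
    GoalLeads x H (goalCfg (.source s) (p + 1) T V)
      (goalCfg (.compare s) (p + 2 + m + 1) T V) := by
  have h₁ : GoalLeads x H (goalCfg (.source s) (p + 1) T V) (goalCfg (.label s) (p + 2) T V) := by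
    refine goalLeads_keep (fun o => ?_) (by simp) (min_moveHead_right h.source)
    rw [h.source]
    exact ⟨fun h => by cases h; rfl, fun h => h ▸ .source ..⟩
  have h₂ : ∀ i ≤ m, GoalLeads x H (goalCfg (.label s) (p + 2) T V)
      (goalCfg (.label s) (p + 2 + i) T V) := by
    intro i hi
    induction i with
    | zero => exact .refl _
    | succ i ih =>
      refine (ih (by omega)).trans ?_
      rcases h.label i (by omega) with hc | ⟨b, hc⟩
      · refine goalLeads_keep (fun o => ?_) (by simp) (min_moveHead_right hc)
        rw [hc]
        exact ⟨fun h => by cases h; rfl, fun h => h ▸ .label_eps ..⟩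
      · refine goalLeads_keep (fun o => ?_) (by simp) (min_moveHead_right hc)
        rw [hc]
        exact ⟨fun h => by cases h; rfl, fun h => h ▸ .label_bit ..⟩
  refine h₁.trans ((h₂ m le_rfl).trans ?_)
  refine goalLeads_keep (fun o => ?_) (by simp) (min_moveHead_right h.comma)
  rw [h.comma]
  exact ⟨fun h => by cases h; rfl, fun h => h ▸ .label_comma ..⟩

/-- After an empty right hand side the head sees `action` or the end marker, where the skipping
states are stuck. -/
theorem GoalAccIn.exists_pair {q : GoalState} (hq : q = .skipTail ∨ ∃ s a, q = .skipFst s a)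
    {n t : ℕ} {ξ : List Γ} (ht : TargetAt x name t ξ) {T V : List GoalSymbol}
    (h : GoalAccIn x H n q t T V) :
    ∃ l r, ξ = [l, r] ∧ FieldAt x t (name l) ∧
      FieldAt x (t + (name l).length + 1) (name r) := by
  match ξ, ht with
  | [], ht =>
    exfalso
    obtain ⟨m, hm, q', d, o₁, o₂, htr, -⟩ :=
      GoalAccIn.exists_step h (by rcases hq with rfl | ⟨s, a, rfl⟩ <;> simp)
    rcases hq with rfl | ⟨s, a, rfl⟩ <;> rcases ht with hc | hc <;> rw [hc] at htr <;> cases htr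
  | [l, r], ht => exact ⟨l, r, rfl, ht.1, ht.2⟩

theorem GoalAccIn.run_of_copyFst {n t : ℕ} {bs : List Bool} (h : FieldAt x t bs)
    (ht : inputCell x (t - 1) = .letter .comma) {T V : List GoalSymbol}
    (hacc : GoalAccIn x H n .copyFst (t + bs.length - 1) T V) :
    ∃ s m, m < n ∧ GoalAccIn x H m .run (t - 1) (.goal s :: goalBits bs ++ T) V := by
  obtain ⟨m, hm, q', d, o₁, o₂, htr, hacc⟩ :=
    GoalAccIn.exists_step ((isCopy_copyFst.leads h).1 n hacc) (by simp)
  rw [ht] at htr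
  cases htr with
  | copyFst_comma s =>
    rw [min_moveHead_stay (by have := inputCell_eq_letter_le ht; omega)] at hacc
    exact ⟨s, m, hm, hacc⟩

theorem GoalAcc.copyFst_of_run {t : ℕ} {bs : List Bool} (h : FieldAt x t bs)
    (ht : inputCell x (t - 1) = .letter .comma) {s : Shape} {T V : List GoalSymbol}
    (hacc : GoalAcc x H .run (t - 1) (.goal s :: goalBits bs ++ T) V) :
    GoalAcc x H .copyFst (t + bs.length - 1) T V := by
  have hf : (GoalSymbol.goal s :: goalBits bs ++ T).length ≤ H := hacc.fits.1
  simp only [List.cons_append, List.length_cons] at hf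
  refine (isCopy_copyFst.leads h).2 ?_
  refine GoalAcc.of_tr (o₁ := some (some (.goal s))) (o₂ := none) (d := .stay) ?_ hacc
    (min_moveHead_stay (by have := inputCell_eq_letter_le ht; omega)) rfl rfl (by omega)
    hacc.fits.2
  rw [ht]
  exact .copyFst_comma ..

/-! #### Soundness -/

/-- Strong induction on the number of steps, from one visit of state `run` to the next. The names
found on the input determine the rule, and each way of treating it turns values of the children into
the value claimed for the goal. -/
theorem met_of_accIn (hx : ListsActions x P name) {n p : ℕ} {l : List (Goal Γ)} {q : ℕ}
    (hp : p ≤ x.length + 1) (h : GoalAccIn x H n .run p (goalStack name l) (units q)) :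
    Met P l q := by
  induction n using Nat.strong_induction_on generalizing p l q with
  | _ n ih =>
  match l with
  | [] => trivial
  | .up :: l =>
    obtain ⟨m, hm, q', d, o₁, o₂, htr, hacc⟩ := GoalAccIn.exists_step h (by simp)
    simp only [goalStack, List.head?_cons] at htr
    cases htr
    exact ih m hm (min_le_right _ _) (q := q + 1) hacc
  | .goal s γ :: l =>
    obtain ⟨m₀, hm₀, q', d, o₁, o₂, htr, hacc⟩ := GoalAccIn.exists_step h (by simp)
    simp only [goalStack, List.cons_append, List.head?_cons] at htr
    cases htr
    obtain ⟨p, hp, hacc⟩ := GoalAccIn.exists_source hacc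
    obtain ⟨m, γ', ξ, hrule, hat⟩ := hx.exists_rule p hp
    obtain ⟨hγ, hacc⟩ := GoalAccIn.compare_eq hat.symbol (head?_goalStack_ne_bit name l)
      ((hat.leads_compare s _ _).1 _ hacc)
    obtain rfl := hx.name_injective hγ
    have hstate := hat.state
    have htarget := hat.target
    set t := p + 2 + m + 1 + (name γ).length + 1 with ht
    have hle := inputCell_eq_letter_le hstate
    obtain ⟨m₁, hm₁, q', d, o₁, o₂, htr, hacc⟩ := GoalAccIn.exists_step hacc (by simp)
    rw [hstate] at htr
    simp only [StackOp.apply] at htr hacc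
    generalize hu : (units q).head? = u at htr
    have hpred : inputCell x (t + 1 - 1) = .letter .comma := hstate
    have hmove : min (moveHead .right t) (x.length + 1) = t + 1 := min_moveHead_right hstate
    cases htr with
    | target_pop =>
      rw [hmove] at hacc
      obtain ⟨m₂, hm₂, q', d, o₁, o₂, htr, hacc⟩ := GoalAccIn.exists_step hacc (by simp)
      have hξ : ξ = [] := by
        match ξ, htarget with
        | [], _ => rfl
        | [l', r], h =>
          exfalso
          rcases h.1.cell with hc | ⟨b, hc⟩ <;> rw [hc] at htr <;> cases htr
      subst hξ
      have hq : q = 0 := by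
        apply head?_units_eq_none
        rcases htarget with hc | hc <;> rw [hc] at htr <;>
          · generalize (units q).head? = u at htr
            cases htr
            rfl
      have hrun : ∃ p', p' ≤ x.length + 1 ∧
          GoalAccIn x H m₂ .run p' (goalStack name l) (units q) := by
        rcases htarget with hc | hc <;> rw [hc] at htr <;>
          · generalize (units q).head? = u at htr
            cases htr
            exact ⟨_, min_le_right _ _, hacc⟩
      obtain ⟨p', hp', hrun⟩ := hrun
      refine ⟨?_, ih m₂ (by omega) hp' hrun⟩
      rw [hq]
      exact .leaf hrule
    | target_keep =>
      rw [hmove] at hacc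
      obtain ⟨l', r, rfl, hl, hr⟩ := GoalAccIn.exists_pair (.inr ⟨_, _, rfl⟩) htarget hacc
      have hle' := inputCell_eq_letter_le hl.comma
      obtain ⟨j, i, rfl, hdesc⟩ := GoalAccIn.descend (by omega)
        ((goalLeads_skipFst_copySnd s .descend hl hr).1 _ hacc)
      obtain ⟨s', m₂, hm₂, hrun⟩ := GoalAccIn.run_of_copyFst hl hpred hdesc
      have hmet := ih m₂ (by omega) (p := t + 1 - 1) (by omega) (q := i)
        (l := .goal s' l' :: (List.replicate (j + 1) .up ++ .goal s r :: l)) (by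
          rw [goalStack, goalStack_replicate_up]
          exact hrun)
      rw [Met, met_replicate_up] at hmet
      obtain ⟨h₁, h₂, h₃⟩ := hmet
      refine ⟨?_, h₃⟩
      convert PDA.HasVal.node hrule h₁ h₂ using 1
      -- The guessed shape `s'` is immaterial, because `nestVal` uses only the rank of the left
      -- child.
      cases s <;> cases s' <;> simp only [Shape.val, joinVal, nestVal, Prod.mk.injEq] <;> omega
    | target_split =>
      rw [hmove] at hacc
      obtain ⟨q, rfl⟩ := exists_of_head?_units hu
      obtain ⟨l', r, rfl, hl, hr⟩ := GoalAccIn.exists_pair (.inr ⟨_, _, rfl⟩) htarget hacc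
      have hle' := inputCell_eq_letter_le hl.comma
      obtain ⟨s', m₂, hm₂, hacc⟩ := GoalAccIn.run_of_copyFst hl hpred
        ((goalLeads_skipFst_copySnd .single .copy hl hr).1 _ hacc)
      have hmet := ih m₂ (by omega) (p := t + 1 - 1) (by omega) (q := q)
        (l := .goal s' l' :: .goal .single r :: .up :: l) hacc
      obtain ⟨h₁, h₂, h₃⟩ := hmet
      refine ⟨?_, h₃⟩
      convert PDA.HasVal.node hrule h₁ h₂ using 1
      cases s' <;> simp only [Shape.val, joinVal, nestVal, Prod.mk.injEq] <;> omega
    | target_tail =>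
      rw [hmove] at hacc
      obtain ⟨l', r, rfl, hl, hr⟩ := GoalAccIn.exists_pair (.inl rfl) htarget hacc
      have hle' := inputCell_eq_letter_le hl.comma
      obtain ⟨m₂, hm₂, q', d, o₁, o₂, htr, hacc⟩ :=
        GoalAccIn.exists_step ((goalLeads_skipTail hl).1 _ hacc) (by simp)
      rw [hpred] at htr
      cases htr with
      | copyTail_comma s' =>
      rw [show t + 1 - 1 = t from rfl, hmove] at hacc
      obtain ⟨j, i, s'', rfl, hs'', hlow⟩ := GoalAccIn.lower (by omega) hacc
      have hmet := ih m₂ (by omega) (p := t + 1 + (name l').length - 1) (by omega) (q := i)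
        (l := .goal s'' r :: (List.replicate j .up ++ .goal s' l' :: l)) (by
          rw [goalStack, goalStack_replicate_up]
          exact (goalLeads_skipFst_copySnd s'' .run hl hr).1 _ hlow)
      rw [Met, met_replicate_up] at hmet
      obtain ⟨h₁, h₂, h₃⟩ := hmet
      refine ⟨?_, h₃⟩
      convert PDA.HasVal.node hrule h₂ h₁ using 1
      cases s'' with
      | single =>
        have := hs'' rfl
        cases s' <;> simp only [Shape.val, joinVal, nestVal, Prod.mk.injEq] <;> omega
      | double =>
        cases s' <;> simp only [Shape.val, joinVal, nestVal, Prod.mk.injEq] <;> omega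

end

end Oscillation

namespace Oscillation

open NTM (inputCell moveHead)

variable {Q S Γ : Type}

/-! #### Completeness -/

/-- A bound for the number of goals that are on the stack at the same time while a goal of shape
`s` at level `q` is being met. -/
def Shape.cost : Shape → ℕ → ℕ
  | .single, q => 2 * q + 1
  | .double, q => 2 * q

theorem Shape.cost_le (s : Shape) (q : ℕ) : s.cost q ≤ 2 * q + 1 := by
  cases s <;> simp [Shape.cost]

section

variable {x : List Letter} {H : ℕ} {name : Γ → List Bool} {P : PDA Q S Γ}

theorem length_goalStack_goal (s : Shape) (γ : Γ) (l : List (Goal Γ)) :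
    (goalStack name (.goal s γ :: l)).length =
      (name γ).length + 1 + (goalStack name l).length := by
  simp only [goalStack, List.cons_append, List.length_cons, List.length_append, length_goalBits]
  omega

theorem ActionAt.acc_run {p m : ℕ} {γ : Γ} {ξ : List Γ} (hat : ActionAt x name p m γ ξ)
    {s : Shape} {p' : ℕ} (hp' : p' ≤ x.length + 1) {l : List (Goal Γ)} {V : List GoalSymbol}
    (hH : (goalStack name (.goal s γ :: l)).length ≤ H)
    (hacc : GoalAcc x H (.target s) (p + 2 + m + 1 + (name γ).length + 1) (goalStack name l) V) :
    GoalAcc x H .run p' (goalStack name (.goal s γ :: l)) V := by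
  have hH' := hH
  rw [length_goalStack_goal] at hH'
  refine GoalAcc.of_tr (o₁ := some none) (o₂ := none) (.run_goal ..) ?_ (min_moveHead_stay hp') rfl
    rfl hH hacc.fits.2
  refine GoalAcc.seek_of_source hp' hat.action ((hat.leads_compare s _ _).2 ?_)
  refine GoalAcc.compare hat.symbol (head?_goalStack_ne_bit name l) ?_ hacc
  simp only [List.length_append, length_goalBits]
  omega

theorem PDA.HasVal.exists_shape {γ : Γ} {a : ℕ × ℕ} (h : P.HasVal γ a) :
    ∃ s : Shape, a = s.val a.1 := by
  obtain ⟨a₁, a₂⟩ := a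
  have := h.snd
  simp only at this
  rcases Nat.lt_or_ge a₁ a₂ with hlt | hge
  · exact ⟨.single, Prod.ext rfl (by simp only [Shape.val]; omega)⟩
  · exact ⟨.double, Prod.ext rfl (by simp only [Shape.val]; omega)⟩

theorem GoalAcc.run_ups {T : List GoalSymbol} {j q p : ℕ} (hp : p ≤ x.length + 1)
    (hT : j + T.length ≤ H) (h : GoalAcc x H .run p T (units (q + j))) :
    GoalAcc x H .run p (ups j ++ T) (units q) := by
  induction j generalizing q with
  | zero => exact h
  | succ j ih =>
    have hV : (units (q + (j + 1))).length ≤ H := h.fits.2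
    simp only [length_units] at hV
    rw [show q + (j + 1) = q + 1 + j by omega] at h
    refine GoalAcc.of_tr (q' := .run) (d := .stay) (o₁ := some none) (o₂ := some (some .unit))
      (.run_up ..) (ih (by omega) h) (min_moveHead_stay hp) rfl rfl ?_ ?_
    · rw [List.length_append, length_ups]
      omega
    · simp only [length_units]; omega

/-- The hypothesis `hl` is a continuation: the goals below are met from any head position once the
top goal is gone. The height hypothesis pays `w + 1` cells for each unit of cost and `q` further
cells for the markers and the level. Passing to a child met first frees at least one unit of cost,
which pays for the postponed sibling. -/
theorem acc_of_hasVal (hx : ListsActions x P name) {w : ℕ} (hw : ∀ γ, (name γ).length ≤ w)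
    {γ : Γ} {a : ℕ × ℕ} (h : P.HasVal γ a) {s : Shape} {q : ℕ} (ha : a = s.val q)
    {l : List (Goal Γ)} (hH : (goalStack name l).length + s.cost q * (w + 1) + q ≤ H)
    (hl : ∀ p ≤ x.length + 1, GoalAcc x H .run p (goalStack name l) (units q))
    {p : ℕ} (hp : p ≤ x.length + 1) :
    GoalAcc x H .run p (goalStack name (.goal s γ :: l)) (units q) := by
  induction h generalizing s q l p with
  | @leaf γ hrule =>
    obtain ⟨rfl, rfl⟩ : s = .single ∧ q = 0 := by
      cases s <;> simp only [Shape.val, Prod.mk.injEq] at ha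
      · exact ⟨rfl, by omega⟩
      · omega
    obtain ⟨p₀, m, hat⟩ := hx.exists_action γ [] hrule
    have hwγ := hw γ
    refine hat.acc_run hp ?_ ?_
    · rw [length_goalStack_goal]
      simp only [Shape.cost] at hH
      omega
    have hT : (goalStack name l).length ≤ H := by omega
    have hV : (units 0).length ≤ H := by simp
    refine GoalAcc.of_tr (o₁ := none) (o₂ := none) (by rw [hat.state]; exact .target_pop ..) ?_
      (min_moveHead_right hat.state) rfl rfl hT hV
    have hle := inputCell_eq_letter_le hat.state
    refine GoalAcc.of_tr (q' := .run) (d := .stay) (o₁ := none) (o₂ := none) ?_ (hl _ ?_)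
      (min_moveHead_stay ?_) rfl rfl hT hV
    · rcases hat.target with hc | hc
      · rw [hc]; exact .pop_action ..
      · rw [hc]; exact .pop_end ..
    · omega
    · omega
  | @node γ γ₁ γ₂ a₁ a₂ hrule h₁ h₂ ih₁ ih₂ =>
    obtain ⟨s₁, hs₁⟩ := h₁.exists_shape
    obtain ⟨s₂, hs₂⟩ := h₂.exists_shape
    obtain ⟨q₁, t₁⟩ := a₁
    obtain ⟨q₂, t₂⟩ := a₂
    simp only at hs₁ hs₂
    have hb₁ := h₁.snd
    have hb₂ := h₂.snd
    obtain ⟨p₀, m, hat⟩ := hx.exists_action γ _ hrule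
    have hstate := hat.state
    obtain ⟨hf₁, hf₂⟩ := hat.target
    have hwγ := hw γ
    have hw₁ := hw γ₁
    have hw₂ := hw γ₂
    have hcost : 1 ≤ s.cost q := by
      cases s <;> simp only [Shape.cost, Shape.val, joinVal, nestVal, Prod.mk.injEq] at ha ⊢ <;>
        omega
    have hmul : w + 1 ≤ s.cost q * (w + 1) := Nat.le_mul_of_pos_left _ hcost
    refine hat.acc_run hp (by rw [length_goalStack_goal]; omega) ?_
    set t := p₀ + 2 + m + 1 + (name γ).length + 1 with ht
    have hle := inputCell_eq_letter_le hstate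
    have hle₁ := inputCell_eq_letter_le hf₁.comma
    have hpred : inputCell x (t + 1 - 1) = .letter .comma := hstate
    have hT : (goalStack name l).length ≤ H := by omega
    have hV : (units q).length ≤ H := by simp only [length_units]; omega
    have hmove : min (moveHead .right t) (x.length + 1) = t + 1 := min_moveHead_right hstate
    simp only at hb₁ hb₂
    -- If the left rank is below `q` and the right child already has the wanted value, the goal is
    -- passed on to the right child at no extra cost.
    by_cases hkeep : q₁ < q ∧ (q₂, t₂) = s.val q
    · obtain ⟨hlt, hval⟩ := hkeep
      obtain ⟨j, rfl⟩ : ∃ j, q = q₁ + (j + 1) := ⟨q - q₁ - 1, by omega⟩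
      have hc₁ := Shape.cost_le s₁ q₁
      -- The left child costs at most `2 * q₁ + 1` and the postponed right goal takes one more unit;
      -- since `q₁ < q`, even shape `double` at level `q` can afford both.
      have hc : 2 * q₁ + 2 ≤ s.cost (q₁ + (j + 1)) := by
        cases s <;> simp only [Shape.cost] <;> omega
      have hm₁ : s₁.cost q₁ * (w + 1) + (w + 1) ≤ s.cost (q₁ + (j + 1)) * (w + 1) := by
        rw [← Nat.succ_mul]
        exact Nat.mul_le_mul_right _ (by omega)
      refine GoalAcc.of_tr (o₁ := none) (o₂ := none) (by rw [hstate]; exact .target_keep ..) ?_ hmove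
        rfl rfl hT hV
      refine (goalLeads_skipFst_copySnd s .descend hf₁ hf₂).2
        (GoalAcc.descend (by omega) (by omega) ?_)
      refine GoalAcc.copyFst_of_run (s := s₁) hf₁ hpred ?_
      have := ih₁ (s := s₁) (q := q₁) (l := List.replicate (j + 1) .up ++ .goal s γ₂ :: l)
        (p := t + 1 - 1) hs₁ ?_ ?_ (by omega)
      · rw [goalStack, goalStack_replicate_up] at this
        exact this
      · rw [goalStack_replicate_up, List.length_append, length_ups, length_goalStack_goal]
        omega
      · intro p' hp'
        rw [goalStack_replicate_up]
        refine GoalAcc.run_ups hp' ?_ (ih₂ hval hH hl hp')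
        rw [length_goalStack_goal]
        omega
    cases s with
    | single =>
      -- Since `hkeep` fails, the second component `q + 1` of a `single` value can only come from
      -- the left child.
      have hq : q₁ = q ∧ t₂ ≤ q := by
        simp only [Shape.val, joinVal, nestVal, Prod.mk.injEq] at ha hkeep
        omega
      obtain ⟨rfl, ht₂⟩ := hq
      obtain ⟨j, rfl⟩ : ∃ j, q₁ = q₂ + j := ⟨q₁ - q₂, by omega⟩
      have hj : s₂ = Shape.single → 1 ≤ j := by
        rintro rfl
        simp only [Shape.val, Prod.mk.injEq] at hs₂
        omega
      have hc₂ : s₂.cost q₂ + 1 ≤ 2 * (q₂ + j) + 1 := by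
        cases s₂ with
        | single => have := hj rfl; simp only [Shape.cost]; omega
        | double => simp only [Shape.cost]; omega
      simp only [Shape.cost] at hH
      have hm₂ : s₂.cost q₂ * (w + 1) + (w + 1) ≤ (2 * (q₂ + j) + 1) * (w + 1) := by
        rw [← Nat.succ_mul]
        exact Nat.mul_le_mul_right _ hc₂
      have hm₁ : s₁.cost (q₂ + j) * (w + 1) ≤ (2 * (q₂ + j) + 1) * (w + 1) :=
        Nat.mul_le_mul_right _ (Shape.cost_le _ _)
      refine GoalAcc.of_tr (o₁ := none) (o₂ := none) (by rw [hstate]; exact .target_tail ..) ?_ hmove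
        rfl rfl hT hV
      refine (goalLeads_skipTail hf₁).2 ?_
      refine GoalAcc.of_tr (o₁ := some (some (.goal s₁))) (o₂ := none)
        (by rw [hpred]; exact .copyTail_comma ..) ?_ hmove rfl rfl ?_ hV
      · refine GoalAcc.lower (s := s₂) (by omega) (by omega) hj ?_
        refine (goalLeads_skipFst_copySnd s₂ .run hf₁ hf₂).2 ?_
        have := ih₂ (s := s₂) (q := q₂) (l := List.replicate j .up ++ .goal s₁ γ₁ :: l)
          (p := t + 1 + (name γ₁).length - 1) hs₂ ?_ ?_ (by omega)
        · rw [goalStack, goalStack_replicate_up] at this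
          exact this
        · rw [goalStack_replicate_up, List.length_append, length_ups, length_goalStack_goal]
          omega
        · intro p' hp'
          rw [goalStack_replicate_up]
          refine GoalAcc.run_ups hp' ?_ (ih₁ hs₁ (by omega) hl hp')
          rw [length_goalStack_goal]
          omega
      · simp only [StackOp.apply, List.length_append, length_goalBits]
        omega
    | double =>
      -- Since `hkeep` fails, rank `q` of a `double` value can only come from the minimum in
      -- `joinVal`, that is, from both children together.
      have hq : q = q₁ + 1 ∧ q₂ = q₁ ∧ t₂ = q₁ + 1 := by
        simp only [Shape.val, joinVal, nestVal, Prod.mk.injEq] at ha hkeep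
        omega
      obtain ⟨rfl, rfl, rfl⟩ := hq
      simp only [Shape.cost] at hH
      have hm₁ : s₁.cost q₂ * (w + 1) + (w + 1) ≤ 2 * (q₂ + 1) * (w + 1) := by
        rw [← Nat.succ_mul]
        have := Shape.cost_le s₁ q₂
        exact Nat.mul_le_mul_right _ (by omega)
      have hm₂ : Shape.single.cost q₂ * (w + 1) + (w + 1) ≤ 2 * (q₂ + 1) * (w + 1) := by
        rw [← Nat.succ_mul]
        exact Nat.mul_le_mul_right _ (by simp only [Shape.cost]; omega)
      refine GoalAcc.of_tr (o₁ := some (some .up)) (o₂ := some none)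
        (by rw [hstate]; exact .target_split ..) ?_ hmove rfl rfl hT hV
      refine (goalLeads_skipFst_copySnd .single .copy hf₁ hf₂).2 ?_
      refine GoalAcc.copyFst_of_run (s := s₁) hf₁ hpred ?_
      have hup : (goalStack name (.up :: l)).length = (goalStack name l).length + 1 := rfl
      refine ih₁ (s := s₁) (q := q₂) (l := .goal .single γ₂ :: .up :: l)
        (p := t + 1 - 1) hs₁ ?_ ?_ (by omega)
      · rw [length_goalStack_goal]
        omega
      · intro p' hp'
        refine ih₂ (s := .single) rfl (by omega) (fun p'' hp'' => ?_) hp'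
        exact GoalAcc.run_ups (j := 1) hp'' (by omega) (hl p'' hp'')

/-- Emptiness in terms of the stack machine. -/
theorem goalAcc_iff (hx : ListsActions x P name) {w k i t : ℕ} {γ : Γ}
    (hw : ∀ γ, (name γ).length ≤ w) (hH : (2 * k + 1) * (w + 1) + k ≤ H)
    (hbit : ∀ j < i, inputCell x (j + 1) = .letter (.bit (k.testBit j))) (hk : k < 2 ^ i)
    (hcell : ∀ j, 1 ≤ j → j ≤ t + (name γ).length → inputCell x j = .letter .comma ∨
      ∃ b, inputCell x j = .letter (.bit b))
    (hfield : FieldAt x t (name γ)) (ht : inputCell x (t - 1) = .letter .comma)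
    (hend : inputCell x (t + (name γ).length + 1) = .letter .action ∨
      inputCell x (t + (name γ).length + 1) = .rightEnd) :
    GoalAcc x H .level i [] [] ↔ ∃ u, P.HasVal γ (k, u) := by
  have h₁ := goalLeads_level (H := H) (by omega) i hbit
  rw [Nat.div_eq_of_lt hk] at h₁
  have h₂ := goalLeads_header (x := x) (H := H) (S := []) (V := units k) (t := 1)
    (t + (name γ).length) (fun j hj => hcell _ (by omega) (by omega))
  rw [add_comm 1] at h₂
  have hlead := h₁.trans (h₂.trans (goalLeads_start hfield hend))
  have hle := inputCell_eq_letter_le ht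
  have hmove : min (moveHead .stay (t - 1)) (x.length + 1) = t - 1 :=
    min_moveHead_stay (by omega)
  constructor
  · rintro ⟨n, h⟩
    obtain ⟨m, hm, q', d, o₁, o₂, htr, hacc⟩ := GoalAccIn.exists_step (hlead.1 n h) (by simp)
    rw [ht] at htr
    cases htr with
    | copyFst_comma s =>
      rw [hmove] at hacc
      have hmet := met_of_accIn hx (l := [.goal s γ]) (q := k) (show t - 1 ≤ _ by omega) hacc
      cases s with
      | single => exact ⟨_, hmet.1⟩
      | double => exact ⟨_, hmet.1⟩
  · rintro ⟨u, hu⟩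
    obtain ⟨s, hs⟩ := hu.exists_shape
    have hm := Nat.mul_le_mul_right (w + 1) (Shape.cost_le s k)
    have hk' : k ≤ H := by omega
    have hrun := acc_of_hasVal (H := H) hx hw hu hs (l := []) (p := t - 1)
      (by simp only [goalStack, List.length_nil]; omega) (fun p hp => ?_) (by omega)
    · have hf : (GoalSymbol.goal s :: (goalBits (name γ) ++ [])).length ≤ H := hrun.fits.1
      refine hlead.2 (GoalAcc.of_tr (o₁ := some (some (.goal s))) (o₂ := none) (d := .stay)
        (by rw [ht]; exact .copyFst_comma ..) hrun hmove rfl rfl ?_ (by simpa using hk'))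
      simp only [List.length_cons] at hf
      omega
    · refine GoalAcc.of_tr (q' := .done) (d := .stay) (o₁ := none) (o₂ := none) (.run_end ..)
        ⟨0, .halt _ _ ⟨?_, ?_⟩ rfl⟩ (min_moveHead_stay hp) rfl rfl
        (by simp [goalStack]) (by simpa using hk')
      · exact Nat.zero_le _
      · exact (length_units k).le.trans hk'

end

end Oscillation

-- Reading the encoding

namespace Oscillation

open NTM (inputCell)

/-- From cell `p` to its end, the input reads `s`. -/
def ReadsFrom (x : List Letter) (p : ℕ) (s : List Letter) : Prop :=
  ∃ pre, x = pre ++ s ∧ p = pre.length + 1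

section

variable {x s w : List Letter} {p : ℕ} {a : Letter}

theorem ReadsFrom.append (h : ReadsFrom x p (w ++ s)) : ReadsFrom x (p + w.length) s := by
  obtain ⟨pre, rfl, rfl⟩ := h
  exact ⟨pre ++ w, by simp, by simp; omega⟩

theorem ReadsFrom.cons (h : ReadsFrom x p (a :: s)) : ReadsFrom x (p + 1) s :=
  h.append (w := [a])

theorem ReadsFrom.cell (h : ReadsFrom x p (a :: s)) : inputCell x p = .letter a := by
  obtain ⟨pre, rfl, rfl⟩ := h
  simp [inputCell]

theorem ReadsFrom.cell_nil (h : ReadsFrom x p []) : inputCell x p = .rightEnd := by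
  obtain ⟨pre, rfl, rfl⟩ := h
  simp [inputCell]

theorem ReadsFrom.exists_mem (h : ReadsFrom x p (w ++ s)) {j : ℕ} (hj : j < w.length) :
    ∃ a ∈ w, inputCell x (p + j) = .letter a := by
  obtain ⟨pre, rfl, rfl⟩ := h
  refine ⟨w[j], List.getElem_mem hj, ?_⟩
  rw [show pre.length + 1 + j = (pre.length + j) + 1 by omega]
  simp [inputCell, List.getElem?_append_right, List.getElem?_append_left hj,
    List.getElem?_eq_getElem hj]

theorem ReadsFrom.fieldAt_bits {bs : List Bool}
    (h : ReadsFrom x p ((bs.map .bit ++ [.comma]) ++ s)) : FieldAt x p bs := by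
  induction bs generalizing p with
  | nil => exact h.cell
  | cons b bs ih => exact ⟨h.cell, ih h.cons⟩

theorem ReadsFrom.fieldAt {n : ℕ} (h : ReadsFrom x p (encodeNat n ++ s)) :
    FieldAt x p n.bits :=
  h.fieldAt_bits

theorem length_encodeNat (n : ℕ) : (encodeNat n).length = n.bits.length + 1 := by
  simp [encodeNat]

theorem ReadsFrom.encodeNat {n : ℕ} (h : ReadsFrom x p (encodeNat n ++ s)) :
    ReadsFrom x (p + n.bits.length + 1) s := by
  have := h.append
  rwa [length_encodeNat] at this

theorem FieldAt.bit {bs : List Bool} (h : FieldAt x p bs) {j : ℕ} (hj : j < bs.length) :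
    inputCell x (p + j) = .letter (.bit bs[j]) := by
  induction bs generalizing p j with
  | nil => simp at hj
  | cons b bs ih =>
    cases j with
    | zero => exact h.1
    | succ j =>
      have := ih h.2 (j := j) (by simpa using hj)
      rwa [show p + (j + 1) = p + 1 + j by omega]

theorem FieldAt.bitField {bs : List Bool} (h : FieldAt x (p + 1) bs) :
    BitField x p bs.length where
  bit t ht := ⟨_, h.bit ht⟩
  comma := by rw [show p + bs.length + 1 = p + 1 + bs.length by omega]; exact h.comma

end

theorem mem_encodeNat {n : ℕ} {a : Letter} (h : a ∈ encodeNat n) :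
    a = .comma ∨ ∃ b, a = .bit b := by
  simp only [encodeNat, List.mem_append, List.mem_map, List.mem_singleton] at h
  rcases h with ⟨b, -, rfl⟩ | rfl
  · exact .inr ⟨b, rfl⟩
  · exact .inl rfl

theorem bits_injective : Function.Injective Nat.bits := fun m n h => by
  refine Nat.eq_of_testBit_eq fun i => ?_
  rw [Nat.testBit_eq_inth, Nat.testBit_eq_inth, h]

theorem length_bits_le {m n : ℕ} (h : m ≤ n) : m.bits.length ≤ n.bits.length := by
  rw [Nat.size_eq_bits_len, Nat.size_eq_bits_len]
  exact Nat.size_le_size h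

theorem lt_two_pow_length_bits (n : ℕ) : n < 2 ^ n.bits.length := by
  rw [Nat.size_eq_bits_len]
  exact Nat.lt_size_self n

theorem two_pow_length_bits_le (n : ℕ) : 2 ^ n.bits.length ≤ 2 * max n 1 := by
  rw [Nat.size_eq_bits_len]
  cases h : n.size with
  | zero => simp; omega
  | succ m =>
    have := Nat.lt_size.1 (show m < n.size by omega)
    rw [pow_succ]
    omega

theorem length_bits_le_log {n N : ℕ} (hn : n ≤ N) :
    n.bits.length ≤ Nat.log 2 N + 1 := by
  rw [Nat.size_eq_bits_len, Nat.size_le]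
  exact hn.trans_lt (Nat.lt_pow_succ_log_self one_lt_two N)


/-- The encoding of the label of an action, without the comma at its end. -/
def labelWord : Option ℕ → List Letter
  | none => [.eps]
  | some a => a.bits.map .bit

theorem mem_labelWord {b : Option ℕ} {a : Letter} (h : a ∈ labelWord b) :
    a = .eps ∨ ∃ b, a = .bit b := by
  cases b with
  | none => exact .inl (List.mem_singleton.1 h)
  | some n =>
    obtain ⟨b, -, rfl⟩ := List.mem_map.1 h
    exact .inr ⟨b, rfl⟩

section

variable {Q S Γ : Type} {nQ nS nΓ : ℕ} (eQ : Q ≃ Fin nQ) (eS : S ≃ Fin nS) (eΓ : Γ ≃ Fin nΓ)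

/-- The encoding of an action for the given numberings. -/
def actionWord (t : Q × Option S × Γ × Q × List Γ) : List Letter :=
  encodeAction ((eQ t.1 : ℕ), t.2.1.map (fun a => (eS a : ℕ)), (eΓ t.2.2.1 : ℕ),
    (eQ t.2.2.2.1 : ℕ), t.2.2.2.2.map fun γ => (eΓ γ : ℕ))

/-- The name of a stack symbol. -/
def symbolName (γ : Γ) : List Bool := (eΓ γ : ℕ).bits

theorem symbolName_injective : Function.Injective (symbolName eΓ) :=
  bits_injective.comp (Fin.val_injective.comp eΓ.injective)

theorem length_symbolName_le (γ : Γ) : (symbolName eΓ γ).length ≤ nΓ.bits.length :=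
  length_bits_le (eΓ γ).isLt.le

-- A single state can only have number `0`, which has no bits.
variable {eQ} in
theorem encodeNat_of_subsingleton [Subsingleton Q] (q : Q) :
    encodeNat (eQ q : ℕ) = [.comma] := by
  have : nQ ≤ 1 := by
    by_contra h
    have := eQ.symm.injective.ne (a₁ := ⟨0, by omega⟩) (a₂ := ⟨1, by omega⟩) (by simp)
    exact this (Subsingleton.elim _ _)
  have := (eQ q).isLt
  rw [show (eQ q : ℕ) = 0 by omega]
  rfl

theorem actionWord_eq [Subsingleton Q] (q : Q) (b : Option S) (γ : Γ) (p : Q) (ξ : List Γ) :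
    actionWord eQ eS eΓ (q, b, γ, p, ξ) =
      .action :: .comma :: (labelWord (b.map fun a => (eS a : ℕ)) ++
        .comma :: (encodeNat (eΓ γ : ℕ) ++
          .comma :: ξ.flatMap fun γ => encodeNat (eΓ γ : ℕ))) := by
  cases b <;>
    simp [actionWord, encodeAction, encodeNat_of_subsingleton, labelWord, List.flatMap_map,
      show encodeNat (eS _ : ℕ) = _ ++ [Letter.comma] from rfl]

variable {eQ eS eΓ}

theorem eq_nil_or_cons_of_flatMap_actionWord (l : List (Q × Option S × Γ × Q × List Γ)) :
    l.flatMap (actionWord eQ eS eΓ) = [] ∨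
      ∃ s, l.flatMap (actionWord eQ eS eΓ) = .action :: s := by
  cases l with
  | nil => exact .inl rfl
  | cons t l => exact .inr ⟨_, rfl⟩

theorem ReadsFrom.action_or_rightEnd {x : List Letter} {p : ℕ}
    {l : List (Q × Option S × Γ × Q × List Γ)}
    (h : ReadsFrom x p (l.flatMap (actionWord eQ eS eΓ))) :
    inputCell x p = .letter .action ∨ inputCell x p = .rightEnd := by
  rcases eq_nil_or_cons_of_flatMap_actionWord (eQ := eQ) (eS := eS) (eΓ := eΓ) l with hs | ⟨s, hs⟩
  · exact .inr (hs ▸ h).cell_nil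
  · exact .inl (hs ▸ h).cell

theorem ReadsFrom.actionAt [Subsingleton Q] {x : List Letter} {i : ℕ}
    {l : List (Q × Option S × Γ × Q × List Γ)} {q : Q} {b : Option S} {γ : Γ} {p : Q} {ξ : List Γ}
    (hξ : ξ.length = 0 ∨ ξ.length = 2)
    (h : ReadsFrom x i (actionWord eQ eS eΓ (q, b, γ, p, ξ) ++
      l.flatMap (actionWord eQ eS eΓ))) :
    ActionAt x (symbolName eΓ) i (labelWord (b.map fun a => (eS a : ℕ))).length γ ξ := by
  rw [actionWord_eq] at h
  simp only [List.cons_append, List.append_assoc] at h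
  have h₁ := h.cons
  have h₂ := h₁.cons
  have h₃ := h₂.append
  have h₄ := h₃.cons
  have h₅ := h₄.encodeNat
  have h₆ := h₅.cons
  refine ⟨h.cell, h₁.cell, fun j hj => ?_, h₃.cell, h₄.fieldAt, h₅.cell, ?_⟩
  · obtain ⟨a, ha, hc⟩ := h₂.exists_mem hj
    rw [show i + 2 = i + 1 + 1 from rfl, hc]
    rcases mem_labelWord ha with rfl | ⟨b, rfl⟩
    · exact .inl rfl
    · exact .inr ⟨b, rfl⟩
  · match ξ, hξ with
    | [], _ => exact h₆.action_or_rightEnd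
    | [γ₁, γ₂], _ =>
      simp only [List.flatMap_cons, List.flatMap_nil, List.append_assoc] at h₆
      exact ⟨h₆.fieldAt, h₆.encodeNat.fieldAt⟩

/-- Hence each letter `action` on the input marks the beginning of an action, so a head that stops
at such a letter is correctly aligned. -/
theorem action_notMem_tail_actionWord [Subsingleton Q] (t : Q × Option S × Γ × Q × List Γ) :
    Letter.action ∉ (actionWord eQ eS eΓ t).tail := by
  obtain ⟨q, b, γ, p, ξ⟩ := t
  have hN : ∀ n, Letter.action ∉ encodeNat n := fun n h => by
    rcases mem_encodeNat h with h | ⟨_, h⟩ <;> cases h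
  have hL : ∀ b, Letter.action ∉ labelWord b := fun n h => by
    rcases mem_labelWord h with h | ⟨_, h⟩ <;> cases h
  simp [actionWord_eq, hN, hL]

theorem ReadsFrom.exists_actionWord [Subsingleton Q] {x : List Letter} {i j : ℕ}
    {l : List (Q × Option S × Γ × Q × List Γ)}
    (h : ReadsFrom x i (l.flatMap (actionWord eQ eS eΓ))) (hij : i ≤ j)
    (hj : inputCell x j = .letter .action) :
    ∃ t ∈ l, ∃ l' : List (Q × Option S × Γ × Q × List Γ),
      ReadsFrom x j (actionWord eQ eS eΓ t ++ l'.flatMap (actionWord eQ eS eΓ)) := by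
  induction l generalizing i with
  | nil =>
    obtain ⟨pre, hx, rfl⟩ := h
    have := (inputCell_eq_letter_le hj).2
    simp only [List.flatMap_nil, List.append_nil] at hx
    subst hx
    omega
  | cons t l ih =>
    rw [List.flatMap_cons] at h
    rcases Nat.lt_or_ge j (i + (actionWord eQ eS eΓ t).length) with hlt | hge
    · rcases hij.eq_or_lt with rfl | hij
      · exact ⟨t, by simp, l, h⟩
      · exfalso
        have htail : actionWord eQ eS eΓ t = .action :: (actionWord eQ eS eΓ t).tail := rfl
        rw [htail, List.length_cons] at hlt
        rw [htail, List.cons_append] at h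
        obtain ⟨a, ha, hc⟩ := h.cons.exists_mem (j := j - (i + 1)) (by omega)
        rw [show i + 1 + (j - (i + 1)) = j by omega, hj] at hc
        cases hc
        exact action_notMem_tail_actionWord t ha
    · obtain ⟨t', ht', l', h'⟩ := ih h.append hge
      exact ⟨t', List.mem_cons_of_mem _ ht', l', h'⟩

theorem ReadsFrom.listsActions [Subsingleton Q] {P : PDA Q S Γ} (hP : P.IsReduced)
    {x : List Letter} {i : ℕ} {l : List (Q × Option S × Γ × Q × List Γ)}
    (hl : ∀ t, t ∈ l ↔ t ∈ P.actions)
    (h : ReadsFrom x i (l.flatMap (actionWord eQ eS eΓ)))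
    (hi : ∀ j < i, inputCell x j ≠ .letter .action) : ListsActions x P (symbolName eΓ) where
  name_injective := symbolName_injective eΓ
  exists_rule j hj := by
    obtain ⟨⟨q, b, γ, p, ξ⟩, ht, l', h'⟩ :=
      h.exists_actionWord (not_lt.1 fun hlt => hi j hlt hj) hj
    have ht' := (hl _).1 ht
    exact ⟨_, γ, ξ, ⟨q, b, p, ht'⟩, h'.actionAt (hP.2 _ _ _ _ _ ht')⟩
  exists_action γ ξ := by
    rintro ⟨q, b, p, ht⟩
    obtain ⟨l₁, l₂, rfl⟩ := List.append_of_mem ((hl _).2 ht)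
    rw [List.flatMap_append, List.flatMap_cons] at h
    exact ⟨_, _, h.append.actionAt (hP.2 _ _ _ _ _ ht)⟩

theorem length_actionWord_le [Subsingleton Q] (t : Q × Option S × Γ × Q × List Γ)
    (ht : t.2.2.2.2.length = 0 ∨ t.2.2.2.2.length = 2) :
    (actionWord eQ eS eΓ t).length ≤ nS.bits.length + 3 * nΓ.bits.length + 8 := by
  obtain ⟨q, b, γ, p, ξ⟩ := t
  have hb : (labelWord (b.map fun a => (eS a : ℕ))).length ≤ nS.bits.length + 1 := by
    cases b with
    | none => simp [labelWord]
    | some a =>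
      have := length_bits_le (eS a).isLt.le
      simp only [Option.map_some, labelWord, List.length_map]
      omega
  have hΓ (γ : Γ) : (encodeNat (eΓ γ : ℕ)).length ≤ nΓ.bits.length + 1 := by
    rw [length_encodeNat]
    exact Nat.succ_le_succ (length_symbolName_le eΓ γ)
  have hγ := hΓ γ
  rw [actionWord_eq]
  match ξ, ht with
  | [], _ =>
    simp only [List.length_cons, List.length_append, List.flatMap_nil, List.length_nil]
    omega
  | [γ₁, γ₂], _ =>
    have h₁ := hΓ γ₁
    have h₂ := hΓ γ₂
    simp only [List.length_cons, List.length_append, List.flatMap_nil, List.length_nil,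
      List.flatMap_cons]
    omega

/-- With one state and right hand sides of length zero or two, an action is determined by its label,
its source and the first two entries of its right hand side, if any. The bound avoids `|δ|` because
the marked space depends only on `k` and the sizes of the three sets. -/
theorem length_actions_le [Subsingleton Q] (eS : S ≃ Fin nS) (eΓ : Γ ≃ Fin nΓ)
    {l : List (Q × Option S × Γ × Q × List Γ)} (hl : l.Nodup)
    (hξ : ∀ t ∈ l, t.2.2.2.2.length = 0 ∨ t.2.2.2.2.length = 2) :
    l.length ≤ (nS + 1) * (nΓ * ((nΓ + 1) * (nΓ + 1))) := by
  classical
  let f : Q × Option S × Γ × Q × List Γ → Option (Fin nS) × Fin nΓ × Option (Fin nΓ) ×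
      Option (Fin nΓ) := fun t =>
    (t.2.1.map eS, eΓ t.2.2.1, t.2.2.2.2[0]?.map eΓ, t.2.2.2.2[1]?.map eΓ)
  have hf : Set.InjOn f {t | t ∈ l} := by
    rintro ⟨q, b, γ, p, ξ⟩ ht ⟨q', b', γ', p', ξ'⟩ ht' h
    simp only [f, Prod.mk.injEq, (Option.map_injective eS.injective).eq_iff,
      (Option.map_injective eΓ.injective).eq_iff, eΓ.injective.eq_iff] at h
    obtain ⟨rfl, rfl, h₀, h₁⟩ := h
    obtain rfl := Subsingleton.elim q q'
    obtain rfl := Subsingleton.elim p p'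
    have hξ₁ := hξ _ ht
    have hξ₂ := hξ _ ht'
    match ξ, ξ', hξ₁, hξ₂ with
    | [], [], _, _ => rfl
    | [], [_, _], _, _ => simp at h₀
    | [_, _], [], _, _ => simp at h₀
    | [_, _], [_, _], _, _ => simp at h₀ h₁; simp [h₀, h₁]
  have hmap : (l.map f).Nodup := hl.map_on fun a ha b hb h => hf ha hb h
  have := hmap.length_le_card
  simpa using this

end

end Oscillation

-- Numerical bounds and conclusion

namespace Oscillation

open NTM (inputCell)
open StackMachine (markedSpace)

theorem add_le_markedSpace (m a b c : ℕ) : m + (a + b + c + 3) ≤ markedSpace m a b c := by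
  have h₁ : m + 1 < 2 ^ (m + 1) := Nat.lt_two_pow_self
  have h₂ : (m + 1) * (a + b + c + 3) ≤ markedSpace m a b c :=
    Nat.mul_le_mul_right _ (by omega)
  refine le_trans ?_ h₂
  rw [add_mul, one_mul]
  exact Nat.add_le_add_right (Nat.le_mul_of_pos_right _ (by omega)) _

/-- The clock must also count input head positions. The input length is at most exponential in the
bit lengths `m`, `a`, `b`, `c`, hence in the marked space; the base `64 = 2 ^ 6` absorbs the summand
`6 * c` in the exponent. -/
theorem add_two_le_pow_markedSpace {m a b c n len : ℕ} (hn : n ≤ 2 ^ (b + 3 * c))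
    (hlen : len ≤ m + a + b + 2 * c + 6 + n * (b + 3 * c + 8)) :
    len + 2 ≤ 64 ^ markedSpace m a b c := by
  have h₁ : m + a + b + 2 * c + 8 < 2 ^ (m + a + b + 2 * c + 8) := Nat.lt_two_pow_self
  have h₂ : b + 3 * c + 8 < 2 ^ (b + 3 * c + 8) := Nat.lt_two_pow_self
  have h₃ := Nat.mul_le_mul hn h₂.le
  rw [← pow_add] at h₃
  have h₄ : 2 ^ (m + a + b + 2 * c + 8) ≤ 2 ^ (m + a + 2 * b + 6 * c + 8) :=
    Nat.pow_le_pow_right two_pos (by omega)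
  have h₅ : 2 ^ (b + 3 * c + (b + 3 * c + 8)) ≤ 2 ^ (m + a + 2 * b + 6 * c + 8) :=
    Nat.pow_le_pow_right two_pos (by omega)
  have h₆ := add_le_markedSpace m a b c
  have h₇ : 2 ^ (m + a + 2 * b + 6 * c + 8 + 1) ≤ 2 ^ (6 * markedSpace m a b c) :=
    Nat.pow_le_pow_right two_pos (by omega)
  rw [pow_succ] at h₇
  rw [show 64 = 2 ^ 6 by norm_num, ← pow_mul]
  omega

theorem StackMachine.ncard_bounded_le_pow {A : Type} (M : StackMachine A) (x : List A) {D H : ℕ}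
    (hH : H ≠ 0) (hx : x.length + 2 ≤ D ^ H) :
    (M.bounded x H).ncard ≤
      (Nat.card M.State * (D * ((Nat.card M.Symbol + 1) * (Nat.card M.Symbol + 1)))) ^ H := by
  rw [mul_pow, mul_pow, mul_pow]
  exact (M.ncard_bounded_le x H).trans
    (Nat.mul_le_mul (Nat.le_self_pow hH _) (Nat.mul_le_mul_right _ hx))

/-- From `k < 2 ^ m`, with `m` the bit length of `k`, there are at least `2 * k + 1` sweeps. Each is
long enough for a goal of `c + 1` cells with a cell to spare, and the spare cells cover the summand
`k`. -/
theorem height_le_markedSpace (k a b c : ℕ) :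
    (2 * k + 1) * (c + 1) + k ≤ markedSpace k.bits.length a b c := by
  have h₁ := lt_two_pow_length_bits k
  have h₂ : (2 * k + 1) * (a + b + c + 3) ≤ markedSpace k.bits.length a b c :=
    Nat.mul_le_mul_right _ (by rw [pow_succ]; omega)
  have h₃ : (2 * k + 1) * (c + 1 + 1) ≤ (2 * k + 1) * (a + b + c + 3) :=
    Nat.mul_le_mul_left _ (by omega)
  have h₄ : (2 * k + 1) * (c + 1 + 1) = (2 * k + 1) * (c + 1) + (2 * k + 1) := by ring
  omega

/-- The counter tree has at most `4 * K` leaves, `K = max k 1`, and a sweep has `a + b + c + 3 ≤ 3 *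
L + 6 ≤ 9 * L` cells. The two cells for the markers turn `36` into `38`. -/
theorem space_le {k a b c L : ℕ} (hL : 1 ≤ L) (ha : a ≤ L + 1) (hb : b ≤ L + 1)
    (hc : c ≤ L + 1) :
    k.bits.length + 2 ≤ 38 * (max k 1 * L) ∧
      markedSpace k.bits.length a b c + 2 ≤ 38 * (max k 1 * L) := by
  have h₁ := two_pow_length_bits_le k
  have h₂ : k.bits.length < 2 ^ k.bits.length := Nat.lt_two_pow_self
  have hK : 1 ≤ max k 1 := le_max_right _ _
  generalize max k 1 = K at *
  have h₃ : markedSpace k.bits.length a b c ≤ 4 * K * (9 * L) :=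
    Nat.mul_le_mul (by rw [pow_succ]; omega) (by omega)
  have h₄ : K ≤ K * L := Nat.le_mul_of_pos_right _ hL
  have h₅ : 4 * K * (9 * L) = 36 * (K * L) := by ring
  omega

/-- The machine for `k`-emptiness. -/
noncomputable def emptinessMachine : NTM Letter :=
  -- This base makes `B ^ H` bound the number of configurations: one factor each for the state, the
  -- input head and the two stacks.
  goalMachine.compile (Nat.card goalMachine.State *
    (64 * ((Nat.card goalMachine.Symbol + 1) * (Nat.card goalMachine.Symbol + 1))))

theorem length_flatMap_le {α β : Type} {f : α → List β} {n : ℕ} (l : List α)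
    (h : ∀ t ∈ l, (f t).length ≤ n) : (l.flatMap f).length ≤ l.length * n := by
  rw [List.length_flatMap, ← List.length_map (f := fun t => (f t).length)]
  exact List.sum_le_card_nsmul _ _ (by simpa using h)

theorem emptinessMachine_spec {Q S Γ : Type} [Fintype Q] [Fintype S] [Fintype Γ]
    {P : PDA Q S Γ} {k : ℕ} {x : List Letter} (hP : P.IsReduced) (hx : IsEncoding P k x) :
    (emptinessMachine.Accepts x ↔ ∃ w, w ∈ P.oscLanguage k) ∧ emptinessMachine.HaltsOn x ∧
      emptinessMachine.SpaceOn x (38 * (max k 1 * Nat.log 2 P.size)) := by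
  have : Subsingleton Q := hP.1
  have hQ : 0 < Fintype.card Q := Fintype.card_pos_iff.2 ⟨P.startState⟩
  have hΓ : 0 < Fintype.card Γ := Fintype.card_pos_iff.2 ⟨P.startSymbol⟩
  obtain ⟨eQ, eS, eΓ, l, hnodup, hl, hx⟩ := hx
  have hsize : P.size = Fintype.card Q + Fintype.card S + Fintype.card Γ + P.actions.card := rfl
  -- There are a start state and a start symbol, so the size is at least two and additive constants
  -- are absorbed by the logarithm.
  have hL : 1 ≤ Nat.log 2 P.size := Nat.log_pos one_lt_two (by omega)
  obtain ⟨hsp, hH⟩ := space_le (k := k) hL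
    (length_bits_le_log (n := Fintype.card Q) (by omega))
    (length_bits_le_log (n := Fintype.card S) (by omega))
    (length_bits_le_log (n := Fintype.card Γ) (by omega))
  change x = _ ++ l.flatMap (actionWord eQ eS eΓ) at hx
  have h : ReadsFrom x 1 (_ ++ l.flatMap (actionWord eQ eS eΓ)) := ⟨[], hx, rfl⟩
  have hxlen := congrArg List.length hx
  have h₁ := h
  simp only [List.append_assoc, encodeNat_of_subsingleton (eQ := eQ)] at h₁
  have h₂ := h₁.encodeNat
  have h₃ := h₂.encodeNat
  have h₄ := h₃.encodeNat
  have h₅ := h₄.encodeNat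
  have h₆ := h₅.append (w := [.comma])
  have h₇ := h₆.encodeNat
  simp only [List.length_append, length_encodeNat, encodeNat_of_subsingleton (eQ := eQ)] at hxlen
  set m := k.bits.length with hm
  set a := (Fintype.card Q).bits.length
  set b := (Fintype.card S).bits.length with hb
  set c := (Fintype.card Γ).bits.length with hc
  have hname := length_symbolName_le eΓ P.startSymbol
  have hcell : ∀ j, 1 ≤ j → j < 1 + m + 1 + a + 1 + b + 1 + c + 1 + 1 +
      (symbolName eΓ P.startSymbol).length + 1 →
      inputCell x j = .letter .comma ∨ ∃ b, inputCell x j = .letter (.bit b) := by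
    intro j hj hj'
    obtain ⟨a, ha, hcell⟩ := h.exists_mem (j := j - 1) (by
      simp only [List.length_append, length_encodeNat, encodeNat_of_subsingleton (eQ := eQ)]
      change _ < m + 1 + (a + 1) + (b + 1) + (c + 1) + [Letter.comma].length +
        ((symbolName eΓ P.startSymbol).length + 1)
      simp only [List.length_singleton]
      omega)
    rw [show 1 + (j - 1) = j by omega] at hcell
    have ha' : a = .comma ∨ ∃ b, a = .bit b := by
      simp only [List.mem_append] at ha
      obtain ((((ha | ha) | ha) | ha) | ha) | ha := ha <;> exact mem_encodeNat ha
    rw [hcell]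
    rcases ha' with rfl | ⟨b, rfl⟩
    · exact .inl rfl
    · exact .inr ⟨b, rfl⟩
  have hlists : ListsActions x P (symbolName eΓ) := by
    refine h₇.listsActions hP hl fun j hj hcj => ?_
    rcases hcell j (inputCell_eq_letter_le hcj).1 hj with h | ⟨_, h⟩ <;> rw [h] at hcj <;> cases hcj
  have hξ : ∀ t ∈ l, t.2.2.2.2.length = 0 ∨ t.2.2.2.2.length = 2 := fun t ht =>
    hP.2 _ _ _ _ _ ((hl t).1 ht)
  have hlen : x.length + 2 ≤ 64 ^ markedSpace m a b c := by
    refine add_two_le_pow_markedSpace (n := l.length) ?_ ?_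
    · have hS := lt_two_pow_length_bits (Fintype.card S)
      have hΓ := lt_two_pow_length_bits (Fintype.card Γ)
      rw [← hb] at hS
      rw [← hc] at hΓ
      refine (length_actions_le eS eΓ hnodup hξ).trans ?_
      rw [pow_add, show 3 * c = c + (c + c) by ring, pow_add, pow_add]
      exact Nat.mul_le_mul hS (Nat.mul_le_mul hΓ.le (Nat.mul_le_mul hΓ hΓ))
    · have := length_flatMap_le (f := actionWord eQ eS eΓ) l
        fun t ht => length_actionWord_le t (hξ t ht)
      rw [← hb, ← hc] at this
      simp only [symbolName] at hname
      simp only [List.length_singleton] at hxlen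
      omega
  have hpos : markedSpace m a b c ≠ 0 := by
    have := add_le_markedSpace m a b c
    omega
  obtain ⟨hacc, hhalt, hspace⟩ := goalMachine.compile_spec (h₁.fieldAt.bitField (p := 0))
    (FieldAt.bitField (p := m + 1) (by rw [show m + 1 + 1 = 1 + m + 1 by omega]; exact h₂.fieldAt))
    (FieldAt.bitField (p := m + 1 + a + 1) (by
      rw [show m + 1 + a + 1 + 1 = 1 + m + 1 + a + 1 by omega]; exact h₃.fieldAt))
    (FieldAt.bitField (p := m + 1 + a + 1 + b + 1) (by
      rw [show m + 1 + a + 1 + b + 1 + 1 = 1 + m + 1 + a + 1 + b + 1 by omega]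
      exact h₄.fieldAt))
    hsp hH (StackMachine.ncard_bounded_le_pow goalMachine x hpos hlen)
  refine ⟨hacc.trans (Iff.trans ?_ (PDA.exists_mem_oscLanguage_iff hP k).symm), hhalt, hspace⟩
  refine goalAcc_iff hlists (length_symbolName_le eΓ) (height_le_markedSpace k a b c)
    (fun j hj => ?_) (lt_two_pow_length_bits k)
    (fun j hj hj' => hcell j hj (Nat.lt_succ_of_le hj')) h₆.fieldAt h₅.cell
    h₇.action_or_rightEnd
  rw [add_comm j, h₁.fieldAt.bit hj, Nat.testBit_eq_inth, List.getI_eq_getElem _ hj]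

end Oscillation

theorem theorem3 :
    ∃ (M : Oscillation.NTM Oscillation.Letter) (c : ℕ),
      ∀ (Q S Γ : Type) [Fintype Q] [Fintype S] [Fintype Γ]
        (P : Oscillation.PDA Q S Γ) (k : ℕ) (x : List Oscillation.Letter),
        P.IsReduced → Oscillation.IsEncoding P k x →
          (M.Accepts x ↔ ∃ w, w ∈ P.oscLanguage k) ∧
          M.HaltsOn x ∧
          M.SpaceOn x (c * (max k 1 * Nat.log 2 P.size)) :=
  ⟨Oscillation.emptinessMachine, 38, fun _ _ _ _ _ _ _ _ _ hP hx =>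
    Oscillation.emptinessMachine_spec hP hx⟩
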